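/- **Setting.** Let $V_1,\dots,V_k$ be finite sets and let $\mu$ be a probability measure on $V_1\times\cdots\times V_k$. For $S\subseteq[k]$ let $\mu_S$ be the projection of $\mu$ on the coordinates in $S$, let $V_S$ be the support of $\mu_S$, and for $x\in V_S$ let $\mu_x(y)=\mu(x,y)/\mu_S(x)$ be the link of $x$, a probability measure on the remaining coordinates. A probability measure $\nu$ on a product $A\times B$ of two finite sets, with marginals $\nu_1,\nu_2$, is called $\epsilon$-pseudorandom if for all $g\colon A\to\mathbb R$, $h\colon B\to\mathbb R$ $$\bigl|\mathbb E_{(a,b)\sim\nu}[g(a)h(b)]-\mathbb E_{\nu_1}[g]\,\mathbb E_{\nu_2}[h]\bigr|\le\epsilon\sqrt{\mathrm{Var}_{\nu_1}[g]\,\mathrm{Var}_{\nu_2}[h]} .$$ Assume that $\mu$ is an $\epsilon$-product measure ($\epsilon\ge 0$), that is, for every $S$ with $|S|\le k-2$, every $x\in V_S$ and every pair $i\ne j$ outside $S$, the projection of the link $\mu_x$ on coordinates $i,j$ is $\epsilon$-pseudorandom. (This is the setting for high dimensional expanders, $\epsilon$-HDX.) For $f\colon V_{[k]}\to\mathbb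 R$ put $A_Sf(x)=\mathbb E_{y\sim\mu}[f(y)\mid y_S=x_S]$, $f^{=S}=\sum_{T\subseteq S}(-1)^{|S\setminus T|}A_Tf$ and $\|f\|_2^2=\mathbb E_\mu[f^2]$. For $\rho\in(0,1)$ let $$\mathrm T_\rho f=\sum_{S\subseteq[k]}\rho^{|S|}(1-\rho)^{k-|S|}A_Sf .$$ Equivalently $\mathrm T_\rho f(x)=\mathbb E_{y\sim N_\rho(x)}f(y)$, where $y\sim N_\rho(x)$ is obtained by putting each coordinate in a random set $S$ independently with probability $\rho$, keeping $x_S$, and drawing the other coordinates from the link $\mu_{x_S}$. For an integer $d\ge0$ and real $\delta$, $f$ is $(d,\delta)$-global if $\|f(x,\cdot)\|_{L^2(\mu_x)}\le\delta$ for all $|S|\le d$ and all $x\in V_S$. **Theorem.** For every $k$ there is a constant $C_k>0$, depending only on $k$, such that for all $V_1,\dots,V_k$, all $\epsilon\ge0$, all $\epsilon$-product measures $\mu$ on $V_1\times\cdots\times V_k$ and all $\rho\in(0,1)$: 1. $\mathrm T_\rho f=\sum_{S\subseteq[k]}\rho^{|S|}f^{=S}$ for every $f\colon V_{[k]}\to\mathbb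 R$. 2. If $f\colon V_{[k]}\to\{0,1\}$ is $(d,\delta)$-global, then (with the convention $0^0=1$ when $d=0$) $$\|\mathrm T_\rho f\|_2^2\le B\,\|f\|_2^2,\qquad B:=\rho^d+(100d)^d\delta^2+C_k\sqrt\epsilon .$$ 3. Hence, for such $f=1_A$, the noisy random walk leaves $A$: $$\Pr_{x\sim\mu,\;y\sim N_\rho(x)}[x\in A,\ y\notin A]\ \ge\ \bigl(1-\sqrt{B}\bigr)\,\mu(A).$$ -/

import Mathlib

namespace HDX

noncomputable section

/-- Expectation of `g` under the weights `ν` on a finite set. -/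
def expect {α : Type*} [Fintype α] (ν : α → ℝ) (g : α → ℝ) : ℝ :=
  ∑ x, ν x * g x

/-- Variance of `g` under the weights `ν`. -/
def variance {α : Type*} [Fintype α] (ν : α → ℝ) (g : α → ℝ) : ℝ :=
  expect ν (fun x => (g x - expect ν g) ^ 2)

/-- `‖g‖₂²` in `L²(ν)`. -/
def normSq {α : Type*} [Fintype α] (ν : α → ℝ) (g : α → ℝ) : ℝ :=
  expect ν (fun x => g x ^ 2)

/-- `‖g‖₂` in `L²(ν)`. -/
def norm₂ {α : Type*} [Fintype α] (ν : α → ℝ) (g : α → ℝ) : ℝ :=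
  Real.sqrt (normSq ν g)

/-- First marginal of a weighted bipartite graph. -/
def fstMarginal {α β : Type*} [Fintype β] (ν : α × β → ℝ) (a : α) : ℝ :=
  ∑ b, ν (a, b)

/-- Second marginal of a weighted bipartite graph. -/
def sndMarginal {α β : Type*} [Fintype α] (ν : α × β → ℝ) (b : β) : ℝ :=
  ∑ a, ν (a, b)

/-- `ε`-pseudorandom weighted bipartite graphs. -/
def IsPseudorandom {α β : Type*} [Fintype α] [Fintype β] (ε : ℝ) (ν : α × β → ℝ) : Prop :=
  ∀ (g : α → ℝ) (h : β → ℝ),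
    |expect ν (fun p => g p.1 * h p.2) - expect (fstMarginal ν) g * expect (sndMarginal ν) h| ≤
      ε * Real.sqrt (variance (fstMarginal ν) g * variance (sndMarginal ν) h)

open scoped Classical in
/-- The projection `μ_S` of `μ` on the coordinates in `S`. -/
def marginal {k : ℕ} {V : Fin k → Type*} [∀ i, Fintype (V i)] (μ : (∀ i, V i) → ℝ)
    (S : Finset (Fin k)) (a : ∀ i : S, V i) : ℝ :=
  ∑ y, if S.restrict y = a then μ y else 0

open scoped Classical in
/-- The projection of `μ` on the two coordinates `i, j`, as a weighted bipartite graph. -/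
def pairMarginal {k : ℕ} {V : Fin k → Type*} [∀ i, Fintype (V i)] (μ : (∀ i, V i) → ℝ)
    (i j : Fin k) (p : V i × V j) : ℝ :=
  ∑ y, if y i = p.1 ∧ y j = p.2 then μ y else 0

open scoped Classical in
/-- The link of `μ` at `a ∈ V_S`: the conditional law `μ(y) / μ_S(a)` of `y ∼ μ` given `y_S = a`.
It is kept as a weight function on the full product, with the coordinates in `S` frozen to `a`;
its values are those of the measure `μ_a` on the remaining coordinates. It is meaningful when
`a` is in the support of `μ_S`. -/
def link {k : ℕ} {V : Fin k → Type*} [∀ i, Fintype (V i)] (μ : (∀ i, V i) → ℝ)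
    (S : Finset (Fin k)) (a : ∀ i : S, V i) (y : ∀ i, V i) : ℝ :=
  if S.restrict y = a then μ y / marginal μ S a else 0

/-- `μ` is `ε`-product: for every `S` of size at most `k - 2` and every `a` in the support of
`μ_S`, every two-dimensional projection of the link `μ_a` (on coordinates outside `S`) is
`ε`-pseudorandom. -/
def IsEpsProduct {k : ℕ} {V : Fin k → Type*} [∀ i, Fintype (V i)] (ε : ℝ)
    (μ : (∀ i, V i) → ℝ) : Prop :=
  ∀ S : Finset (Fin k), S.card + 2 ≤ k → ∀ a : (∀ i : S, V i), 0 < marginal μ S a →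
    ∀ i j : Fin k, i ∉ S → j ∉ S → i ≠ j → IsPseudorandom ε (pairMarginal (link μ S a) i j)

/-- The averaging operator `A_S f (x) = E_{y ∼ μ}[f(y) | y_S = x_S]`. -/
def avg {k : ℕ} {V : Fin k → Type*} [∀ i, Fintype (V i)] (μ : (∀ i, V i) → ℝ)
    (S : Finset (Fin k)) (f : (∀ i, V i) → ℝ) (x : ∀ i, V i) : ℝ :=
  expect (link μ S (S.restrict x)) f

/-- The Efron--Stein component `f^{=S} = ∑_{T ⊆ S} (-1)^{|S \ T|} A_T f`. -/
def efronStein {k : ℕ} {V : Fin k → Type*} [∀ i, Fintype (V i)] (μ : (∀ i, V i) → ℝ)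
    (S : Finset (Fin k)) (f : (∀ i, V i) → ℝ) (x : ∀ i, V i) : ℝ :=
  ∑ T ∈ S.powerset, (-1 : ℝ) ^ (S \ T).card * avg μ T f x

/-- The noise operator `T_ρ f = ∑_S ρ^{|S|} (1 - ρ)^{k - |S|} A_S f`. -/
def noise {k : ℕ} {V : Fin k → Type*} [∀ i, Fintype (V i)] (μ : (∀ i, V i) → ℝ)
    (ρ : ℝ) (f : (∀ i, V i) → ℝ) (x : ∀ i, V i) : ℝ :=
  ∑ S : Finset (Fin k), ρ ^ S.card * (1 - ρ) ^ (k - S.card) * avg μ S f x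

/-- The law `N_ρ(x)` of one step of the noisy walk from `x`: put each coordinate in a random set
`S` independently with probability `ρ`, keep `x_S` and resample the rest from the link of `x_S`. -/
def noiseStep {k : ℕ} {V : Fin k → Type*} [∀ i, Fintype (V i)] (μ : (∀ i, V i) → ℝ)
    (ρ : ℝ) (x y : ∀ i, V i) : ℝ :=
  ∑ S : Finset (Fin k), ρ ^ S.card * (1 - ρ) ^ (k - S.card) * link μ S (S.restrict x) y

/-- `f` is `(d, δ)`-global: `‖f(a, ·)‖_{L²(μ_a)} ≤ δ` for all `|S| ≤ d` and all `a` in the support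
of `μ_S`. -/
def IsGlobal {k : ℕ} {V : Fin k → Type*} [∀ i, Fintype (V i)] (μ : (∀ i, V i) → ℝ)
    (d : ℕ) (δ : ℝ) (f : (∀ i, V i) → ℝ) : Prop :=
  ∀ S : Finset (Fin k), S.card ≤ d → ∀ a : (∀ i : S, V i), 0 < marginal μ S a →
    norm₂ (link μ S a) f ≤ δ

end

end HDX

namespace HDX

open scoped Classical
open Finset

/-! ### Expectations and L² norms for finite weights -/

section Expect
variable {α : Type*} [Fintype α] {ν : α → ℝ}

/-! Expanding `(1 - ρ)^(k - |S|)` gives `T_ρ f = ∑ ρ^|S| f^{=S}` exactly, for any weights. In an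
`ε`-product measure `A_S A_T` is within `k² ε ‖f‖` of `A_{S ∩ T} f` (`norm₂_avg_avg_sub_le`), so the
Efron–Stein components are orthogonal up to `O_k(ε) ‖f‖²`, and `‖T_ρ f‖²` is close to `∑ ρ^(2i)
W_i`, where `W_i` is the weight of `f` on level `i`. Levels with `2i > d` carry a factor `ρ^(d+1)`,
and level `0` has weight at most `δ² ‖f‖²`. What remains are the levels `1 ≤ i ≤ d/2`, for which a
level inequality for global Boolean functions is needed (`exists_levelWeight_le`).

The level inequality rests on a global hypercontractive estimate (`exists_expect_level_pow_le`): the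
moment of order `2(n+2)` of the level-`i` part is at most `levelRate n ^ i * Λ^(n+1) * W_i` plus an
error linear in `ε`, where `Λ` bounds the weights on levels at most `i` of the links. It is obtained
by splitting off the coordinates one at a time. For each coordinate `v` a two-point inequality
(`add_two_mul_add_pow_le`) separates the components without `v` from those with `v`. The cross term
almost vanishes, since averaging over `v` nearly kills the latter. In the other terms `v` is either
averaged out inside the square, at a cost per coordinate, or kept as a conditioning coordinate, also
at a cost per coordinate.

Boolean duality then closes the argument: `W_i` is almost `⟨f, f^{=i}⟩`, which the moment bounds.
The proper links are handled by strong induction on `i`; the trivial link brings back `W_i` itself,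
so the bound is self-referential and is solved for `W_i / ‖f‖²`.

Every error is kept proportional to `ε ‖f‖²` by estimating all but two factors in sup norm and two
in L². The errors are absorbed by a parameter `D ≥ Γ √ε`, which is the source of the term `C_k √ε`.
The moment order is finally taken to be `4d + 2`. The escape estimate is Cauchy–Schwarz for `⟨f, T_ρ
f⟩`. -/

theorem expect_add (f g : α → ℝ) :
    expect ν (fun x => f x + g x) = expect ν f + expect ν g := by
  simp [expect, mul_add, sum_add_distrib]

theorem expect_sub (f g : α → ℝ) :
    expect ν (fun x => f x - g x) = expect ν f - expect ν g := by
  simp [expect, mul_sub, sum_sub_distrib]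

theorem expect_const_mul (c : ℝ) (f : α → ℝ) :
    expect ν (fun x => c * f x) = c * expect ν f := by
  simp only [expect, mul_sum]
  exact sum_congr rfl fun x _ => by ring

theorem expect_sum {ι : Type*} (s : Finset ι) (f : ι → α → ℝ) :
    expect ν (fun x => ∑ i ∈ s, f i x) = ∑ i ∈ s, expect ν (f i) := by
  simp only [expect, mul_sum]
  exact sum_comm

theorem expect_const (hν : ν ∈ stdSimplex ℝ α) (c : ℝ) : expect ν (fun _ => c) = c := by
  simp [expect, ← sum_mul, hν.2]

theorem expect_congr (hν : ∀ x, 0 ≤ ν x) {f g : α → ℝ} (h : ∀ x, 0 < ν x → f x = g x) :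
    expect ν f = expect ν g := by
  refine sum_congr rfl fun x _ => ?_
  rcases (hν x).eq_or_lt with h0 | h0
  · rw [← h0]; simp
  · rw [h x h0]

theorem expect_mono (hν : ∀ x, 0 ≤ ν x) {f g : α → ℝ} (h : ∀ x, 0 < ν x → f x ≤ g x) :
    expect ν f ≤ expect ν g := by
  refine sum_le_sum fun x _ => ?_
  rcases (hν x).eq_or_lt with h0 | h0
  · rw [← h0]; simp
  · exact mul_le_mul_of_nonneg_left (h x h0) h0.le

theorem expect_nonneg (hν : ∀ x, 0 ≤ ν x) {f : α → ℝ} (h : ∀ x, 0 < ν x → 0 ≤ f x) :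
    0 ≤ expect ν f := by
  have := expect_mono hν (f := fun _ => 0) (g := f) h
  simpa [expect] using this

theorem abs_expect_le (hν : ∀ x, 0 ≤ ν x) (f : α → ℝ) :
    |expect ν f| ≤ expect ν (fun x => |f x|) := by
  refine (abs_sum_le_sum_abs _ _).trans (le_of_eq ?_)
  exact sum_congr rfl fun x _ => by rw [abs_mul, abs_of_nonneg (hν x)]

theorem normSq_nonneg (hν : ∀ x, 0 ≤ ν x) (f : α → ℝ) : 0 ≤ normSq ν f :=
  expect_nonneg hν fun x _ => sq_nonneg (f x)

theorem norm₂_nonneg (f : α → ℝ) : 0 ≤ norm₂ ν f := Real.sqrt_nonneg _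

theorem norm₂_sq (hν : ∀ x, 0 ≤ ν x) (f : α → ℝ) : norm₂ ν f ^ 2 = normSq ν f :=
  Real.sq_sqrt (normSq_nonneg hν f)

theorem norm₂_le_of_sq_le {f : α → ℝ} {c : ℝ} (hc : 0 ≤ c) (h : normSq ν f ≤ c ^ 2) :
    norm₂ ν f ≤ c := (Real.sqrt_le_sqrt h).trans (Real.sqrt_sq hc).le

theorem normSq_le_of_norm₂_le (hν : ∀ x, 0 ≤ ν x) {f : α → ℝ} {c : ℝ} (h : norm₂ ν f ≤ c) :
    normSq ν f ≤ c ^ 2 := by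
  rw [← norm₂_sq hν]
  exact pow_le_pow_left₀ (norm₂_nonneg f) h 2

theorem norm₂_congr (hν : ∀ x, 0 ≤ ν x) {f g : α → ℝ} (h : ∀ x, 0 < ν x → f x = g x) :
    norm₂ ν f = norm₂ ν g := by
  unfold norm₂ normSq
  rw [expect_congr hν fun x hx => by rw [h x hx]]

theorem norm₂_mono (hν : ∀ x, 0 ≤ ν x) {f g : α → ℝ} (h : ∀ x, 0 < ν x → |f x| ≤ |g x|) :
    norm₂ ν f ≤ norm₂ ν g :=
  Real.sqrt_le_sqrt (expect_mono hν fun x hx => sq_le_sq.2 (h x hx))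

theorem abs_expect_mul_le (hν : ∀ x, 0 ≤ ν x) (f g : α → ℝ) :
    |expect ν (fun x => f x * g x)| ≤ norm₂ ν f * norm₂ ν g := by
  unfold norm₂
  rw [← Real.sqrt_mul (normSq_nonneg hν f)]
  apply Real.abs_le_sqrt
  unfold expect normSq expect
  refine sum_sq_le_sum_mul_sum_of_sq_le_mul _ (fun x _ => ?_) (fun x _ => ?_)
    (fun x _ => le_of_eq ?_)
  · exact mul_nonneg (hν x) (sq_nonneg _)
  · exact mul_nonneg (hν x) (sq_nonneg _)
  · ring

theorem expect_mul_le (hν : ∀ x, 0 ≤ ν x) (f g : α → ℝ) :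
    expect ν (fun x => f x * g x) ≤ norm₂ ν f * norm₂ ν g :=
  (le_abs_self _).trans (abs_expect_mul_le hν f g)

theorem expect_abs_mul_le (hν : ∀ x, 0 ≤ ν x) (f g : α → ℝ) :
    expect ν (fun x => |f x| * |g x|) ≤ norm₂ ν f * norm₂ ν g := by
  refine (expect_mul_le hν _ _).trans (le_of_eq ?_)
  simp [norm₂, normSq]

theorem norm₂_add_le (hν : ∀ x, 0 ≤ ν x) (f g : α → ℝ) :
    norm₂ ν (fun x => f x + g x) ≤ norm₂ ν f + norm₂ ν g := by
  refine norm₂_le_of_sq_le (add_nonneg (norm₂_nonneg f) (norm₂_nonneg g)) ?_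
  have h1 : normSq ν (fun x => f x + g x) =
      normSq ν f + 2 * expect ν (fun x => f x * g x) + normSq ν g := by
    unfold normSq
    rw [← expect_const_mul, ← expect_add, ← expect_add]
    congr 1; ext x; ring
  rw [h1, ← norm₂_sq hν, ← norm₂_sq hν]
  nlinarith [expect_mul_le hν f g]

theorem norm₂_const_mul (c : ℝ) (f : α → ℝ) :
    norm₂ ν (fun x => c * f x) = |c| * norm₂ ν f := by
  unfold norm₂ normSq
  simp only [mul_pow]
  rw [expect_const_mul, Real.sqrt_mul (sq_nonneg c), Real.sqrt_sq_eq_abs]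

theorem norm₂_zero : norm₂ ν (fun _ => 0) = 0 := by simp [norm₂, normSq, expect]

theorem norm₂_sum_le (hν : ∀ x, 0 ≤ ν x) {ι : Type*} (s : Finset ι) (f : ι → α → ℝ) :
    norm₂ ν (fun x => ∑ i ∈ s, f i x) ≤ ∑ i ∈ s, norm₂ ν (f i) := by
  induction s using Finset.induction_on with
  | empty => simp [norm₂_zero]
  | insert a s ha ih =>
    simp only [sum_insert ha]
    exact (norm₂_add_le hν _ _).trans (by gcongr)

theorem variance_eq (hν : ν ∈ stdSimplex ℝ α) (g : α → ℝ) :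
    variance ν g = normSq ν g - expect ν g ^ 2 := by
  unfold variance normSq
  have : (fun x => (g x - expect ν g) ^ 2) =
      fun x => (g x ^ 2 - (2 * expect ν g) * g x) + expect ν g ^ 2 := by ext x; ring
  rw [this, expect_add, expect_sub, expect_const_mul, expect_const hν]
  ring

end Expect

/-! ### Dependence on coordinates and conditional expectations -/

section Coordinates
variable {k : ℕ} {V : Fin k → Type*}

theorem restrict_eq_iff (S : Finset (Fin k)) (x y : ∀ i, V i) :
    S.restrict x = S.restrict y ↔ ∀ i ∈ S, x i = y i := by
  constructor
  · intro h i hi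
    exact congrFun h ⟨i, hi⟩
  · intro h
    ext ⟨i, hi⟩
    exact h i hi

theorem dependsOn_mono {S T : Finset (Fin k)} (h : S ⊆ T) {g : (∀ i, V i) → ℝ}
    (hg : DependsOn g (S : Set (Fin k))) : DependsOn g (T : Set (Fin k)) :=
  fun x y hxy => hg fun i hi => hxy i (by simpa using h (by simpa using hi))

end Coordinates

section Avg
variable {k : ℕ} {V : Fin k → Type*} [∀ i, Fintype (V i)] {μ : (∀ i, V i) → ℝ}

theorem marginal_nonneg (hμ : ∀ x, 0 ≤ μ x) (S : Finset (Fin k)) (a : ∀ i : S, V i) :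
    0 ≤ marginal μ S a :=
  sum_nonneg fun y _ => by split_ifs <;> [exact hμ y; exact le_rfl]

theorem le_marginal (hμ : ∀ x, 0 ≤ μ x) (S : Finset (Fin k)) (x : ∀ i, V i) :
    μ x ≤ marginal μ S (S.restrict x) := by
  have := single_le_sum (f := fun y => if S.restrict y = S.restrict x then μ y else 0)
    (fun y _ => by split_ifs <;> [exact hμ y; exact le_rfl]) (mem_univ x)
  simpa [marginal] using this

theorem exists_of_marginal_pos {S : Finset (Fin k)} {a : ∀ i : S, V i}
    (h : 0 < marginal μ S a) : ∃ x, S.restrict x = a ∧ 0 < μ x := by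
  by_contra! hc
  refine h.not_ge (sum_nonpos fun y _ => ?_)
  split_ifs with hy
  · exact hc y hy
  · exact le_rfl

theorem link_nonneg (hμ : ∀ x, 0 ≤ μ x) (S : Finset (Fin k)) (a : ∀ i : S, V i) (y : ∀ i, V i) :
    0 ≤ link μ S a y := by
  unfold link
  split_ifs
  · exact div_nonneg (hμ y) (marginal_nonneg hμ S a)
  · exact le_rfl

theorem sum_link (S : Finset (Fin k)) (a : ∀ i : S, V i) (h : marginal μ S a ≠ 0) :
    ∑ y, link μ S a y = 1 := by
  have : ∀ y, link μ S a y = (if S.restrict y = a then μ y else 0) / marginal μ S a := by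
    intro y; unfold link; split_ifs <;> simp
  simp only [this, ← sum_div]
  exact div_self h

theorem link_mem_stdSimplex (hμ : ∀ x, 0 ≤ μ x) {S : Finset (Fin k)} {a : ∀ i : S, V i}
    (h : 0 < marginal μ S a) : link μ S a ∈ stdSimplex ℝ (∀ i, V i) :=
  ⟨link_nonneg hμ S a, sum_link S a h.ne'⟩

theorem restrict_eq_of_link_pos {S : Finset (Fin k)} {a : ∀ i : S, V i} {y : ∀ i, V i}
    (h : 0 < link μ S a y) : S.restrict y = a := by
  unfold link at h
  split_ifs at h with h1
  · exact h1
  · exact absurd h (lt_irrefl 0)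

theorem pos_of_link_pos (hμ : ∀ x, 0 ≤ μ x) {S : Finset (Fin k)} {a : ∀ i : S, V i}
    {y : ∀ i, V i} (h : 0 < link μ S a y) : 0 < μ y := by
  refine (hμ y).lt_of_ne fun h0 => ?_
  unfold link at h
  rw [← h0] at h
  simp at h

/-- `A_S f` depends only on the coordinates in `S`. -/
theorem avg_dependsOn (S : Finset (Fin k)) (f : (∀ i, V i) → ℝ) :
    DependsOn (avg μ S f) (S : Set (Fin k)) := by
  intro x y h
  unfold avg
  rw [(restrict_eq_iff S x y).2 (by simpa using h)]

theorem avg_mono (hμ : ∀ x, 0 ≤ μ x) (S : Finset (Fin k)) {f g : (∀ i, V i) → ℝ}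
    (h : ∀ x, 0 < μ x → f x ≤ g x) (x : ∀ i, V i) : avg μ S f x ≤ avg μ S g x :=
  expect_mono (link_nonneg hμ S _) fun y hy => h y (pos_of_link_pos hμ hy)

theorem avg_congr (hμ : ∀ x, 0 ≤ μ x) (S : Finset (Fin k)) {f g : (∀ i, V i) → ℝ}
    (h : ∀ x, 0 < μ x → f x = g x) (x : ∀ i, V i) : avg μ S f x = avg μ S g x :=
  expect_congr (link_nonneg hμ S _) fun y hy => h y (pos_of_link_pos hμ hy)

theorem avg_nonneg (hμ : ∀ x, 0 ≤ μ x) (S : Finset (Fin k)) {f : (∀ i, V i) → ℝ}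
    (h : ∀ x, 0 < μ x → 0 ≤ f x) (x : ∀ i, V i) : 0 ≤ avg μ S f x :=
  expect_nonneg (link_nonneg hμ S _) fun y hy => h y (pos_of_link_pos hμ hy)

theorem avg_const (hμ : ∀ x, 0 ≤ μ x) (S : Finset (Fin k)) (c : ℝ) {x : ∀ i, V i}
    (hx : 0 < μ x) : avg μ S (fun _ => c) x = c :=
  expect_const (link_mem_stdSimplex hμ (hx.trans_le (le_marginal hμ S x))) c

theorem avg_add (S : Finset (Fin k)) (f g : (∀ i, V i) → ℝ) (x : ∀ i, V i) :
    avg μ S (fun y => f y + g y) x = avg μ S f x + avg μ S g x := expect_add f g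

theorem avg_sub (S : Finset (Fin k)) (f g : (∀ i, V i) → ℝ) (x : ∀ i, V i) :
    avg μ S (fun y => f y - g y) x = avg μ S f x - avg μ S g x := expect_sub f g

theorem avg_const_mul (S : Finset (Fin k)) (c : ℝ) (f : (∀ i, V i) → ℝ) (x : ∀ i, V i) :
    avg μ S (fun y => c * f y) x = c * avg μ S f x := expect_const_mul c f

theorem avg_sum {ι : Type*} (S : Finset (Fin k)) (s : Finset ι) (f : ι → (∀ i, V i) → ℝ)
    (x : ∀ i, V i) : avg μ S (fun y => ∑ i ∈ s, f i y) x = ∑ i ∈ s, avg μ S (f i) x :=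
  expect_sum s f

/-- Functions of the coordinates in `S` are pulled out of `A_S`. -/
theorem avg_mul_of_dependsOn (hμ : ∀ x, 0 ≤ μ x) {S : Finset (Fin k)} {g : (∀ i, V i) → ℝ}
    (hg : DependsOn g (S : Set (Fin k))) (f : (∀ i, V i) → ℝ) (x : ∀ i, V i) :
    avg μ S (fun y => g y * f y) x = g x * avg μ S f x := by
  unfold avg
  rw [← expect_const_mul]
  refine expect_congr (link_nonneg hμ S _) fun y hy => ?_
  rw [hg (x := y) (y := x)]
  simpa using (restrict_eq_iff S y x).1 (restrict_eq_of_link_pos hy)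

theorem avg_of_dependsOn (hμ : ∀ x, 0 ≤ μ x) {S : Finset (Fin k)} {g : (∀ i, V i) → ℝ}
    (hg : DependsOn g (S : Set (Fin k))) {x : ∀ i, V i} (hx : 0 < μ x) : avg μ S g x = g x := by
  have := avg_mul_of_dependsOn hμ hg (fun _ => 1) x
  simpa [avg_const hμ S 1 hx] using this

theorem avg_univ (hμ : ∀ x, 0 ≤ μ x) (g : (∀ i, V i) → ℝ) {x : ∀ i, V i} (hx : 0 < μ x) :
    avg μ univ g x = g x :=
  avg_of_dependsOn hμ (fun x y h => by rw [show x = y from funext fun i => h i (by simp)]) hx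

/-- The operator `A_S` is the orthogonal projection on functions of the coordinates in `S`. -/
theorem expect_mul_avg (hμ : ∀ x, 0 ≤ μ x) {S : Finset (Fin k)} {g : (∀ i, V i) → ℝ}
    (hg : DependsOn g (S : Set (Fin k))) (f : (∀ i, V i) → ℝ) :
    expect μ (fun x => g x * avg μ S f x) = expect μ (fun x => g x * f x) := by
  -- Detailed balance: resampling from the link is reversible with respect to `μ`, and `g` agrees at
  -- the two endpoints because the move keeps the coordinates in `S`.
  have h1 : ∀ x y, μ x * (g x * (link μ S (S.restrict x) y * f y)) =
      (μ y * (g y * f y)) * link μ S (S.restrict y) x := by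
    intro x y
    unfold link
    by_cases h : S.restrict y = S.restrict x
    · have hgx : g y = g x := hg (by simpa using (restrict_eq_iff S y x).1 h)
      rw [if_pos h, if_pos h.symm, hgx, h]
      ring
    · rw [if_neg h, if_neg (Ne.symm h)]
      ring
  unfold avg expect
  simp only [mul_sum]
  rw [sum_comm]
  refine sum_congr rfl fun y _ => ?_
  simp only [h1, ← mul_sum]
  rcases (hμ y).eq_or_lt with h0 | h0
  · simp [← h0]
  · rw [sum_link _ _ (h0.trans_le (le_marginal hμ S y)).ne', mul_one]

theorem expect_avg (hμ : ∀ x, 0 ≤ μ x) (S : Finset (Fin k)) (f : (∀ i, V i) → ℝ) :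
    expect μ (avg μ S f) = expect μ f := by
  have := expect_mul_avg hμ (S := S) (g := fun _ => 1) (fun _ _ _ => rfl) f
  simpa using this

theorem avg_sq_le (hμ : ∀ x, 0 ≤ μ x) (S : Finset (Fin k)) (f : (∀ i, V i) → ℝ) (x : ∀ i, V i) :
    avg μ S f x ^ 2 ≤ avg μ S (fun y => f y ^ 2) x := by
  by_cases h : marginal μ S (S.restrict x) = 0
  · have : ∀ y, link μ S (S.restrict x) y = 0 := by
      intro y; unfold link; rw [h]; simp
    simp [avg, expect, this]
  · have hl := link_mem_stdSimplex hμ ((marginal_nonneg hμ S (S.restrict x)).lt_of_ne (Ne.symm h))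
    have h1 := variance_eq hl f
    have h2 : 0 ≤ variance (link μ S (S.restrict x)) f :=
      expect_nonneg hl.1 fun y _ => sq_nonneg _
    unfold avg
    unfold normSq at h1
    linarith

theorem norm₂_avg_le (hμ : ∀ x, 0 ≤ μ x) (S : Finset (Fin k)) (f : (∀ i, V i) → ℝ) :
    norm₂ μ (avg μ S f) ≤ norm₂ μ f := by
  refine Real.sqrt_le_sqrt ?_
  unfold normSq
  rw [← expect_avg hμ S (fun y => f y ^ 2)]
  exact expect_mono hμ fun x _ => avg_sq_le hμ S f x

/-- The link of a link is the link of the union. -/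
theorem link_link {S : Finset (Fin k)} (U : Finset (Fin k))
    {x : ∀ i, V i} (hx : 0 < marginal μ S (S.restrict x)) :
    link (link μ S (S.restrict x)) U (U.restrict x) = link μ (U ∪ S) ((U ∪ S).restrict x) := by
  have key : ∀ z : ∀ i, V i, (U ∪ S).restrict z = (U ∪ S).restrict x ↔
      U.restrict z = U.restrict x ∧ S.restrict z = S.restrict x := by
    intro z
    simp only [restrict_eq_iff, mem_union]
    grind
  have hm : marginal (link μ S (S.restrict x)) U (U.restrict x) =
      marginal μ (U ∪ S) ((U ∪ S).restrict x) / marginal μ S (S.restrict x) := by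
    unfold marginal
    rw [sum_div]
    refine sum_congr rfl fun z _ => ?_
    unfold link
    simp only [key z]
    by_cases h1 : U.restrict z = U.restrict x <;> by_cases h2 : S.restrict z = S.restrict x <;>
      simp [h1, h2, marginal]
  funext z
  rw [link, link, hm, link]
  simp only [key z]
  by_cases h1 : U.restrict z = U.restrict x <;> by_cases h2 : S.restrict z = S.restrict x <;>
    simp only [h1, h2, if_true, if_false, and_self, and_true, and_false, zero_div]
  rw [div_div_div_cancel_right₀ hx.ne']

theorem avg_link {S : Finset (Fin k)} (U : Finset (Fin k))
    {a : ∀ i : S, V i} (ha : 0 < marginal μ S a) {x : ∀ i, V i} (hx : S.restrict x = a)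
    (f : (∀ i, V i) → ℝ) : avg (link μ S a) U f x = avg μ (U ∪ S) f x := by
  subst hx
  unfold avg
  rw [link_link U ha]

/-- The tower property. Since `T` contains `S`, inside the link at `x_S` the operator `A_T` of `μ`
is that of the link, and averaging preserves the expectation over the link. -/
theorem avg_avg_of_subset (hμ : ∀ x, 0 ≤ μ x) {S T : Finset (Fin k)} (h : S ⊆ T)
    (f : (∀ i, V i) → ℝ) {x : ∀ i, V i} (hx : 0 < μ x) :
    avg μ S (avg μ T f) x = avg μ S f x := by
  have hm := hx.trans_le (le_marginal hμ S x)
  have h1 := expect_avg (link_nonneg hμ S (S.restrict x)) T f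
  unfold avg
  rw [← h1]
  refine expect_congr (link_nonneg hμ S _) fun y hy => ?_
  rw [avg_link T hm (restrict_eq_of_link_pos hy), union_eq_left.2 h]
  rfl

theorem expect_avg_mul (hμ : ∀ x, 0 ≤ μ x) {S : Finset (Fin k)} {f g : (∀ i, V i) → ℝ} :
    expect μ (fun x => avg μ S g x * f x) = expect μ (fun x => g x * avg μ S f x) := by
  rw [← expect_mul_avg hμ (avg_dependsOn S g) f]
  simp only [mul_comm (avg μ S g _)]
  rw [expect_mul_avg hμ (avg_dependsOn S f) g]
  simp only [mul_comm]

end Avg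

/-! ### Links inherit pseudorandomness and globalness -/

section Links
variable {k : ℕ} {V : Fin k → Type*} [∀ i, Fintype (V i)] {μ : (∀ i, V i) → ℝ}

theorem expect_pairMarginal (i j : Fin k) (F : V i → V j → ℝ) :
    expect (pairMarginal μ i j) (fun p => F p.1 p.2) = expect μ (fun y => F (y i) (y j)) := by
  unfold expect pairMarginal
  simp only [sum_mul]
  rw [sum_comm]
  refine sum_congr rfl fun y _ => ?_
  rw [sum_eq_single (y i, y j)]
  · simp
  · rintro ⟨a, b⟩ _ hne
    rw [if_neg, zero_mul]
    rintro ⟨rfl, rfl⟩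
    exact hne rfl
  · simp

theorem expect_fstMarginal (i j : Fin k) (g : V i → ℝ) :
    expect (fstMarginal (pairMarginal μ i j)) g = expect μ (fun y => g (y i)) := by
  rw [← expect_pairMarginal i j (fun a _ => g a)]
  simp only [expect, fstMarginal, sum_mul, Fintype.sum_prod_type]

theorem expect_sndMarginal (i j : Fin k) (h : V j → ℝ) :
    expect (sndMarginal (pairMarginal μ i j)) h = expect μ (fun y => h (y j)) := by
  rw [← expect_pairMarginal i j (fun _ b => h b)]
  simp only [expect, sndMarginal, sum_mul, Fintype.sum_prod_type]
  exact sum_comm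

theorem isPseudorandom_pairMarginal_iff {ε : ℝ} (i j : Fin k) :
    IsPseudorandom ε (pairMarginal μ i j) ↔ ∀ (g : V i → ℝ) (h : V j → ℝ),
      |expect μ (fun y => g (y i) * h (y j)) -
          expect μ (fun y => g (y i)) * expect μ (fun y => h (y j))| ≤
        ε * Real.sqrt (variance μ (fun y => g (y i)) * variance μ (fun y => h (y j))) := by
  unfold IsPseudorandom variance
  refine forall_congr' fun g => forall_congr' fun h => ?_
  rw [expect_pairMarginal i j (fun a b => g a * h b), expect_fstMarginal, expect_sndMarginal,
    expect_fstMarginal, expect_sndMarginal]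

theorem variance_nonneg (hμ : ∀ x, 0 ≤ μ x) (f : (∀ i, V i) → ℝ) : 0 ≤ variance μ f :=
  expect_nonneg hμ fun _ _ => sq_nonneg _

/-- A constant has zero covariance with everything. This is needed because links live on the full
product, so pairs that meet the frozen coordinates also have to be checked. -/
theorem isPseudorandom_of_const {ε : ℝ} (hε : 0 ≤ ε) (hμ : μ ∈ stdSimplex ℝ (∀ i, V i))
    {i j : Fin k} (x : ∀ i, V i)
    (h : (∀ y, 0 < μ y → y i = x i) ∨ (∀ y, 0 < μ y → y j = x j)) :
    IsPseudorandom ε (pairMarginal μ i j) := by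
  rw [isPseudorandom_pairMarginal_iff]
  intro g f
  have h0 : expect μ (fun y => g (y i) * f (y j)) -
      expect μ (fun y => g (y i)) * expect μ (fun y => f (y j)) = 0 := by
    rcases h with h | h
    · rw [expect_congr hμ.1 (f := fun y => g (y i) * f (y j)) (g := fun y => g (x i) * f (y j))
        fun y hy => by rw [h y hy], expect_congr hμ.1 (f := fun y => g (y i))
        (g := fun _ => g (x i)) fun y hy => by rw [h y hy], expect_const_mul, expect_const hμ]
      ring
    · rw [expect_congr hμ.1 (f := fun y => g (y i) * f (y j)) (g := fun y => f (x j) * g (y i))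
        fun y hy => by rw [h y hy, mul_comm], expect_congr hμ.1 (f := fun y => f (y j))
        (g := fun _ => f (x j)) fun y hy => by rw [h y hy], expect_const_mul, expect_const hμ]
      ring
  rw [h0, abs_zero]
  exact mul_nonneg hε (Real.sqrt_nonneg _)

/-- Links of `ε`-product measures are `ε`-product. -/
theorem IsEpsProduct.link {ε : ℝ} (hε : 0 ≤ ε) (hμ : ∀ x, 0 ≤ μ x) (h : IsEpsProduct ε μ)
    {S : Finset (Fin k)} {a : ∀ i : S, V i} (ha : 0 < marginal μ S a) :
    IsEpsProduct ε (link μ S a) := by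
  intro U _ b hb i j hi hj hij
  have hl := link_nonneg hμ S a
  obtain ⟨x, rfl, hx⟩ := exists_of_marginal_pos hb
  have hxS := restrict_eq_of_link_pos hx
  subst hxS
  rw [link_link U ha]
  have hm := (pos_of_link_pos hμ hx).trans_le (le_marginal hμ (U ∪ S) x)
  -- A pair that avoids `U ∪ S` is covered by the hypothesis on `μ`, the two extra coordinates
  -- giving `|U ∪ S| + 2 ≤ k`. Otherwise one of the two coordinates is frozen.
  by_cases hS : i ∉ S ∧ j ∉ S
  · have hd : Disjoint (U ∪ S) {i, j} := by
      rw [disjoint_left]; grind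
    have hc := card_le_univ ((U ∪ S) ∪ {i, j})
    rw [card_union_of_disjoint hd, card_pair hij, Fintype.card_fin] at hc
    exact h _ hc _ hm i j (by grind) (by grind) hij
  · have hc : ∀ v ∈ S, ∀ y, 0 < HDX.link μ (U ∪ S) ((U ∪ S).restrict x) y → y v = x v :=
      fun v hv y hy => (restrict_eq_iff _ y x).1 (restrict_eq_of_link_pos hy) v
        (mem_union_right _ hv)
    refine isPseudorandom_of_const hε (link_mem_stdSimplex hμ hm) x ?_
    by_cases hiS : i ∈ S
    · exact Or.inl (hc i hiS)
    · exact Or.inr (hc j (by tauto))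

theorem IsGlobal.mono {d d' : ℕ} {δ : ℝ} {f : (∀ i, V i) → ℝ} (h : IsGlobal μ d δ f)
    (hd : d' ≤ d) : IsGlobal μ d' δ f := fun S hS => h S (hS.trans hd)

/-- A link of a link is the link of the union, so conditioning on `S` uses up `|S|` of the `d`
coordinates that may be fixed. -/
theorem IsGlobal.link {d e : ℕ} {δ : ℝ} {f : (∀ i, V i) → ℝ} (hμ : ∀ x, 0 ≤ μ x)
    (h : IsGlobal μ d δ f) {S : Finset (Fin k)} {a : ∀ i : S, V i} (ha : 0 < marginal μ S a)
    (he : e + S.card ≤ d) : IsGlobal (link μ S a) e δ f := by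
  intro U hU b hb
  obtain ⟨x, rfl, hx⟩ := exists_of_marginal_pos hb
  have hxS := restrict_eq_of_link_pos hx
  subst hxS
  rw [link_link U ha]
  refine h _ ((card_union_le _ _).trans ?_) _
    ((pos_of_link_pos hμ hx).trans_le (le_marginal hμ (U ∪ S) x))
  omega

end Links

/-! ### Approximate multiplication of averaging operators -/

section Approx
variable {k : ℕ} {V : Fin k → Type*} [∀ i, Fintype (V i)] {μ : (∀ i, V i) → ℝ} {ε : ℝ}

/-- In the link at `x_U`, `g` is a function of coordinate `i` alone and `f` of coordinate `j` alone,
so pseudorandomness of that pair applies; variances are then bounded by second moments. -/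
theorem abs_avg_mul_sub_le (hμ : ∀ x, 0 ≤ μ x) (hε : 0 ≤ ε) (h : IsEpsProduct ε μ)
    {U : Finset (Fin k)} {i j : Fin k} (hi : i ∉ U) (hj : j ∉ U) (hij : i ≠ j)
    {f g : (∀ i, V i) → ℝ} (hg : DependsOn g (insert i U : Finset (Fin k)))
    (hf : DependsOn f (insert j U : Finset (Fin k))) {x : ∀ i, V i} (hx : 0 < μ x) :
    |avg μ U (fun y => g y * f y) x - avg μ U g x * avg μ U f x| ≤
      ε * Real.sqrt (avg μ U (fun y => g y ^ 2) x * avg μ U (fun y => f y ^ 2) x) := by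
  have hm := hx.trans_le (le_marginal hμ U x)
  have hl := link_mem_stdSimplex hμ hm
  have hd : Disjoint U {i, j} := by
    rw [disjoint_left]; grind
  have hc := card_le_univ (U ∪ {i, j})
  rw [card_union_of_disjoint hd, card_pair hij, Fintype.card_fin] at hc
  have hps := h U hc _ hm i j hi hj hij
  rw [isPseudorandom_pairMarginal_iff] at hps
  have hyU : ∀ y, 0 < link μ U (U.restrict x) y → ∀ v ∈ U, y v = x v :=
    fun y hy => (restrict_eq_iff U y x).1 (restrict_eq_of_link_pos hy)
  have key : ∀ (v : Fin k) (F : (∀ i, V i) → ℝ), DependsOn F (insert v U : Finset (Fin k)) →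
      ∀ y, 0 < link μ U (U.restrict x) y → F (Function.update x v (y v)) = F y := by
    intro v F hF y hy
    apply hF
    intro w hw
    by_cases hwv : w = v
    · subst hwv; simp
    · rw [Function.update_of_ne hwv]
      have : w ∈ U := by simpa [hwv] using hw
      exact (hyU y hy w this).symm
  -- The one-variable functions are obtained by freezing all the other coordinates at those of `x`,
  -- which changes nothing on the support of the link.
  have hps' := hps (fun b => g (Function.update x i b)) (fun b => f (Function.update x j b))
  unfold avg
  have e1 := expect_congr hl.1 (key i g hg)
  have e2 := expect_congr hl.1 (key j f hf)
  have e3 : expect (link μ U (U.restrict x)) (fun y => g (Function.update x i (y i)) *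
      f (Function.update x j (y j))) = expect (link μ U (U.restrict x)) (fun y => g y * f y) :=
    expect_congr hl.1 fun y hy => by rw [key i g hg y hy, key j f hf y hy]
  rw [e1, e2, e3] at hps'
  refine hps'.trans (mul_le_mul_of_nonneg_left (Real.sqrt_le_sqrt ?_) hε)
  have hv : ∀ (v : Fin k) (F : (∀ i, V i) → ℝ), DependsOn F (insert v U : Finset (Fin k)) →
      variance (link μ U (U.restrict x)) (fun y => F (Function.update x v (y v))) ≤
        expect (link μ U (U.restrict x)) (fun y => F y ^ 2) := by
    intro v F hF
    rw [variance_eq hl]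
    unfold normSq
    rw [expect_congr hl.1 (f := fun y => F (Function.update x v (y v)) ^ 2)
      (g := fun y => F y ^ 2) fun y hy => by rw [key v F hF y hy]]
    nlinarith [sq_nonneg (expect (link μ U (U.restrict x))
      (fun y => F (Function.update x v (y v))))]
  exact mul_le_mul (hv i g hg) (hv j f hf) (variance_nonneg hl.1 _)
    (expect_nonneg hl.1 fun _ _ => sq_nonneg _)

/-- The left side is the mean over `x` of the conditional covariance in the link at `x_U`;
Cauchy–Schwarz turns the mean of the conditional bounds into global norms. -/
theorem abs_expect_mul_sub_insert_insert_le (hμ : ∀ x, 0 ≤ μ x) (hε : 0 ≤ ε)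
    (h : IsEpsProduct ε μ) {U : Finset (Fin k)} {i j : Fin k} (hi : i ∉ U) (hj : j ∉ U)
    (hij : i ≠ j) {f g : (∀ i, V i) → ℝ} (hg : DependsOn g (insert i U : Finset (Fin k)))
    (hf : DependsOn f (insert j U : Finset (Fin k))) :
    |expect μ (fun x => g x * f x) - expect μ (fun x => g x * avg μ U f x)| ≤
      ε * (norm₂ μ g * norm₂ μ f) := by
  have h1 : expect μ (fun x => g x * f x) - expect μ (fun x => g x * avg μ U f x) =
      expect μ (fun x => avg μ U (fun y => g y * f y) x - avg μ U g x * avg μ U f x) := by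
    rw [expect_sub, expect_avg hμ]
    congr 1
    simp only [mul_comm (avg μ U g _)]
    rw [expect_mul_avg hμ (avg_dependsOn U f) g]
    simp only [mul_comm]
  rw [h1]
  refine (abs_expect_le hμ _).trans ((expect_mono hμ fun x hx =>
    abs_avg_mul_sub_le hμ hε h hi hj hij hg hf hx).trans ?_)
  rw [expect_const_mul]
  refine mul_le_mul_of_nonneg_left ?_ hε
  have hn : ∀ (F : (∀ i, V i) → ℝ) x, 0 ≤ avg μ U (fun y => F y ^ 2) x :=
    fun F x => avg_nonneg hμ U (fun _ _ => sq_nonneg _) x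
  simp only [Real.sqrt_mul (hn g _)]
  refine (expect_mul_le hμ _ _).trans (le_of_eq ?_)
  unfold norm₂ normSq
  simp only [Real.sq_sqrt (hn _ _)]
  rw [expect_avg hμ, expect_avg hμ]

/-- One telescoping step for approximate independence. -/
theorem abs_expect_mul_sub_union_le (hμ : ∀ x, 0 ≤ μ x) {c : ℝ} (hc : 0 ≤ c)
    {U I : Finset (Fin k)} (hUI : Disjoint U I)
    (base : ∀ (W : Finset (Fin k)) (j : Fin k), Disjoint W I → j ∉ W → j ∉ I →
      ∀ f g : (∀ i, V i) → ℝ, DependsOn g (W ∪ I : Finset (Fin k)) →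
        DependsOn f (insert j W : Finset (Fin k)) →
        |expect μ (fun x => g x * f x) - expect μ (fun x => g x * avg μ W f x)| ≤
          c * (norm₂ μ g * norm₂ μ f))
    {f g : (∀ i, V i) → ℝ} (hg : DependsOn g (U ∪ I : Finset (Fin k))) (J : Finset (Fin k))
    (hJI : Disjoint J I) (hJU : Disjoint J U) (hf : DependsOn f (U ∪ J : Finset (Fin k))) :
    |expect μ (fun x => g x * f x) - expect μ (fun x => g x * avg μ U f x)| ≤
      J.card * c * (norm₂ μ g * norm₂ μ f) := by
  induction J using Finset.induction_on generalizing f with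
  | empty =>
    rw [union_empty] at hf
    rw [expect_congr hμ (f := fun x => g x * avg μ U f x) (g := fun x => g x * f x)
      fun x hx => by rw [avg_of_dependsOn hμ hf hx]]
    simp
  | insert j J hj ih =>
    rw [disjoint_insert_left] at hJI hJU
    have hW : Disjoint (U ∪ J) I := disjoint_union_left.2 ⟨hUI, hJI.2⟩
    have h1 := base (U ∪ J) j hW (by simp [hj, hJU.1]) hJI.1 f g
      (dependsOn_mono (by grind) hg) (by rwa [← union_insert])
    have h2 := ih hJI.2 hJU.2 (avg_dependsOn (μ := μ) (U ∪ J) f)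
    rw [expect_congr hμ (f := fun x => g x * avg μ U (avg μ (U ∪ J) f) x)
      (g := fun x => g x * avg μ U f x)
      fun x hx => by rw [avg_avg_of_subset hμ subset_union_left f hx]] at h2
    have h3 : (J.card : ℝ) * c * (norm₂ μ g * norm₂ μ (avg μ (U ∪ J) f)) ≤
        J.card * c * (norm₂ μ g * norm₂ μ f) := by
      have := norm₂_avg_le hμ (U ∪ J) f
      have := norm₂_nonneg (ν := μ) g
      gcongr
    rw [card_insert_of_notMem hj]
    push_cast
    have h4 := abs_sub_le (expect μ (fun x => g x * f x))
      (expect μ (fun x => g x * avg μ (U ∪ J) f x)) (expect μ (fun x => g x * avg μ U f x))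
    linarith

/-- The telescoping runs twice: once over the private coordinates of `g` against a single private
coordinate of `f`, then over the private coordinates of `f`. At most `k` steps each time give the
factor `k²`. -/
theorem abs_expect_mul_sub_le (hμ : ∀ x, 0 ≤ μ x) (hε : 0 ≤ ε) (h : IsEpsProduct ε μ)
    {S T : Finset (Fin k)} {f g : (∀ i, V i) → ℝ} (hg : DependsOn g (S : Set (Fin k)))
    (hf : DependsOn f (T : Set (Fin k))) :
    |expect μ (fun x => g x * f x) - expect μ (fun x => g x * avg μ (S ∩ T) f x)| ≤
      (k : ℝ) ^ 2 * ε * (norm₂ μ g * norm₂ μ f) := by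
  have single : ∀ (j : Fin k) (W I : Finset (Fin k)), Disjoint W I → j ∉ W → j ∉ I →
      ∀ f g : (∀ i, V i) → ℝ, DependsOn g (W ∪ I : Finset (Fin k)) →
        DependsOn f (insert j W : Finset (Fin k)) →
        |expect μ (fun x => g x * f x) - expect μ (fun x => g x * avg μ W f x)| ≤
          I.card * ε * (norm₂ μ g * norm₂ μ f) := by
    intro j W I hWI hjW hjI f g hg hf
    -- Here the roles of `f` and `g` are exchanged, with the set `I` being removed one point at a
    -- time; self-adjointness of `A_W` moves the average back to `f`.
    have := abs_expect_mul_sub_union_le hμ hε (U := W) (I := {j}) (by simpa using hjW)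
      (fun W' i hd hiW hi f' g' hg' hf' => abs_expect_mul_sub_insert_insert_le hμ hε h
        (disjoint_singleton_right.1 hd) hiW (Ne.symm (by simpa using hi)) (by rwa [insert_eq, union_comm]) hf')
      (f := g) (g := f) (by rwa [union_comm, ← insert_eq]) I (by simpa using hjI) hWI.symm hg
    rw [← expect_avg_mul hμ] at this
    simpa only [mul_comm (norm₂ μ f), mul_comm (f _), mul_comm (avg μ W f _)] using this
  have hSe : S ∩ T ∪ S \ T = S := by grind
  have hTe : S ∩ T ∪ T \ S = T := by grind
  have := abs_expect_mul_sub_union_le hμ (c := (S \ T).card * ε) (by positivity)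
    (U := S ∩ T) (I := S \ T) (by rw [disjoint_left]; grind)
    (fun W j hW hj hjI => single j W _ hW hj hjI) (f := f) (g := g) (by rwa [hSe]) (T \ S)
    (by rw [disjoint_left]; grind) (by rw [disjoint_left]; grind) (by rwa [hTe])
  refine this.trans ?_
  have hk : ∀ A : Finset (Fin k), (A.card : ℝ) ≤ k := fun A => by
    exact_mod_cast (card_le_univ A).trans (Fintype.card_fin k).le
  have h1 := hk (S \ T)
  have h2 := hk (T \ S)
  have h3 : 0 ≤ norm₂ μ g * norm₂ μ f := mul_nonneg (norm₂_nonneg g) (norm₂_nonneg f)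
  refine mul_le_mul_of_nonneg_right ?_ h3
  rw [← mul_assoc, sq]
  gcongr

/-- The averaging operators of an `ε`-product measure approximately multiply like those of a
product measure. -/
theorem norm₂_avg_avg_sub_le (hμ : ∀ x, 0 ≤ μ x) (hε : 0 ≤ ε) (h : IsEpsProduct ε μ)
    (S T : Finset (Fin k)) (f : (∀ i, V i) → ℝ) :
    norm₂ μ (fun x => avg μ S (avg μ T f) x - avg μ (S ∩ T) f x) ≤
      (k : ℝ) ^ 2 * ε * norm₂ μ f := by
  set g := fun x => avg μ S (avg μ T f) x - avg μ (S ∩ T) f x with hgdef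
  have hg : DependsOn g (S : Set (Fin k)) := fun x y hxy => by
    simp only [hgdef]
    rw [avg_dependsOn S (avg μ T f) hxy,
      dependsOn_mono inter_subset_left (avg_dependsOn (μ := μ) (S ∩ T) f) hxy]
  have h1 := abs_expect_mul_sub_le hμ hε h hg (avg_dependsOn (μ := μ) T f)
  -- The difference depends only on `S`, so it may be tested against itself; by the tower property
  -- `A_{S ∩ T} f = A_{S ∩ T} A_T f`.
  have h2 : normSq μ g = expect μ (fun x => g x * avg μ T f x) -
      expect μ (fun x => g x * avg μ (S ∩ T) (avg μ T f) x) := by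
    rw [← expect_mul_avg hμ hg (avg μ T f), ← expect_sub]
    refine expect_congr hμ fun x hx => ?_
    rw [avg_avg_of_subset hμ inter_subset_right f hx]
    simp only [hgdef]
    ring
  rw [← h2, abs_of_nonneg (normSq_nonneg hμ g), ← norm₂_sq hμ] at h1
  have h3 := norm₂_avg_le hμ T f
  have h0 := norm₂_nonneg (ν := μ) g
  have h4 : norm₂ μ g ^ 2 ≤ norm₂ μ g * ((k : ℝ) ^ 2 * ε * norm₂ μ f) := by
    refine h1.trans ?_
    rw [mul_left_comm]
    gcongr
  rcases h0.eq_or_lt with h5 | h5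
  · rw [← h5]
    exact mul_nonneg (by positivity) (norm₂_nonneg f)
  · rw [sq] at h4
    exact le_of_mul_le_mul_left h4 h5

end Approx

/-! ### The two-point inequality and elementary bounds on powers -/

theorem two_mul_abs_le_of_sq_le {a b X t : ℝ} (ha : 0 ≤ a) (hb : 0 ≤ b) (hX : X ^ 2 ≤ a * b)
    (ht : 0 < t) : |2 * t * X| ≤ a + t ^ 2 * b := by
  apply abs_le_of_sq_le_sq _ (by positivity)
  nlinarith [sq_nonneg (a - t ^ 2 * b), mul_le_mul_of_nonneg_left hX (sq_nonneg t)]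

/-- The two-point inequality behind hypercontractivity, with `a = ‖u‖²`, `b = ‖v‖²` and
`X = ⟨u, v⟩`. -/
theorem add_two_mul_add_pow_le {a b X : ℝ} (ha : 0 ≤ a) (hb : 0 ≤ b) (hX : X ^ 2 ≤ a * b)
    (n : ℕ) :
    (a + 2 * X + b) ^ (n + 1) ≤ a ^ (n + 1) + 2 * (n + 1 : ℝ) * (a ^ n * X) +
      24 * (n + 1 : ℝ) ^ 2 * (a ^ n * b) + (n + 2 : ℝ) ^ (2 * (n + 1)) * b ^ (n + 1) := by
  obtain ⟨m, hm⟩ : ∃ m : ℝ, m = n + 1 := ⟨_, rfl⟩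
  have hm1 : 1 ≤ m := by rw [hm]; linarith [n.cast_nonneg (α := ℝ)]
  have hn2 : (n + 2 : ℝ) = m + 1 := by rw [hm]; ring
  rw [hn2, ← hm]
  have hamg := two_mul_abs_le_of_sq_le ha hb hX (by linarith : 0 < m)
  have h1 := abs_le.1 hamg
  have hN : 0 ≤ a + 2 * X + b := by
    have := abs_le.1 (two_mul_abs_le_of_sq_le ha hb hX one_pos)
    linarith
  have han : 0 ≤ a ^ n := pow_nonneg ha n
  have hmb : 0 ≤ m ^ 2 * b := by positivity
  -- If `b` dominates, the last term alone covers the left side and the other terms have nonnegative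
  -- sum. Otherwise the power is expanded around `a`.
  rcases le_or_gt a (m ^ 2 * b) with hab | hab
  · have h2 : a + 2 * X + b ≤ (m + 1) ^ 2 * b := by
      have : 2 * m * X ≤ m * (2 * (m * b)) := by nlinarith
      have := le_of_mul_le_mul_left (a := m) (by linarith : m * (2 * X) ≤ m * (2 * (m * b)))
        (by linarith)
      nlinarith
    have h3 := pow_le_pow_left₀ hN h2 (n + 1)
    rw [mul_pow, ← pow_mul] at h3
    have h4 : 0 ≤ a ^ n * (a + 2 * m * X + 24 * m ^ 2 * b) :=
      mul_nonneg han (by nlinarith)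
    rw [pow_succ a n]
    nlinarith
  · have ha0 : 0 < a := lt_of_le_of_lt hmb hab
    -- The scaling makes the base `a (1 + 3z/m)` with `|z| ≤ 1`, so its `m`-th power is at most `a^m
    -- (e^z)^3`.
    set z := m * (2 * X + b) / (3 * a) with hz
    have hmb' : m * b ≤ a := by nlinarith
    have hz1 : |z| ≤ 1 := by
      rw [hz, abs_div, abs_of_pos (by positivity : 0 < 3 * a), div_le_one (by positivity), abs_le]
      constructor <;> nlinarith
    have hz2 : z ^ 2 * a ≤ m ^ 2 * b := by
      have hq : (2 * X + b) ^ 2 ≤ 9 * (a * b) := by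
        have hb2 : b ≤ a := by nlinarith
        have hXb : 4 * X ≤ 4 * a := by
          have := abs_le.1 (two_mul_abs_le_of_sq_le ha hb hX one_pos)
          linarith
        nlinarith
      have : z ^ 2 * a = m ^ 2 * (2 * X + b) ^ 2 / (9 * a) := by
        rw [hz]; field_simp; ring
      rw [this, div_le_iff₀ (by positivity)]
      nlinarith [mul_le_mul_of_nonneg_left hq (sq_nonneg m)]
    have hN' : a + 2 * X + b = a * (1 + 3 * z / m) := by
      rw [hz]; field_simp; ring
    have hpos : 0 ≤ 1 + 3 * z / m := by
      rw [hN'] at hN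
      exact nonneg_of_mul_nonneg_right hN ha0
    -- Cubing `e^z ≤ 1 + z + z²` and bounding each higher power by `z²` gives `6 + 7 + 6 + 3 + 1 =
    -- 23`. The extra `m b` in the linear term later raises `23` to `24`.
    have h5 : (1 + 3 * z / m) ^ (n + 1) ≤ 1 + 3 * z + 23 * z ^ 2 := by
      have e1 : (1 + 3 * z / m) ^ (n + 1) ≤ Real.exp (3 * z / m) ^ (n + 1) :=
        pow_le_pow_left₀ hpos (by linarith [Real.add_one_le_exp (3 * z / m)]) _
      rw [← Real.exp_nat_mul] at e1
      have e2 : ((n + 1 : ℕ) : ℝ) * (3 * z / m) = (3 : ℕ) * z := by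
        push_cast; rw [← hm]; field_simp
      rw [e2, Real.exp_nat_mul] at e1
      have e3 : Real.exp z ≤ 1 + z + z ^ 2 := by
        have := abs_le.1 (Real.abs_exp_sub_one_sub_id_le hz1)
        linarith
      have e4 := pow_le_pow_left₀ (Real.exp_pos z).le e3 3
      obtain ⟨l, u⟩ := abs_le.1 hz1
      have c3 : z ^ 3 ≤ z ^ 2 := by nlinarith [mul_nonneg (sq_nonneg z) (sub_nonneg.2 u)]
      have c4 : z ^ 4 ≤ z ^ 2 := by
        nlinarith [mul_nonneg (sq_nonneg z) (mul_nonneg (sub_nonneg.2 u) (by linarith : 0 ≤ 1 + z))]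
      have c5 : z ^ 5 ≤ z ^ 4 := by
        nlinarith [mul_nonneg (sq_nonneg (z ^ 2)) (sub_nonneg.2 u)]
      have c6 : z ^ 6 ≤ z ^ 4 := by
        nlinarith [mul_nonneg (sq_nonneg (z ^ 2)) (mul_nonneg (sub_nonneg.2 u)
          (by linarith : 0 ≤ 1 + z))]
      have e5 : (1 + z + z ^ 2) ^ 3 =
          1 + 3 * z + 6 * z ^ 2 + 7 * z ^ 3 + 6 * z ^ 4 + 3 * z ^ 5 + z ^ 6 := by ring
      rw [e5] at e4
      linarith
    rw [hN', mul_pow]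
    have h6 := mul_le_mul_of_nonneg_left h5 (pow_nonneg ha (n + 1))
    have h7 : a ^ (n + 1) * (3 * z) = a ^ n * (m * (2 * X + b)) := by
      rw [hz, pow_succ]; field_simp
    have h8 : a ^ (n + 1) * z ^ 2 ≤ a ^ n * (m ^ 2 * b) := by
      rw [pow_succ, mul_assoc, mul_comm a]
      gcongr
    have h9 : a ^ n * (m * b) ≤ a ^ n * (m ^ 2 * b) := by
      gcongr; nlinarith
    have h10 : 0 ≤ (m + 1) ^ (2 * (n + 1)) * b ^ (n + 1) := by positivity
    have h11 : a ^ (n + 1) * (1 + 3 * z + 23 * z ^ 2) =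
        a ^ (n + 1) + a ^ (n + 1) * (3 * z) + 23 * (a ^ (n + 1) * z ^ 2) := by ring
    have h12 : a ^ n * (m * (2 * X + b)) = 2 * m * (a ^ n * X) + a ^ n * (m * b) := by ring
    have h13 : 24 * m ^ 2 * (a ^ n * b) = 24 * (a ^ n * (m ^ 2 * b)) := by ring
    rw [h11, h7, h12] at h6
    rw [h13]
    linarith

/-- The first two terms of the binomial expansion. It folds the quadratic correction of the
two-point inequality back into a single power. -/
theorem pow_add_mul_pow_le {a b : ℝ} (ha : 0 ≤ a) (hb : 0 ≤ b) (n : ℕ) :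
    a ^ (n + 1) + (n + 1 : ℝ) * (a ^ n * b) ≤ (a + b) ^ (n + 1) := by
  induction n with
  | zero => simp
  | succ n ih =>
    have h2 : 0 ≤ a ^ n * b * b := by positivity
    have h3 := mul_le_mul_of_nonneg_right ih (add_nonneg ha hb)
    rw [← pow_succ] at h3
    refine le_trans (le_of_sub_nonneg ?_) h3
    push_cast
    have : (a ^ (n + 1) + ((n : ℝ) + 1) * (a ^ n * b)) * (a + b) -
        (a ^ (n + 1 + 1) + ((n : ℝ) + 1 + 1) * (a ^ (n + 1) * b)) =
        ((n : ℝ) + 1) * (a ^ n * b * b) := by ring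
    rw [this]
    positivity

theorem abs_pow_sub_pow_le {x y L : ℝ} (hx : 0 ≤ x) (hy : 0 ≤ y) (hxL : x ≤ L) (hyL : y ≤ L)
    (n : ℕ) : |x ^ (n + 1) - y ^ (n + 1)| ≤ (n + 1 : ℝ) * L ^ n * |x - y| := by
  induction n with
  | zero => simp
  | succ n ih =>
    have e : x ^ (n + 1 + 1) - y ^ (n + 1 + 1) =
        (x ^ (n + 1) - y ^ (n + 1)) * x + y ^ (n + 1) * (x - y) := by ring
    have hL : 0 ≤ L := hx.trans hxL
    rw [e]
    refine (abs_add_le _ _).trans ?_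
    rw [abs_mul, abs_mul, abs_of_nonneg hx, abs_of_nonneg (pow_nonneg hy (n + 1))]
    have h1 : |x ^ (n + 1) - y ^ (n + 1)| * x ≤ (n + 1 : ℝ) * L ^ n * |x - y| * L := by gcongr
    have h2 : y ^ (n + 1) * |x - y| ≤ L ^ (n + 1) * |x - y| := by gcongr
    push_cast
    calc _ ≤ _ := add_le_add h1 h2
      _ = _ := by ring

/-! ### Splitting off one coordinate -/

section Step
variable {α : Type*} [Fintype α] {ν : α → ℝ}

/-- Powers are compared with the sup bound `L` for `n` factors and L² norms for the remaining two.
Using the sup bound throughout would lose the factor `‖f‖²` in the errors. -/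
theorem expect_pow_sub_pow_mul_le (hν : ∀ x, 0 ≤ ν x) {u w : α → ℝ} {L : ℝ}
    (hu : ∀ x, 0 < ν x → 0 ≤ u x ∧ u x ≤ L) (hw : ∀ x, 0 < ν x → 0 ≤ w x ∧ w x ≤ L) (n : ℕ)
    (φ : α → ℝ) (hL : 0 ≤ L) :
    expect ν (fun x => (u x ^ (n + 1) - w x ^ (n + 1)) * φ x) ≤
      (n + 1 : ℝ) * L ^ n * (norm₂ ν (fun x => u x - w x) * norm₂ ν φ) := by
  refine (le_trans (expect_mono hν (g := fun x => (n + 1 : ℝ) * L ^ n * (|u x - w x| * |φ x|))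
    fun x hx => ?_) ?_)
  · refine (le_abs_self _).trans ?_
    rw [abs_mul, ← mul_assoc]
    exact mul_le_mul_of_nonneg_right
      (abs_pow_sub_pow_le (hu x hx).1 (hw x hx).1 (hu x hx).2 (hw x hx).2 n) (abs_nonneg _)
  · rw [expect_const_mul]
    exact mul_le_mul_of_nonneg_left (expect_abs_mul_le hν _ _) (by positivity)

theorem expect_pow_sub_pow_le (hν : ∀ x, 0 ≤ ν x) {u w : α → ℝ} {L : ℝ}
    (hu : ∀ x, 0 < ν x → 0 ≤ u x ∧ u x ≤ L) (hw : ∀ x, 0 < ν x → 0 ≤ w x ∧ w x ≤ L) (n : ℕ)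
    (hL : 0 ≤ L) :
    expect ν (fun x => u x ^ (n + 2)) ≤ expect ν (fun x => w x ^ (n + 2)) +
      L ^ n * (norm₂ ν (fun x => u x - w x) * (norm₂ ν u + (n + 1 : ℝ) * norm₂ ν w)) := by
  have h1 := expect_pow_sub_pow_mul_le hν hu hw n w hL
  have h2 : expect ν (fun x => u x ^ (n + 1) * (u x - w x)) ≤
      L ^ n * (norm₂ ν (fun x => u x - w x) * norm₂ ν u) := by
    refine (expect_mono hν (g := fun x => L ^ n * (|u x - w x| * |u x|)) fun x hx => ?_).trans ?_
    · have hux := hu x hx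
      rw [abs_of_nonneg hux.1, pow_succ]
      have h3 : u x * (u x - w x) ≤ u x * |u x - w x| :=
        mul_le_mul_of_nonneg_left (le_abs_self _) hux.1
      have h4 : u x ^ n * (u x * (u x - w x)) ≤ L ^ n * (u x * |u x - w x|) :=
        (mul_le_mul_of_nonneg_left h3 (pow_nonneg hux.1 n)).trans
          (mul_le_mul_of_nonneg_right (pow_le_pow_left₀ hux.1 hux.2 n)
            (mul_nonneg hux.1 (abs_nonneg _)))
      linarith
    · rw [expect_const_mul]
      exact mul_le_mul_of_nonneg_left (expect_abs_mul_le hν _ _) (by positivity)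
  have h3 : expect ν (fun x => u x ^ (n + 2)) = expect ν (fun x => w x ^ (n + 2)) +
      expect ν (fun x => u x ^ (n + 1) * (u x - w x)) +
      expect ν (fun x => (u x ^ (n + 1) - w x ^ (n + 1)) * w x) := by
    rw [← expect_add, ← expect_add]
    congr 1; ext x; ring
  rw [h3]
  linarith

theorem norm₂_mul_le (hν : ∀ x, 0 ≤ ν x) {f g : α → ℝ} {M q : ℝ} (hM : 0 ≤ M)
    (hf : ∀ x, |f x| ≤ M) (hg : norm₂ ν g ≤ q) : norm₂ ν (fun x => f x * g x) ≤ M * q := by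
  refine (norm₂_mono hν (g := fun x => M * g x) fun x _ => ?_).trans ?_
  · rw [abs_mul, abs_mul, abs_of_nonneg hM]
    exact mul_le_mul_of_nonneg_right (hf x) (abs_nonneg _)
  · rw [norm₂_const_mul, abs_of_nonneg hM]
    exact mul_le_mul_of_nonneg_left hg hM

end Step

section OneStep
variable {k : ℕ} {V : Fin k → Type*} [∀ i, Fintype (V i)] {μ : (∀ i, V i) → ℝ} {ε : ℝ}
variable {ι : Type*}

/-- Weighted sums of averages. -/
noncomputable def avgSum (μ : (∀ i, V i) → ℝ) (s : Finset ι) (c : ι → ℝ) (Y : Finset (Fin k))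
    (u : ι → (∀ i, V i) → ℝ) (x : ∀ i, V i) : ℝ :=
  ∑ r ∈ s, c r * avg μ Y (u r) x

theorem avgSum_dependsOn (s : Finset ι) (c : ι → ℝ) (Y : Finset (Fin k))
    (u : ι → (∀ i, V i) → ℝ) : DependsOn (avgSum μ s c Y u) (Y : Set (Fin k)) := by
  intro x y hxy
  unfold avgSum
  exact sum_congr rfl fun r _ => by rw [avg_dependsOn Y (u r) hxy]

theorem norm₂_sum_mul_le (hμ : ∀ x, 0 ≤ μ x) {s : Finset ι} {c : ι → ℝ}
    (hc : ∀ r ∈ s, 0 ≤ c r) {u : ι → (∀ i, V i) → ℝ} {B : ℝ}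
    (hu : ∀ r ∈ s, norm₂ μ (u r) ≤ B) :
    norm₂ μ (fun x => ∑ r ∈ s, c r * u r x) ≤ (∑ r ∈ s, c r) * B := by
  refine (norm₂_sum_le hμ s _).trans ?_
  rw [sum_mul]
  refine sum_le_sum fun r hr => ?_
  rw [norm₂_const_mul, abs_of_nonneg (hc r hr)]
  exact mul_le_mul_of_nonneg_left (hu r hr) (hc r hr)

theorem norm₂_avgSum_le (hμ : ∀ x, 0 ≤ μ x) {s : Finset ι} {c : ι → ℝ}
    (hc : ∀ r ∈ s, 0 ≤ c r) (Y : Finset (Fin k)) {u : ι → (∀ i, V i) → ℝ} {B : ℝ}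
    (hu : ∀ r ∈ s, norm₂ μ (u r) ≤ B) :
    norm₂ μ (avgSum μ s c Y u) ≤ (∑ r ∈ s, c r) * B :=
  norm₂_sum_mul_le hμ hc fun r hr => (norm₂_avg_le hμ Y (u r)).trans (hu r hr)

theorem avgSum_nonneg (hμ : ∀ x, 0 ≤ μ x) {s : Finset ι} {c : ι → ℝ}
    (hc : ∀ r ∈ s, 0 ≤ c r) (Y : Finset (Fin k)) {u : ι → (∀ i, V i) → ℝ}
    (hu : ∀ r ∈ s, ∀ x, 0 ≤ u r x) (x : ∀ i, V i) : 0 ≤ avgSum μ s c Y u x :=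
  sum_nonneg fun r hr => mul_nonneg (hc r hr) (avg_nonneg hμ Y (fun y _ => hu r hr y) x)

theorem avgSum_le (hμ : ∀ x, 0 ≤ μ x) {s : Finset ι} {c : ι → ℝ}
    (hc : ∀ r ∈ s, 0 ≤ c r) (Y : Finset (Fin k)) {u : ι → (∀ i, V i) → ℝ} {B : ℝ}
    (hu : ∀ r ∈ s, ∀ x, u r x ≤ B) {x : ∀ i, V i} (hx : 0 < μ x) :
    avgSum μ s c Y u x ≤ (∑ r ∈ s, c r) * B := by
  unfold avgSum
  rw [sum_mul]
  refine sum_le_sum fun r hr => mul_le_mul_of_nonneg_left ?_ (hc r hr)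
  rw [← avg_const hμ Y B hx]
  exact avg_mono hμ Y (fun y _ => hu r hr y) x

/-- Pulling a function of the coordinates in `Y` through the averages. -/
theorem expect_mul_avgSum (hμ : ∀ x, 0 ≤ μ x) (s : Finset ι) (c : ι → ℝ) {Y : Finset (Fin k)}
    (u : ι → (∀ i, V i) → ℝ) {g : (∀ i, V i) → ℝ} (hg : DependsOn g (Y : Set (Fin k))) :
    expect μ (fun x => g x * avgSum μ s c Y u x) =
      ∑ r ∈ s, c r * expect μ (fun x => g x * u r x) := by
  unfold avgSum
  simp only [mul_sum]
  rw [expect_sum]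
  refine sum_congr rfl fun r _ => ?_
  rw [← expect_mul_avg hμ hg (u r), ← expect_const_mul]
  congr 1; ext x; ring

/-- Cauchy–Schwarz inside the link and then over the index set: the three sums act as squared norms
and inner product of vectors in a Hilbert space attached to `x`, as the two-point inequality
requires. -/
theorem avg_mul_sq_le (hμ : ∀ x, 0 ≤ μ x) {s : Finset ι} {c : ι → ℝ}
    (hc : ∀ r ∈ s, 0 ≤ c r) (Y : Finset (Fin k)) (a b : ι → (∀ i, V i) → ℝ) (x : ∀ i, V i) :
    avgSum μ s c Y (fun r y => a r y * b r y) x ^ 2 ≤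
      avgSum μ s c Y (fun r y => a r y ^ 2) x * avgSum μ s c Y (fun r y => b r y ^ 2) x := by
  have hl := link_nonneg hμ Y (Y.restrict x)
  refine sum_sq_le_sum_mul_sum_of_sq_le_mul _ (fun r hr => ?_) (fun r hr => ?_) (fun r hr => ?_)
  · exact mul_nonneg (hc r hr) (avg_nonneg hμ Y (fun _ _ => sq_nonneg _) x)
  · exact mul_nonneg (hc r hr) (avg_nonneg hμ Y (fun _ _ => sq_nonneg _) x)
  · have h := sq_le_sq.2 ((abs_expect_mul_le hl (a r) (b r)).trans (le_abs_self _))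
    rw [mul_pow, norm₂_sq hl, norm₂_sq hl] at h
    have h2 : avg μ Y (fun y => a r y * b r y) x ^ 2 ≤
      avg μ Y (fun y => a r y ^ 2) x * avg μ Y (fun y => b r y ^ 2) x := h
    nlinarith [mul_le_mul_of_nonneg_left h2 (sq_nonneg (c r))]

/-- Since each `u r` is unchanged by `A_Z`, this is `A_Y A_Z ≈ A_{Y ∩ Z}` term by term. -/
theorem norm₂_avgSum_sub_erase_le (hμ : ∀ x, 0 ≤ μ x) (hε : 0 ≤ ε) (h : IsEpsProduct ε μ)
    {s : Finset ι} {c : ι → ℝ} (hc : ∀ r ∈ s, 0 ≤ c r) {Y Z : Finset (Fin k)}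
    {u : ι → (∀ i, V i) → ℝ} {B : ℝ} (hu : ∀ r ∈ s, DependsOn (u r) (Z : Set (Fin k)))
    (hB : ∀ r ∈ s, norm₂ μ (u r) ≤ B) :
    norm₂ μ (fun x => avgSum μ s c Y u x - avgSum μ s c (Y ∩ Z) u x) ≤
      (∑ r ∈ s, c r) * ((k : ℝ) ^ 2 * ε * B) := by
  have h1 : ∀ x, avgSum μ s c Y u x - avgSum μ s c (Y ∩ Z) u x =
      ∑ r ∈ s, c r * (avg μ Y (u r) x - avg μ (Y ∩ Z) (u r) x) := fun x => by
    simp only [avgSum, mul_sub, sum_sub_distrib]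
  simp only [h1]
  refine norm₂_sum_mul_le hμ hc fun r hr => ?_
  rw [norm₂_congr hμ (g := fun x => avg μ Y (avg μ Z (u r)) x - avg μ (Y ∩ Z) (u r) x)]
  · exact (norm₂_avg_avg_sub_le hμ hε h Y Z (u r)).trans
      (mul_le_mul_of_nonneg_left (hB r hr) (by positivity))
  · intro x _
    rw [avg_congr hμ Y (fun y hy => avg_of_dependsOn hμ (hu r hr) hy) x]

/-- Splitting off one coordinate `v` in a Hilbert-space valued moment. -/
theorem expect_avgSum_add_sq_pow_le (hμ : ∀ x, 0 ≤ μ x) (hε : 0 ≤ ε) (h : IsEpsProduct ε μ)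
    {s : Finset ι} {c : ι → ℝ} (hc : ∀ r ∈ s, 0 ≤ c r) {Y : Finset (Fin k)} {v : Fin k}
    {a b : ι → (∀ i, V i) → ℝ} {M q η : ℝ} (hM : 0 ≤ M) (hq : 0 ≤ q) (hη : 0 ≤ η)
    (ha : ∀ r ∈ s, DependsOn (a r) (univ.erase v : Finset (Fin k)))
    (haM : ∀ r ∈ s, ∀ x, |a r x| ≤ M) (hbM : ∀ r ∈ s, ∀ x, |b r x| ≤ M)
    (haq : ∀ r ∈ s, norm₂ μ (a r) ≤ q) (hbq : ∀ r ∈ s, norm₂ μ (b r) ≤ q)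
    (hb : ∀ r ∈ s, norm₂ μ (avg μ (univ.erase v) (b r)) ≤ η * q) (n : ℕ) :
    expect μ (fun x => avgSum μ s c Y (fun r y => (a r y + b r y) ^ 2) x ^ (n + 2)) ≤
      expect μ (fun x => (avgSum μ s c (Y.erase v) (fun r y => a r y ^ 2) x +
        24 * (n + 2 : ℝ) * avgSum μ s c (Y.erase v) (fun r y => b r y ^ 2) x) ^ (n + 2)) +
      (n + 3 : ℝ) ^ (2 * (n + 2)) *
        expect μ (fun x => avgSum μ s c Y (fun r y => b r y ^ 2) x ^ (n + 2)) +
      24 * (n + 2 : ℝ) ^ 3 * ((∑ r ∈ s, c r) ^ (n + 2) * M ^ (2 * n + 2) * q ^ 2) *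
        ((k : ℝ) ^ 2 * ε + η) := by
  set σ := ∑ r ∈ s, c r with hσ
  set κ := (k : ℝ) ^ 2 * ε with hκ
  have hσ0 : 0 ≤ σ := sum_nonneg hc
  have hκ0 : 0 ≤ κ := by positivity
  set Na := avgSum μ s c Y (fun r y => a r y ^ 2) with hNa
  set Nb := avgSum μ s c Y (fun r y => b r y ^ 2) with hNb
  set X := avgSum μ s c Y (fun r y => a r y * b r y) with hX
  set P := avgSum μ s c (Y.erase v) (fun r y => a r y ^ 2) with hP
  set Pb := avgSum μ s c (Y.erase v) (fun r y => b r y ^ 2) with hPb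
  have sqM : ∀ t : ℝ, |t| ≤ M → t ^ 2 ≤ M ^ 2 := fun t ht => sq_le_sq.2 (ht.trans (le_abs_self M))
  have hNa0 : ∀ x, 0 ≤ Na x := avgSum_nonneg hμ hc Y fun _ _ _ => sq_nonneg _
  have hNb0 : ∀ x, 0 ≤ Nb x := avgSum_nonneg hμ hc Y fun _ _ _ => sq_nonneg _
  have hP0 : ∀ x, 0 ≤ P x := avgSum_nonneg hμ hc _ fun _ _ _ => sq_nonneg _
  have hPb0 : ∀ x, 0 ≤ Pb x := avgSum_nonneg hμ hc _ fun _ _ _ => sq_nonneg _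
  have hL0 : 0 ≤ σ * M ^ 2 := by positivity
  have hNaL : ∀ x, 0 < μ x → 0 ≤ Na x ∧ Na x ≤ σ * M ^ 2 := fun x hx =>
    ⟨hNa0 x, avgSum_le hμ hc Y (fun r hr y => sqM _ (haM r hr y)) hx⟩
  have hPL : ∀ x, 0 < μ x → 0 ≤ P x ∧ P x ≤ σ * M ^ 2 := fun x hx =>
    ⟨hP0 x, avgSum_le hμ hc _ (fun r hr y => sqM _ (haM r hr y)) hx⟩
  have haa : ∀ r ∈ s, norm₂ μ (fun y => a r y ^ 2) ≤ M * q := fun r hr => by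
    simpa only [sq] using norm₂_mul_le hμ hM (haM r hr) (haq r hr)
  have hbb : ∀ r ∈ s, norm₂ μ (fun y => b r y ^ 2) ≤ M * q := fun r hr => by
    simpa only [sq] using norm₂_mul_le hμ hM (hbM r hr) (hbq r hr)
  have hNal : norm₂ μ Na ≤ σ * (M * q) := norm₂_avgSum_le hμ hc Y haa
  have hNbl : norm₂ μ Nb ≤ σ * (M * q) := norm₂_avgSum_le hμ hc Y hbb
  have hPl : norm₂ μ P ≤ σ * (M * q) := norm₂_avgSum_le hμ hc _ haa
  have hXl : norm₂ μ X ≤ σ * (M * q) :=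
    norm₂_avgSum_le hμ hc Y fun r hr => norm₂_mul_le hμ hM (haM r hr) (hbq r hr)
  have hYv : Y ∩ univ.erase v = Y.erase v := by grind
  have hasq : ∀ r ∈ s, DependsOn (fun y => a r y ^ 2) (univ.erase v : Finset (Fin k)) :=
    fun r hr x y hxy => by simp only [ha r hr hxy]
  have hdiff : norm₂ μ (fun x => Na x - P x) ≤ κ * (σ * (M * q)) := by
    have := norm₂_avgSum_sub_erase_le hμ hε h hc (Y := Y) hasq haa
    rw [hYv] at this
    refine this.trans (le_of_eq ?_)
    rw [hκ]; ring
  have hPdep : DependsOn P (Y.erase v : Finset (Fin k)) := avgSum_dependsOn s c _ _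
  have hPpow : DependsOn (fun x => P x ^ (n + 1)) (Y.erase v : Finset (Fin k)) :=
    fun x y hxy => by simp only [hPdep hxy]
  have hl0 : 0 ≤ σ * (M * q) := by positivity
  set l := σ * (M * q) with hl
  set L := σ * M ^ 2 with hL
  have hLl : L ^ n * l ^ 2 = σ ^ (n + 2) * M ^ (2 * n + 2) * q ^ 2 := by
    rw [hL, hl]; ring
  rw [← hLl]
  have hdl : ∀ φ : (∀ i, V i) → ℝ, norm₂ μ φ ≤ l →
      expect μ (fun x => (Na x ^ (n + 1) - P x ^ (n + 1)) * φ x) ≤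
        (n + 1 : ℝ) * κ * (L ^ n * l ^ 2) := fun φ hφ => by
    refine (expect_pow_sub_pow_mul_le hμ hNaL hPL n φ hL0).trans ?_
    have : norm₂ μ (fun x => Na x - P x) * norm₂ μ φ ≤ κ * l * l :=
      mul_le_mul hdiff hφ (norm₂_nonneg _) (by positivity)
    calc _ ≤ (n + 1 : ℝ) * L ^ n * (κ * l * l) := by gcongr
      _ = _ := by ring
  have t1 : expect μ (fun x => Na x ^ (n + 2)) ≤ expect μ (fun x => P x ^ (n + 2)) +
      (n + 2 : ℝ) * κ * (L ^ n * l ^ 2) := by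
    refine (expect_pow_sub_pow_le hμ hNaL hPL n hL0).trans ?_
    have : norm₂ μ (fun x => Na x - P x) * (norm₂ μ Na + (n + 1 : ℝ) * norm₂ μ P) ≤
        κ * l * (l + (n + 1 : ℝ) * l) := by
      have h0 : 0 ≤ norm₂ μ Na + (n + 1 : ℝ) * norm₂ μ P :=
        add_nonneg (norm₂_nonneg _) (mul_nonneg (by positivity) (norm₂_nonneg _))
      gcongr
    have h2 := mul_le_mul_of_nonneg_left this (pow_nonneg hL0 n)
    have e : L ^ n * (κ * l * (l + (n + 1 : ℝ) * l)) = (n + 2 : ℝ) * κ * (L ^ n * l ^ 2) := by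
      ring
    linarith
  -- After `Na` is replaced by `P`, neither `P` nor `a` depends on `v`. The average over `v`
  -- therefore falls on `b` alone, where it is small by hypothesis.
  have t2 : expect μ (fun x => Na x ^ (n + 1) * X x) ≤
      (n + 1 : ℝ) * κ * (L ^ n * l ^ 2) + η * (L ^ n * l ^ 2) := by
    have e1 : expect μ (fun x => Na x ^ (n + 1) * X x) =
        expect μ (fun x => (Na x ^ (n + 1) - P x ^ (n + 1)) * X x) +
          expect μ (fun x => P x ^ (n + 1) * X x) := by
      rw [← expect_add]; congr 1; ext x; ring
    have e2 : expect μ (fun x => P x ^ (n + 1) * X x) ≤ η * (L ^ n * l ^ 2) := by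
      rw [expect_mul_avgSum hμ s c _ (dependsOn_mono (erase_subset v Y) hPpow)]
      have e3 : ∀ r ∈ s, c r * expect μ (fun x => P x ^ (n + 1) * (a r x * b r x)) ≤
          c r * (L ^ (n + 1) * q * (η * q)) := fun r hr => by
        refine mul_le_mul_of_nonneg_left ?_ (hc r hr)
        have hd : DependsOn (fun x => P x ^ (n + 1) * a r x) (univ.erase v : Finset (Fin k)) := by
          intro x y hxy
          have := dependsOn_mono (T := univ.erase v) (by grind) hPpow hxy
          simp only at this ⊢
          rw [this, ha r hr hxy]
        have e4 := expect_mul_avg hμ hd (b r)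
        simp only [mul_assoc] at e4
        rw [← e4]
        have e5 : (fun x => P x ^ (n + 1) * (a r x * avg μ (univ.erase v) (b r) x)) =
            fun x => (P x ^ (n + 1) * a r x) * avg μ (univ.erase v) (b r) x := by ext x; ring
        rw [e5]
        refine (expect_mul_le hμ _ _).trans ?_
        refine mul_le_mul ?_ (hb r hr) (norm₂_nonneg _) (by positivity)
        refine (norm₂_mono hμ (g := fun x => L ^ (n + 1) * a r x) fun x hx => ?_).trans ?_
        · rw [abs_mul, abs_mul, abs_of_nonneg (pow_nonneg (hP0 x) _),
            abs_of_nonneg (pow_nonneg hL0 _)]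
          exact mul_le_mul_of_nonneg_right
            (pow_le_pow_left₀ (hP0 x) (hPL x hx).2 _) (abs_nonneg _)
        · rw [norm₂_const_mul, abs_of_nonneg (pow_nonneg hL0 _)]
          exact mul_le_mul_of_nonneg_left (haq r hr) (pow_nonneg hL0 _)
      refine (sum_le_sum e3).trans (le_of_eq ?_)
      rw [← sum_mul, ← hσ, hL, hl]
      ring
    rw [e1]
    exact add_le_add (hdl X hXl) e2
  -- Once `Na` is replaced by the `v`-free `P`, averaging over `v` in the other factor is exact and
  -- turns `Nb` into `Pb`.
  have t3 : expect μ (fun x => Na x ^ (n + 1) * Nb x) ≤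
      (n + 1 : ℝ) * κ * (L ^ n * l ^ 2) + expect μ (fun x => P x ^ (n + 1) * Pb x) := by
    have e1 : expect μ (fun x => Na x ^ (n + 1) * Nb x) =
        expect μ (fun x => (Na x ^ (n + 1) - P x ^ (n + 1)) * Nb x) +
          expect μ (fun x => P x ^ (n + 1) * Nb x) := by
      rw [← expect_add]; congr 1; ext x; ring
    have e2 : expect μ (fun x => P x ^ (n + 1) * Nb x) =
        expect μ (fun x => P x ^ (n + 1) * Pb x) := by
      rw [expect_mul_avgSum hμ s c _ (dependsOn_mono (erase_subset v Y) hPpow),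
        expect_mul_avgSum hμ s c _ hPpow]
    rw [e1, e2]
    exact add_le_add (hdl Nb hNbl) le_rfl
  -- With `m = n + 2`, the term `24 m² P^(m-1) Pb` is the linear term of `(P + 24 m Pb)^m`.
  have t4 : expect μ (fun x => P x ^ (n + 2)) +
      24 * (n + 2 : ℝ) ^ 2 * expect μ (fun x => P x ^ (n + 1) * Pb x) ≤
      expect μ (fun x => (P x + 24 * (n + 2 : ℝ) * Pb x) ^ (n + 2)) := by
    rw [← expect_const_mul, ← expect_add]
    refine expect_mono hμ fun x _ => ?_
    have := pow_add_mul_pow_le (hP0 x)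
      (by have := hPb0 x; positivity : 0 ≤ 24 * (n + 2 : ℝ) * Pb x) (n + 1)
    push_cast at this
    refine le_trans (le_of_eq ?_) this
    ring
  have t0 : expect μ (fun x => avgSum μ s c Y (fun r y => (a r y + b r y) ^ 2) x ^ (n + 2)) ≤
      expect μ (fun x => Na x ^ (n + 2)) + 2 * (n + 2 : ℝ) * expect μ (fun x => Na x ^ (n + 1) * X x)
        + 24 * (n + 2 : ℝ) ^ 2 * expect μ (fun x => Na x ^ (n + 1) * Nb x)
        + (n + 3 : ℝ) ^ (2 * (n + 2)) * expect μ (fun x => Nb x ^ (n + 2)) := by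
    rw [← expect_const_mul, ← expect_const_mul, ← expect_const_mul, ← expect_add, ← expect_add,
      ← expect_add]
    refine expect_mono hμ fun x _ => ?_
    have e1 : avgSum μ s c Y (fun r y => (a r y + b r y) ^ 2) x = Na x + 2 * X x + Nb x := by
      simp only [hNa, hX, hNb, avgSum, mul_sum, ← sum_add_distrib]
      refine sum_congr rfl fun r _ => ?_
      have : (fun y => (a r y + b r y) ^ 2) =
          fun y => (a r y ^ 2 + 2 * (a r y * b r y)) + b r y ^ 2 := by ext y; ring
      rw [this, avg_add, avg_add, avg_const_mul]
      ring
    rw [e1]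
    have := add_two_mul_add_pow_le (hNa0 x) (hNb0 x) (avg_mul_sq_le hμ hc Y a b x) (n + 1)
    push_cast at this
    have c1 : (n : ℝ) + 1 + 1 = n + 2 := by ring
    have c2 : (n : ℝ) + 1 + 2 = n + 3 := by ring
    rw [c1, c2] at this
    exact this
  have he : 0 ≤ L ^ n * l ^ 2 := by positivity
  have hn : (0 : ℝ) ≤ n := n.cast_nonneg
  have t2' := mul_le_mul_of_nonneg_left t2 (by positivity : 0 ≤ 2 * (n + 2 : ℝ))
  have t3' := mul_le_mul_of_nonneg_left t3 (by positivity : 0 ≤ 24 * (n + 2 : ℝ) ^ 2)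
  have final : (n + 2 : ℝ) * κ * (L ^ n * l ^ 2) +
      2 * (n + 2 : ℝ) * ((n + 1 : ℝ) * κ * (L ^ n * l ^ 2) + η * (L ^ n * l ^ 2)) +
      24 * (n + 2 : ℝ) ^ 2 * ((n + 1 : ℝ) * κ * (L ^ n * l ^ 2)) ≤
      24 * (n + 2 : ℝ) ^ 3 * (L ^ n * l ^ 2) * (κ + η) := by
    rw [← sub_nonneg]
    have e : 24 * (n + 2 : ℝ) ^ 3 * (L ^ n * l ^ 2) * (κ + η) - ((n + 2 : ℝ) * κ * (L ^ n * l ^ 2) +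
      2 * (n + 2 : ℝ) * ((n + 1 : ℝ) * κ * (L ^ n * l ^ 2) + η * (L ^ n * l ^ 2)) +
      24 * (n + 2 : ℝ) ^ 2 * ((n + 1 : ℝ) * κ * (L ^ n * l ^ 2))) =
      (L ^ n * l ^ 2) * (κ * ((n + 2 : ℝ) * (22 * n + 45)) +
        η * ((n + 2 : ℝ) * (24 * (n + 2) ^ 2 - 2))) := by ring
    rw [e]
    have : (0 : ℝ) ≤ 24 * (n + 2) ^ 2 - 2 := by nlinarith
    positivity
  linarith

end OneStep

/-! ### Hypercontractivity by induction on the coordinates -/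

theorem insert_sdiff_insert_of_notMem {α : Type*} [DecidableEq α] {T Z : Finset α} {v : α}
    (hv : v ∉ Z) : insert v Z \ insert v T = Z \ T := by
  ext w
  by_cases hw : w = v
  · subst hw; simp [hv]
  · simp [hw]

section SetIdentities
variable {α : Type*} [Fintype α] [DecidableEq α] {T Z : Finset α} {v : α}

theorem erase_union_compl (hvT : v ∉ T) : (T ∪ Zᶜ).erase v = T ∪ (insert v Z)ᶜ := by
  ext w
  by_cases hw : w = v
  · subst hw; simp [hvT]
  · simp [hw]

theorem insert_union_compl_insert (hv : v ∉ Z) : insert v T ∪ (insert v Z)ᶜ = T ∪ Zᶜ := by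
  ext w
  by_cases hw : w = v
  · subst hw; simp [hv]
  · simp [hw]

end SetIdentities

section TracePart
variable {k : ℕ} {V : Fin k → Type*}

/-- The sum of the components `g S` whose trace on `Z` is `P`. -/
def tracePart (g : Finset (Fin k) → (∀ i, V i) → ℝ) (Z P : Finset (Fin k)) (x : ∀ i, V i) : ℝ :=
  ∑ S with S ∩ Z = P, g S x

theorem tracePart_insert (g : Finset (Fin k) → (∀ i, V i) → ℝ) {Z P : Finset (Fin k)} {v : Fin k}
    (hv : v ∉ Z) (hP : P ⊆ Z) (x : ∀ i, V i) :
    tracePart g Z P x =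
      tracePart g (insert v Z) P x + tracePart g (insert v Z) (insert v P) x := by
  have hvP : v ∉ P := fun h => hv (hP h)
  unfold tracePart
  rw [← sum_union]
  · refine sum_congr ?_ fun _ _ => rfl
    ext S
    simp only [mem_filter, mem_univ, true_and, mem_union]
    by_cases hS : v ∈ S
    · rw [inter_insert_of_mem hS]
      constructor
      · rintro rfl; exact Or.inr rfl
      · rintro (h | h)
        · exact absurd (h ▸ mem_insert_self v _) hvP
        · have := congrArg (fun A => A.erase v) h
          simpa [hv, hvP] using this
    · rw [inter_insert_of_notMem hS]
      constructor
      · exact Or.inl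
      · rintro (h | h)
        · exact h
        · exact absurd (h ▸ mem_insert_self v P) (by simp [hS])
  · rw [disjoint_left]
    intro S h1 h2
    simp only [mem_filter, mem_univ, true_and] at h1 h2
    rw [h1] at h2
    exact hvP (h2 ▸ mem_insert_self v P)

theorem abs_tracePart_le {g : Finset (Fin k) → (∀ i, V i) → ℝ} {b : ℝ} (hb : 0 ≤ b)
    (hg : ∀ S x, |g S x| ≤ b) (Z P : Finset (Fin k)) (x : ∀ i, V i) :
    |tracePart g Z P x| ≤ 2 ^ k * b := by
  refine (abs_sum_le_sum_abs _ _).trans ((sum_le_sum fun S _ => hg S x).trans ?_)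
  rw [sum_const, nsmul_eq_mul]
  refine mul_le_mul_of_nonneg_right ?_ hb
  have := card_le_univ (filter (fun S => S ∩ Z = P) (univ : Finset (Finset (Fin k))))
  rw [Fintype.card_finset, Fintype.card_fin] at this
  exact_mod_cast this

end TracePart

section Hypercontractive
variable {k : ℕ} {V : Fin k → Type*} [∀ i, Fintype (V i)] {μ : (∀ i, V i) → ℝ} {ε : ℝ}

/-- The moment bound in which the coordinates of `Z` have been split off. -/
noncomputable def momentSum (μ : (∀ i, V i) → ℝ) (g : Finset (Fin k) → (∀ i, V i) → ℝ)
    (n : ℕ) (γ C : ℝ) (Z : Finset (Fin k)) : ℝ :=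
  ∑ T ∈ Z.powerset, γ ^ T.card * expect μ (fun x =>
    avgSum μ (Z \ T).powerset (fun R => C ^ R.card) (T ∪ Zᶜ)
      (fun R y => tracePart g Z (T ∪ R) y ^ 2) x ^ (n + 2))

theorem norm₂_sum_filter_le (hμ : ∀ x, 0 ≤ μ x) {u : Finset (Fin k) → (∀ i, V i) → ℝ} {q : ℝ}
    (hq : 0 ≤ q) (p : Finset (Fin k) → Prop) [DecidablePred p]
    (hu : ∀ S, p S → norm₂ μ (u S) ≤ q) :
    norm₂ μ (fun x => ∑ S with p S, u S x) ≤ 2 ^ k * q := by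
  refine (norm₂_sum_le hμ _ _).trans
    ((sum_le_sum fun S hS => hu S (by simpa using hS)).trans ?_)
  rw [sum_const, nsmul_eq_mul]
  refine mul_le_mul_of_nonneg_right ?_ hq
  have := card_le_univ (filter p (univ : Finset (Finset (Fin k))))
  rw [Fintype.card_finset, Fintype.card_fin] at this
  exact_mod_cast this

theorem sum_powerset_pow_card_le {C : ℝ} (hC : 0 ≤ C) (Z : Finset (Fin k)) :
    ∑ R ∈ Z.powerset, C ^ R.card ≤ (1 + C) ^ k := by
  have := sum_pow_mul_eq_add_pow C 1 Z
  simp only [one_pow, mul_one] at this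
  rw [this, add_comm]
  exact pow_le_pow_right₀ (by linarith) ((card_le_univ Z).trans (Fintype.card_fin k).le)

/-- The family indexed by `R` is split by whether a component contains `v`. The two-point inequality
then yields two kinds of terms: `v` averaged out and added to `R` with weight `C`, or `v` kept for
conditioning and added to `T` with weight `γ`. -/
theorem momentSum_term_le (hμ : ∀ x, 0 ≤ μ x) (hε : 0 ≤ ε) (h : IsEpsProduct ε μ)
    {g : Finset (Fin k) → (∀ i, V i) → ℝ} {b q η : ℝ} (hb : 0 ≤ b) (hq : 0 ≤ q) (hη : 0 ≤ η)
    (hdep : ∀ S, DependsOn (g S) (S : Set (Fin k))) (hgb : ∀ S x, |g S x| ≤ b)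
    (hgq : ∀ S, norm₂ μ (g S) ≤ q)
    (hgη : ∀ S, ∀ v ∈ S, norm₂ μ (avg μ (univ.erase v) (g S)) ≤ η * q) (n : ℕ)
    {Z : Finset (Fin k)} {v : Fin k} (hv : v ∉ Z) {γ C : ℝ}
    (hγ : γ = (n + 3 : ℝ) ^ (2 * (n + 2))) (hC : C = 24 * (n + 2 : ℝ))
    {T : Finset (Fin k)} (hT : T ⊆ Z) :
    γ ^ T.card * expect μ (fun x =>
      avgSum μ (Z \ T).powerset (fun R => C ^ R.card) (T ∪ Zᶜ)
        (fun R y => tracePart g Z (T ∪ R) y ^ 2) x ^ (n + 2)) ≤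
      γ ^ T.card * expect μ (fun x =>
        avgSum μ (insert v Z \ T).powerset (fun R => C ^ R.card) (T ∪ (insert v Z)ᶜ)
          (fun R y => tracePart g (insert v Z) (T ∪ R) y ^ 2) x ^ (n + 2)) +
      γ ^ (insert v T).card * expect μ (fun x =>
        avgSum μ (insert v Z \ insert v T).powerset (fun R => C ^ R.card)
          (insert v T ∪ (insert v Z)ᶜ)
          (fun R y => tracePart g (insert v Z) (insert v T ∪ R) y ^ 2) x ^ (n + 2)) +
      γ ^ T.card * (24 * (n + 2 : ℝ) ^ 3 * (((1 + C) ^ k) ^ (n + 2) *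
        (2 ^ k * b) ^ (2 * n + 2) * (2 ^ k * q) ^ 2) * ((k : ℝ) ^ 2 * ε + η)) := by
  have hγ0 : 0 ≤ γ := by rw [hγ]; positivity
  have hC0 : 0 ≤ C := by rw [hC]; positivity
  set e := 24 * (n + 2 : ℝ) ^ 3 * (((1 + C) ^ k) ^ (n + 2) *
        (2 ^ k * b) ^ (2 * n + 2) * (2 ^ k * q) ^ 2) * ((k : ℝ) ^ 2 * ε + η) with he
  have he0 : 0 ≤ e := by positivity
  have hvT : v ∉ T := fun h => hv (hT h)
  have hPZ : ∀ R ∈ (Z \ T).powerset, T ∪ R ⊆ Z := fun R hR => by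
    rw [mem_powerset] at hR; grind
  have hc : ∀ R ∈ (Z \ T).powerset, 0 ≤ C ^ R.card := fun R _ => by positivity
  have hadep : ∀ R ∈ (Z \ T).powerset,
      DependsOn (tracePart g (insert v Z) (T ∪ R)) (univ.erase v : Finset (Fin k)) := by
    intro R hR x y hxy
    refine sum_congr rfl fun S hS => dependsOn_mono (T := univ.erase v) ?_ (hdep S) hxy
    have hS' : S ∩ insert v Z = T ∪ R := (mem_filter.1 hS).2
    intro w hw
    refine mem_erase.2 ⟨?_, mem_univ w⟩
    rintro rfl
    have : w ∈ T ∪ R := hS' ▸ mem_inter.2 ⟨hw, mem_insert_self w Z⟩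
    exact hv (hPZ R hR this)
  have hbη : ∀ R ∈ (Z \ T).powerset,
      norm₂ μ (avg μ (univ.erase v) (tracePart g (insert v Z) (insert v (T ∪ R)))) ≤
        η * (2 ^ k * q) := by
    intro R _
    have e1 : avg μ (univ.erase v) (tracePart g (insert v Z) (insert v (T ∪ R))) =
        fun x => ∑ S with S ∩ insert v Z = insert v (T ∪ R), avg μ (univ.erase v) (g S) x :=
      funext fun x => avg_sum _ _ _ x
    rw [e1]
    refine (norm₂_sum_filter_le hμ (mul_nonneg hη hq) _ fun S hS => hgη S v ?_).trans
      (le_of_eq (by ring))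
    have : v ∈ S ∩ insert v Z := hS ▸ mem_insert_self v _
    exact (mem_inter.1 this).1
  have hq' : ∀ P, norm₂ μ (tracePart g (insert v Z) P) ≤ 2 ^ k * q := fun P =>
    norm₂_sum_filter_le hμ hq _ fun S _ => hgq S
  have key := expect_avgSum_add_sq_pow_le hμ hε h (s := (Z \ T).powerset)
    (c := fun R => C ^ R.card) hc (Y := T ∪ Zᶜ) (v := v)
    (a := fun R => tracePart g (insert v Z) (T ∪ R))
    (b := fun R => tracePart g (insert v Z) (insert v (T ∪ R)))
    (M := 2 ^ k * b) (q := 2 ^ k * q) (η := η) (by positivity) (by positivity) hη hadep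
    (fun R _ x => abs_tracePart_le hb hgb _ _ x) (fun R _ x => abs_tracePart_le hb hgb _ _ x)
    (fun R _ => hq' _) (fun R _ => hq' _) hbη n
  have e1 : avgSum μ (Z \ T).powerset (fun R => C ^ R.card) (T ∪ Zᶜ)
      (fun R y => tracePart g Z (T ∪ R) y ^ 2) =
      avgSum μ (Z \ T).powerset (fun R => C ^ R.card) (T ∪ Zᶜ)
      (fun R y => (tracePart g (insert v Z) (T ∪ R) y +
        tracePart g (insert v Z) (insert v (T ∪ R)) y) ^ 2) := by
    funext x
    unfold avgSum
    refine sum_congr rfl fun R hR => ?_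
    congr 2
    funext y
    dsimp only
    rw [tracePart_insert g hv (hPZ R hR)]
  have e2 := erase_union_compl (Z := Z) hvT
  -- Subsets `R` of the enlarged index set are paired with `insert v R`; the extra factor `C` is
  -- exactly the `24 (n + 2)` of the one-coordinate step.
  have e3 : ∀ x, avgSum μ (insert v Z \ T).powerset (fun R => C ^ R.card) (T ∪ (insert v Z)ᶜ)
        (fun R y => tracePart g (insert v Z) (T ∪ R) y ^ 2) x =
      avgSum μ (Z \ T).powerset (fun R => C ^ R.card) ((T ∪ Zᶜ).erase v)
        (fun R y => tracePart g (insert v Z) (T ∪ R) y ^ 2) x +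
      24 * (n + 2 : ℝ) * avgSum μ (Z \ T).powerset (fun R => C ^ R.card) ((T ∪ Zᶜ).erase v)
        (fun R y => tracePart g (insert v Z) (insert v (T ∪ R)) y ^ 2) x := by
    intro x
    rw [e2, insert_sdiff_of_notMem _ hvT]
    unfold avgSum
    rw [sum_powerset_insert (fun hh => hv (mem_sdiff.1 hh).1), mul_sum]
    congr 1
    refine sum_congr rfl fun R hR => ?_
    dsimp only
    rw [card_insert_of_notMem fun hh => hv (mem_sdiff.1 (mem_powerset.1 hR hh)).1, union_insert, pow_succ C R.card, ← hC]
    ring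
  have e4 := insert_union_compl_insert (T := T) hv
  have e5 := insert_sdiff_insert_of_notMem (T := T) hv
  have hle : (∑ R ∈ (Z \ T).powerset, C ^ R.card) ^ (n + 2) ≤ ((1 + C) ^ k) ^ (n + 2) :=
    pow_le_pow_left₀ (sum_nonneg hc) (sum_powerset_pow_card_le hC0 _) _
  rw [e1, e4, e5, card_insert_of_notMem hvT, pow_succ γ T.card]
  simp only [e3, insert_union]
  have hγT : 0 ≤ γ ^ T.card := by positivity
  rw [mul_assoc, ← mul_add, ← mul_add]
  rw [← hγ] at key
  refine mul_le_mul_of_nonneg_left (key.trans (add_le_add_right ?_ _)) hγT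
  rw [he]
  gcongr

theorem momentSum_le_insert (hμ : ∀ x, 0 ≤ μ x) (hε : 0 ≤ ε) (h : IsEpsProduct ε μ)
    {g : Finset (Fin k) → (∀ i, V i) → ℝ} {b q η : ℝ} (hb : 0 ≤ b) (hq : 0 ≤ q) (hη : 0 ≤ η)
    (hdep : ∀ S, DependsOn (g S) (S : Set (Fin k))) (hgb : ∀ S x, |g S x| ≤ b)
    (hgq : ∀ S, norm₂ μ (g S) ≤ q)
    (hgη : ∀ S, ∀ v ∈ S, norm₂ μ (avg μ (univ.erase v) (g S)) ≤ η * q) (n : ℕ)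
    {Z : Finset (Fin k)} {v : Fin k} (hv : v ∉ Z) {γ C : ℝ}
    (hγ : γ = (n + 3 : ℝ) ^ (2 * (n + 2))) (hC : C = 24 * (n + 2 : ℝ)) :
    momentSum μ g n γ C Z ≤ momentSum μ g n γ C (insert v Z) +
      (1 + γ) ^ k * (24 * (n + 2 : ℝ) ^ 3 * (((1 + C) ^ k) ^ (n + 2) *
        (2 ^ k * b) ^ (2 * n + 2) * (2 ^ k * q) ^ 2) * ((k : ℝ) ^ 2 * ε + η)) := by
  have hγ0 : 0 ≤ γ := by rw [hγ]; positivity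
  have hC0 : 0 ≤ C := by rw [hC]; positivity
  set e := 24 * (n + 2 : ℝ) ^ 3 * (((1 + C) ^ k) ^ (n + 2) *
        (2 ^ k * b) ^ (2 * n + 2) * (2 ^ k * q) ^ 2) * ((k : ℝ) ^ 2 * ε + η) with he
  have he0 : 0 ≤ e := by positivity
  have hterm := fun T (hT : T ∈ Z.powerset) => momentSum_term_le hμ hε h hb hq hη hdep hgb hgq hgη n
    hv hγ hC (mem_powerset.1 hT)
  simp only [← he] at hterm
  unfold momentSum
  rw [sum_powerset_insert hv]
  refine (sum_le_sum hterm).trans ?_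
  rw [sum_add_distrib, sum_add_distrib, ← sum_mul]
  have := mul_le_mul_of_nonneg_right (sum_powerset_pow_card_le hγ0 Z) he0
  linarith

/-- Hypercontractivity for sums of components that are nearly orthogonal to functions of fewer
coordinates. -/
theorem exists_expect_sum_pow_le (k n : ℕ) : ∃ K : ℝ, 0 ≤ K ∧
    ∀ (V : Fin k → Type*) [∀ i, Fintype (V i)] (μ : (∀ i, V i) → ℝ) (ε : ℝ),
      (∀ x, 0 ≤ μ x) → 0 ≤ ε → IsEpsProduct ε μ →
      ∀ (g : Finset (Fin k) → (∀ i, V i) → ℝ) (b q η : ℝ), 0 ≤ b → 0 ≤ q → 0 ≤ η →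
        (∀ S, DependsOn (g S) (S : Set (Fin k))) → (∀ S x, |g S x| ≤ b) →
        (∀ S, norm₂ μ (g S) ≤ q) →
        (∀ S, ∀ v ∈ S, norm₂ μ (avg μ (univ.erase v) (g S)) ≤ η * q) →
        expect μ (fun x => (∑ S, g S x) ^ (2 * (n + 2))) ≤
          ∑ T, ((n + 3 : ℝ) ^ (2 * (n + 2))) ^ T.card * expect μ (fun x =>
            avgSum μ (univ \ T).powerset (fun R => (24 * (n + 2 : ℝ)) ^ R.card) T
              (fun R y => g (T ∪ R) y ^ 2) x ^ (n + 2)) +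
          K * (b ^ (2 * n + 2) * q ^ 2 * ((k : ℝ) ^ 2 * ε + η)) := by
  set γ := (n + 3 : ℝ) ^ (2 * (n + 2)) with hγ
  set C := 24 * (n + 2 : ℝ) with hC
  refine ⟨k * ((1 + γ) ^ k * (24 * (n + 2 : ℝ) ^ 3 * (((1 + C) ^ k) ^ (n + 2) *
    (2 ^ k) ^ (2 * n + 2) * (2 ^ k) ^ 2))), by positivity, ?_⟩
  intro V _ μ ε hμ hε h g b q η hb hq hη hdep hgb hgq hgη
  set e := (1 + γ) ^ k * (24 * (n + 2 : ℝ) ^ 3 * (((1 + C) ^ k) ^ (n + 2) *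
        (2 ^ k * b) ^ (2 * n + 2) * (2 ^ k * q) ^ 2) * ((k : ℝ) ^ 2 * ε + η)) with he
  have hind : ∀ Z : Finset (Fin k), momentSum μ g n γ C ∅ ≤ momentSum μ g n γ C Z + Z.card * e := by
    intro Z
    induction Z using Finset.induction_on with
    | empty => simp
    | insert v Z hv ih =>
      have := momentSum_le_insert hμ hε h hb hq hη hdep hgb hgq hgη n hv hγ hC
      rw [card_insert_of_notMem hv]
      push_cast
      linarith
  -- With nothing split off there is one trace class and `A_univ` is the identity on the support;
  -- with everything split off each trace class is a single component.
  have h0 : momentSum μ g n γ C ∅ = expect μ (fun x => (∑ S, g S x) ^ (2 * (n + 2))) := by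
    unfold momentSum avgSum tracePart
    simp only [powerset_empty, sum_singleton, card_empty, pow_zero, one_mul, empty_sdiff,
      inter_empty, union_empty, filter_true, compl_empty, empty_union]
    refine expect_congr hμ fun x hx => ?_
    rw [avg_univ hμ _ hx, ← pow_mul]
  have h1 : momentSum μ g n γ C univ = ∑ T,
    γ ^ T.card * expect μ (fun x =>
      avgSum μ (univ \ T).powerset (fun R => C ^ R.card) T
        (fun R y => g (T ∪ R) y ^ 2) x ^ (n + 2)) := by
    unfold momentSum tracePart
    simp only [inter_univ, filter_eq', mem_univ, if_true, sum_singleton, compl_univ, union_empty,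
      powerset_univ]
  have h2 := hind univ
  rw [h0, h1, card_univ, Fintype.card_fin] at h2
  refine h2.trans (le_of_eq ?_)
  rw [he]
  ring

end Hypercontractive

/-! ### Reindexing of subsets and alternating sums -/

section Combinatorics

theorem sum_powerset_union_of_disjoint {α M : Type*} [DecidableEq α] [AddCommMonoid M]
    {T R : Finset α} (h : Disjoint T R) (F : Finset α → M) :
    ∑ U ∈ (T ∪ R).powerset, F U = ∑ A ∈ T.powerset, ∑ B ∈ R.powerset, F (A ∪ B) := by
  rw [← sum_product']
  rw [disjoint_left] at h
  refine sum_nbij' (fun U => (U ∩ T, U ∩ R)) (fun p => p.1 ∪ p.2) ?_ ?_ ?_ ?_ ?_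
  · intro U _
    simp
  · rintro ⟨A, B⟩ hp
    simp only [mem_product, mem_powerset] at hp ⊢
    exact union_subset_union hp.1 hp.2
  · intro U hU
    rw [mem_powerset] at hU
    rw [← inter_union_distrib_left, inter_eq_left.2 hU]
  · rintro ⟨A, B⟩ hp
    simp only [mem_product, mem_powerset] at hp
    ext w <;> simp only [mem_inter, mem_union]
    · exact ⟨fun hw => hw.1.resolve_right fun hB => h hw.2 (hp.2 hB), fun hw => ⟨.inl hw, hp.1 hw⟩⟩
    · exact ⟨fun hw => hw.1.resolve_left fun hA => h (hp.1 hA) hw.2, fun hw => ⟨.inr hw, hp.2 hw⟩⟩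
  · intro U hU
    rw [mem_powerset] at hU
    rw [← inter_union_distrib_left, inter_eq_left.2 hU]

theorem sum_sum_powerset_sdiff {α M : Type*} [Fintype α] [DecidableEq α] [AddCommMonoid M]
    (F : Finset α → Finset α → M) :
    ∑ T, ∑ R ∈ (univ \ T).powerset, F T R = ∑ S, ∑ T ∈ S.powerset, F T (S \ T) := by
  rw [sum_sigma', sum_sigma']
  refine sum_nbij' (fun p => ⟨p.1 ∪ p.2, p.1⟩) (fun p => ⟨p.2, p.1 \ p.2⟩) ?_ ?_ ?_ ?_ ?_
  · rintro ⟨T, R⟩ _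
    simp only [mem_sigma, mem_univ, mem_powerset, true_and]
    exact subset_union_left
  · rintro ⟨S, T⟩ _
    simp only [mem_sigma, mem_univ, mem_powerset, true_and]
    exact sdiff_subset_sdiff (subset_univ _) le_rfl
  · rintro ⟨T, R⟩ hp
    simp only [mem_sigma, mem_univ, mem_powerset, true_and] at hp
    have hd : Disjoint R T := disjoint_of_subset_left hp sdiff_disjoint
    simp [union_sdiff_left, sdiff_eq_self_of_disjoint hd]
  · rintro ⟨S, T⟩ hp
    simp only [mem_sigma, mem_univ, mem_powerset, true_and] at hp
    simp [union_sdiff_of_subset hp]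
  · rintro ⟨T, R⟩ hp
    simp only [mem_sigma, mem_univ, mem_powerset, true_and] at hp
    have hd : Disjoint R T := disjoint_of_subset_left hp sdiff_disjoint
    simp [union_sdiff_left, sdiff_eq_self_of_disjoint hd]

/-- Alternating sums over the subsets of `S` vanish when the summand ignores a point of `S`. -/
theorem sum_powerset_neg_one_pow_mul_inter {α : Type*} [DecidableEq α] {S T : Finset α}
    (h : ¬S ⊆ T) (F : Finset α → ℝ) :
    ∑ U ∈ S.powerset, (-1 : ℝ) ^ (S \ U).card * F (T ∩ U) = 0 := by
  obtain ⟨v, hvS, hvT⟩ := not_subset.1 h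
  rw [← insert_erase hvS, sum_powerset_insert (notMem_erase v S), ← sum_add_distrib]
  refine sum_eq_zero fun U hU => ?_
  have hvU : v ∉ U := fun hv => notMem_erase v S (mem_powerset.1 hU hv)
  rw [insert_sdiff_insert_of_notMem (notMem_erase v S), insert_sdiff_of_notMem _ hvU,
    card_insert_of_notMem (by simp), inter_insert_of_notMem hvT, pow_succ]
  ring

theorem powerset_card_le {k : ℕ} (S : Finset (Fin k)) : (S.powerset.card : ℝ) ≤ 2 ^ k := by
  rw [card_powerset]
  push_cast
  exact pow_le_pow_right₀ one_le_two ((card_le_univ S).trans (Fintype.card_fin k).le)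

end Combinatorics

/-! ### The Efron–Stein decomposition and its near-orthogonality -/

section EfronStein
variable {k : ℕ} {V : Fin k → Type*} [∀ i, Fintype (V i)] {μ : (∀ i, V i) → ℝ} {ε : ℝ}

/-- The weight `(1 - ρ)^(k - |T|)` is the sum of `(-ρ)^|R|` over `R` disjoint from `T`; grouping by
`S = T ∪ R` produces the alternating sums. -/
theorem noise_eq_sum_efronStein (ρ : ℝ) (f : (∀ i, V i) → ℝ) (x : ∀ i, V i) :
    noise μ ρ f x = ∑ S : Finset (Fin k), ρ ^ S.card * efronStein μ S f x := by
  unfold noise efronStein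
  simp only [mul_sum]
  have key := sum_sum_powerset_sdiff (α := Fin k) fun T R =>
    ρ ^ (T.card + R.card) * ((-1 : ℝ) ^ R.card * avg μ T f x)
  have h1 : ∀ S : Finset (Fin k), ∑ T ∈ S.powerset,
      ρ ^ (T.card + (S \ T).card) * ((-1 : ℝ) ^ (S \ T).card * avg μ T f x) =
      ∑ T ∈ S.powerset, ρ ^ S.card * ((-1 : ℝ) ^ (S \ T).card * avg μ T f x) := fun S =>
    sum_congr rfl fun T hT => by
      rw [add_comm, card_sdiff_add_card_eq_card (mem_powerset.1 hT)]
  simp only [h1] at key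
  rw [← key]
  refine sum_congr rfl fun T _ => ?_
  have h2 := sum_pow_mul_eq_add_pow (-ρ) 1 (univ \ T)
  have h3 : (univ \ T).card = k - T.card := by
    rw [card_sdiff_of_subset (subset_univ T), card_univ, Fintype.card_fin]
  rw [h3] at h2
  have h4 : (1 - ρ) ^ (k - T.card) = ∑ R ∈ (univ \ T).powerset, (-ρ) ^ R.card := by
    rw [sub_eq_neg_add, ← h2]
    simp
  rw [h4, mul_sum, sum_mul]
  refine sum_congr rfl fun R _ => ?_
  rw [neg_pow, pow_add]
  ring

/-- The case `ρ = 1` of the noise formula, where `0^(k - |S|)` leaves only the full set. -/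
theorem sum_efronStein (f : (∀ i, V i) → ℝ) (x : ∀ i, V i) :
    ∑ S, efronStein μ S f x = avg μ univ f x := by
  have h := noise_eq_sum_efronStein (μ := μ) 1 f x
  simp only [one_pow, one_mul] at h
  rw [← h, noise, sum_eq_single univ]
  · simp
  · intro S _ hS
    have : S.card < k := by simpa using (card_lt_iff_ne_univ S).2 hS
    simp [Nat.sub_eq_zero_iff_le, this]
  · simp

theorem efronStein_dependsOn (S : Finset (Fin k)) (f : (∀ i, V i) → ℝ) :
    DependsOn (efronStein μ S f) (S : Set (Fin k)) := fun x y hxy =>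
  sum_congr rfl fun T hT => by
    rw [dependsOn_mono (mem_powerset.1 hT) (avg_dependsOn (μ := μ) T f) hxy]

/-- The Efron--Stein component on `R` after conditioning on the coordinates in `P`. -/
noncomputable def condEfronStein (μ : (∀ i, V i) → ℝ) (P R : Finset (Fin k))
    (f : (∀ i, V i) → ℝ) (x : ∀ i, V i) : ℝ :=
  ∑ U ∈ R.powerset, (-1 : ℝ) ^ (R \ U).card * avg μ (P ∪ U) f x

theorem efronStein_eq_condEfronStein (S : Finset (Fin k)) (f : (∀ i, V i) → ℝ) :
    efronStein μ S f = condEfronStein μ ∅ S f := by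
  funext x
  simp [efronStein, condEfronStein]

theorem condEfronStein_dependsOn (P R : Finset (Fin k)) (f : (∀ i, V i) → ℝ) :
    DependsOn (condEfronStein μ P R f) (P ∪ R : Finset (Fin k)) := fun x y hxy =>
  sum_congr rfl fun T hT => by
    rw [dependsOn_mono (union_subset_union_right (mem_powerset.1 hT))
      (avg_dependsOn (μ := μ) (P ∪ T) f) hxy]

theorem abs_sum_powerset_neg_one_pow_mul_le {S : Finset (Fin k)} {F : Finset (Fin k) → ℝ} {b : ℝ}
    (hb : 0 ≤ b) (hF : ∀ U ⊆ S, |F U| ≤ b) (e : Finset (Fin k) → ℕ) :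
    |∑ U ∈ S.powerset, (-1 : ℝ) ^ e U * F U| ≤ 2 ^ k * b := by
  refine (abs_sum_le_sum_abs _ _).trans ((sum_le_sum (g := fun _ => b) fun U hU => ?_).trans ?_)
  · rw [abs_mul, abs_pow, abs_neg, abs_one, one_pow, one_mul]
    exact hF U (mem_powerset.1 hU)
  · rw [sum_const, nsmul_eq_mul]
    exact mul_le_mul_of_nonneg_right (powerset_card_le S) hb

theorem norm₂_sum_powerset_neg_one_pow_mul_le (hμ : ∀ x, 0 ≤ μ x) {S : Finset (Fin k)}
    {F : Finset (Fin k) → (∀ i, V i) → ℝ} {b : ℝ} (hb : 0 ≤ b) (hF : ∀ U ⊆ S, norm₂ μ (F U) ≤ b)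
    (e : Finset (Fin k) → ℕ) :
    norm₂ μ (fun x => ∑ U ∈ S.powerset, (-1 : ℝ) ^ e U * F U x) ≤ 2 ^ k * b := by
  refine (norm₂_sum_le hμ _ _).trans ((sum_le_sum (g := fun _ => b) fun U hU => ?_).trans ?_)
  · rw [norm₂_const_mul, abs_pow, abs_neg, abs_one, one_pow, one_mul]
    exact hF U (mem_powerset.1 hU)
  · rw [sum_const, nsmul_eq_mul]
    exact mul_le_mul_of_nonneg_right (powerset_card_le S) hb

theorem norm₂_condEfronStein_le (hμ : ∀ x, 0 ≤ μ x) (P R : Finset (Fin k))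
    (f : (∀ i, V i) → ℝ) : norm₂ μ (condEfronStein μ P R f) ≤ 2 ^ k * norm₂ μ f :=
  norm₂_sum_powerset_neg_one_pow_mul_le hμ (norm₂_nonneg f) (fun _ _ => norm₂_avg_le hμ _ f) _

theorem norm₂_efronStein_le (hμ : ∀ x, 0 ≤ μ x) (S : Finset (Fin k)) (f : (∀ i, V i) → ℝ) :
    norm₂ μ (efronStein μ S f) ≤ 2 ^ k * norm₂ μ f := by
  rw [efronStein_eq_condEfronStein]
  exact norm₂_condEfronStein_le hμ ∅ S f

theorem abs_condEfronStein_le {P R : Finset (Fin k)} {f : (∀ i, V i) → ℝ} {D : ℝ} {i : ℕ}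
    (hD : 0 ≤ D) (hf : ∀ U : Finset (Fin k), U.card ≤ i → ∀ x, |avg μ U f x| ≤ D)
    (hi : P.card + R.card ≤ i) (x : ∀ i, V i) : |condEfronStein μ P R f x| ≤ 2 ^ k * D :=
  abs_sum_powerset_neg_one_pow_mul_le hD (fun U hU => hf _ ((card_union_le P U).trans
    ((Nat.add_le_add_left (card_le_card hU) _).trans hi)) x) _

/-- The component on `S` is nearly orthogonal to functions of fewer coordinates. -/
theorem norm₂_avg_efronStein_le (hμ : ∀ x, 0 ≤ μ x) (hε : 0 ≤ ε) (h : IsEpsProduct ε μ)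
    {S T : Finset (Fin k)} (hST : ¬S ⊆ T) (f : (∀ i, V i) → ℝ) :
    norm₂ μ (avg μ T (efronStein μ S f)) ≤ 2 ^ k * ((k : ℝ) ^ 2 * ε * norm₂ μ f) := by
  -- Replacing each `A_T A_U` by `A_{T ∩ U}` would give zero: a point of `S \ T` pairs off subsets
  -- `U` with opposite signs and equal trace on `T`. Only the replacement errors remain.
  have h1 : avg μ T (efronStein μ S f) = fun x => ∑ U ∈ S.powerset,
      (-1 : ℝ) ^ (S \ U).card * (avg μ T (avg μ U f) x - avg μ (T ∩ U) f x) := by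
    funext x
    simp only [mul_sub, sum_sub_distrib]
    rw [sum_powerset_neg_one_pow_mul_inter hST (fun A => avg μ A f x), sub_zero]
    unfold efronStein
    rw [avg_sum]
    exact sum_congr rfl fun U _ => avg_const_mul _ _ _ x
  rw [h1]
  exact norm₂_sum_powerset_neg_one_pow_mul_le hμ
    (mul_nonneg (by positivity) (norm₂_nonneg f))
    (fun U _ => norm₂_avg_avg_sub_le hμ hε h T U f) _

/-- Two distinct sets cannot contain each other, so one component can be averaged onto a set that
does not contain its own index set, which makes it small. -/
theorem abs_expect_efronStein_mul_le (hμ : ∀ x, 0 ≤ μ x) (hε : 0 ≤ ε) (h : IsEpsProduct ε μ)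
    {S T : Finset (Fin k)} (hST : S ≠ T) (f : (∀ i, V i) → ℝ) :
    |expect μ (fun x => efronStein μ S f x * efronStein μ T f x)| ≤
      4 ^ k * ((k : ℝ) ^ 2 * ε * normSq μ f) := by
  wlog hs : ¬S ⊆ T generalizing S T
  · have hT : ¬T ⊆ S := fun hT => hST ((not_not.1 hs).antisymm hT)
    have := this hST.symm hT
    simpa only [mul_comm] using this
  simp only [mul_comm (efronStein μ S f _)]
  rw [← expect_mul_avg hμ (efronStein_dependsOn T f)]
  refine (abs_expect_mul_le hμ _ _).trans ((mul_le_mul (norm₂_efronStein_le hμ T f)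
    (norm₂_avg_efronStein_le hμ hε h hs f) (norm₂_nonneg _)
    (mul_nonneg (by positivity) (norm₂_nonneg f))).trans (le_of_eq ?_))
  rw [← norm₂_sq hμ, show (4 : ℝ) = 2 * 2 by norm_num, mul_pow]
  ring

/-- Inclusion–exclusion is done over `R` first and `T` last. Each inner sum is then an Efron–Stein
component in a link at a part `P` of `T`, to which globalness and induction apply. -/
theorem efronStein_union {T R : Finset (Fin k)} (hTR : Disjoint T R) (f : (∀ i, V i) → ℝ)
    (x : ∀ i, V i) : efronStein μ (T ∪ R) f x =
      ∑ P ∈ T.powerset, (-1 : ℝ) ^ (T \ P).card * condEfronStein μ P R f x := by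
  unfold efronStein condEfronStein
  rw [sum_powerset_union_of_disjoint hTR]
  refine sum_congr rfl fun P hP => ?_
  rw [mul_sum]
  refine sum_congr rfl fun U hU => ?_
  rw [mem_powerset] at hP hU
  have h1 : (T ∪ R) \ (P ∪ U) = T \ P ∪ R \ U := by
    rw [disjoint_left] at hTR
    ext w
    have := @hTR w
    have := @hP w
    have := @hU w
    simp only [mem_sdiff, mem_union]
    tauto
  rw [h1, card_union_of_disjoint (disjoint_of_subset_left sdiff_subset
    (disjoint_of_subset_right sdiff_subset hTR)), pow_add, mul_assoc]

theorem condEfronStein_eq_efronStein_link {P R : Finset (Fin k)} {x y : ∀ i, V i}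
    (hx : 0 < marginal μ P (P.restrict x)) (hy : 0 < link μ P (P.restrict x) y)
    (f : (∀ i, V i) → ℝ) :
    condEfronStein μ P R f y = efronStein (link μ P (P.restrict x)) R f y :=
  sum_congr rfl fun U _ => by rw [avg_link U hx (restrict_eq_of_link_pos hy), union_comm]

/-- The weight of `f` on level `i`. -/
noncomputable def levelWeight (μ : (∀ i, V i) → ℝ) (i : ℕ) (f : (∀ i, V i) → ℝ) : ℝ :=
  ∑ S ∈ powersetCard i univ, normSq μ (efronStein μ S f)

theorem levelWeight_nonneg (hμ : ∀ x, 0 ≤ μ x) (i : ℕ) (f : (∀ i, V i) → ℝ) :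
    0 ≤ levelWeight μ i f := sum_nonneg fun _ _ => normSq_nonneg hμ _

/-- In the link at `x_P` the conditional components are the genuine ones of the link; the sum over
sets avoiding `T` is extended to all sets of size `j`. -/
theorem sum_avg_condEfronStein_sq_le (hμ : ∀ x, 0 ≤ μ x) {P T : Finset (Fin k)} (j : ℕ)
    (f : (∀ i, V i) → ℝ) {x : ∀ i, V i} (hx : 0 < μ x) :
    ∑ R ∈ powersetCard j (univ \ T), avg μ P (fun y => condEfronStein μ P R f y ^ 2) x ≤
      levelWeight (link μ P (P.restrict x)) j f := by
  have hl := link_nonneg hμ P (P.restrict x)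
  refine (sum_le_sum fun R _ => le_of_eq ?_).trans (sum_le_sum_of_subset_of_nonneg
    (powersetCard_mono (subset_univ _)) fun R _ _ => normSq_nonneg hl _)
  refine expect_congr hl fun y hy => ?_
  rw [condEfronStein_eq_efronStein_link (hx.trans_le (le_marginal hμ P x)) hy]

theorem link_empty (hμ : μ ∈ stdSimplex ℝ (∀ i, V i)) (a : ∀ i : (∅ : Finset (Fin k)), V i) :
    link μ ∅ a = μ := by
  have h : ∀ y : ∀ i, V i, (∅ : Finset (Fin k)).restrict y = a := fun y => by
    ext ⟨i, hi⟩
    simp at hi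
  funext y
  simp [link, marginal, h, hμ.2]

end EfronStein

/-! ### Moments in terms of conditional level weights -/

section LevelMoment
variable {k : ℕ} {V : Fin k → Type*} [∀ i, Fintype (V i)] {μ : (∀ i, V i) → ℝ} {ε : ℝ}

theorem sum_le_card_mul {ι : Type*} {s : Finset ι} {f : ι → ℝ} {N b : ℝ}
    (hb : 0 ≤ b) (hN : (s.card : ℝ) ≤ N) (hf : ∀ i ∈ s, f i ≤ b) : ∑ i ∈ s, f i ≤ N * b := by
  refine (sum_le_sum hf).trans ?_
  rw [sum_const, nsmul_eq_mul]
  exact mul_le_mul_of_nonneg_right hN hb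

theorem powersetCard_card_le (j : ℕ) (S : Finset (Fin k)) :
    ((powersetCard j S).card : ℝ) ≤ 2 ^ k := by
  refine le_trans ?_ (powerset_card_le S)
  rw [powersetCard_eq_filter]
  exact_mod_cast card_le_card (filter_subset _ _)

/-- A moment of the squared components containing `T`, given the coordinates in `T`, in terms of
conditional level weights. -/
theorem expect_sum_avg_efronStein_sq_pow_le (hμ : ∀ x, 0 ≤ μ x) (hε : 0 ≤ ε)
    (h : IsEpsProduct ε μ) {f : (∀ i, V i) → ℝ} {D Λ : ℝ} {i j n : ℕ} (hD : 0 ≤ D)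
    (hf : ∀ U : Finset (Fin k), U.card ≤ i → ∀ x, |avg μ U f x| ≤ D) {T : Finset (Fin k)}
    (hij : T.card + j = i)
    (hΛ : ∀ P ⊆ T, ∀ x, 0 < μ x →
      ∑ R ∈ powersetCard j (univ \ T), avg μ P (fun y => condEfronStein μ P R f y ^ 2) x ≤ Λ) :
    expect μ (fun x => (∑ R ∈ powersetCard j (univ \ T),
        avg μ T (fun y => efronStein μ (T ∪ R) f y ^ 2) x) ^ (n + 2)) ≤
      ((4 : ℝ) ^ T.card * Λ) ^ (n + 1) *
        ∑ R ∈ powersetCard j (univ \ T), normSq μ (efronStein μ (T ∪ R) f) +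
      ((n + 1 : ℝ) * ((2 : ℝ) ^ k) ^ (5 * n + 8)) * (D ^ (2 * n + 2) *
        ((k : ℝ) ^ 2 * ε * normSq μ f)) := by
  set I := powersetCard j (univ \ T) with hI
  set A : ℝ := 2 ^ k with hA
  set κ := (k : ℝ) ^ 2 * ε with hκ
  have hκ0 : 0 ≤ κ := by positivity
  set N := norm₂ μ f with hN
  have hN0 : 0 ≤ N := norm₂_nonneg f
  have hA0 : 0 < A := by positivity
  have hIcard : (I.card : ℝ) ≤ A := powersetCard_card_le j _
  have hIR : ∀ R ∈ I, R ⊆ univ \ T ∧ R.card = j := fun R hR => mem_powersetCard.1 hR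
  have hdisj : ∀ R ∈ I, Disjoint T R := fun R hR =>
    (disjoint_of_subset_left (hIR R hR).1 sdiff_disjoint).symm
  set B := A * D with hB
  have hB0 : 0 ≤ B := by positivity
  have hφ : ∀ P ⊆ T, ∀ R ∈ I, ∀ x, |condEfronStein μ P R f x| ≤ B := fun P hP R hR x =>
    abs_condEfronStein_le hD hf (by rw [(hIR R hR).2, ← hij]; gcongr) x
  have hes : ∀ R ∈ I, ∀ x, |efronStein μ (T ∪ R) f x| ≤ B := fun R hR x => by
    rw [efronStein_eq_condEfronStein]
    refine abs_condEfronStein_le hD hf ?_ x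
    rw [card_empty, zero_add, card_union_of_disjoint (hdisj R hR), (hIR R hR).2, hij]
  have hsq : ∀ t : ℝ, |t| ≤ B → t ^ 2 ≤ B ^ 2 := fun t ht => sq_le_sq.2 (ht.trans (le_abs_self B))
  have hTc : (2 : ℝ) ^ T.card ≤ A := by
    rw [hA]
    exact pow_le_pow_right₀ one_le_two ((card_le_univ T).trans (Fintype.card_fin k).le)
  set Z := fun x => ∑ R ∈ I, avg μ T (fun y => efronStein μ (T ∪ R) f y ^ 2) x with hZ
  -- `Y` dominates `Z` by Cauchy–Schwarz over the `2^|T|` sets `P`. `Y'` averages over the link at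
  -- `x_P` instead of `x_T`, which makes it a sum of level weights of links.
  set Y := fun x => ∑ P ∈ T.powerset, (2 : ℝ) ^ T.card *
    ∑ R ∈ I, avg μ T (fun y => condEfronStein μ P R f y ^ 2) x with hY
  set Y' := fun x => ∑ P ∈ T.powerset, (2 : ℝ) ^ T.card *
    ∑ R ∈ I, avg μ P (fun y => condEfronStein μ P R f y ^ 2) x with hY'
  have hZ0 : ∀ x, 0 ≤ Z x := fun x => sum_nonneg fun R _ => avg_nonneg hμ T (fun _ _ => sq_nonneg _) x
  have hY0 : ∀ x, 0 ≤ Y x := fun x => sum_nonneg fun P _ => mul_nonneg (by positivity)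
    (sum_nonneg fun R _ => avg_nonneg hμ T (fun _ _ => sq_nonneg _) x)
  have hY'0 : ∀ x, 0 ≤ Y' x := fun x => sum_nonneg fun P _ => mul_nonneg (by positivity)
    (sum_nonneg fun R _ => avg_nonneg hμ P (fun _ _ => sq_nonneg _) x)
  have hZY : ∀ x, Z x ≤ Y x := by
    intro x
    simp only [hZ, hY, mul_sum]
    rw [sum_comm]
    refine sum_le_sum fun R hR => ?_
    rw [show ∑ P ∈ T.powerset, (2 : ℝ) ^ T.card * avg μ T (fun y => condEfronStein μ P R f y ^ 2) x
      = avg μ T (fun y => ∑ P ∈ T.powerset, 2 ^ T.card * condEfronStein μ P R f y ^ 2) x by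
        rw [avg_sum]; exact sum_congr rfl fun P _ => (avg_const_mul T _ _ x).symm]
    refine avg_mono hμ T (fun y _ => ?_) x
    rw [efronStein_union (hdisj R hR)]
    refine sq_sum_le_card_mul_sum_sq.trans (le_of_eq ?_)
    rw [card_powerset, ← mul_sum]
    push_cast
    congr 1
    refine sum_congr rfl fun P _ => ?_
    rw [mul_pow, ← pow_mul, mul_comm _ 2, pow_mul]
    norm_num
  have bound : ∀ (S : Finset (Fin k) → Finset (Fin k)) (x), 0 < μ x →
      ∑ P ∈ T.powerset, (2 : ℝ) ^ T.card *
        ∑ R ∈ I, avg μ (S P) (fun y => condEfronStein μ P R f y ^ 2) x ≤ A ^ 3 * B ^ 2 := by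
    intro S x hx
    refine (sum_le_card_mul (b := A * (A * B ^ 2)) (by positivity) (powerset_card_le T)
      fun P hP => ?_).trans (le_of_eq (by rw [← hA]; ring))
    refine mul_le_mul hTc (sum_le_card_mul (by positivity) hIcard fun R hR => ?_)
      (sum_nonneg fun R _ => avg_nonneg hμ _ (fun _ _ => sq_nonneg _) x) hA0.le
    rw [← avg_const hμ (S P) (B ^ 2) hx]
    exact avg_mono hμ _ (fun y _ => hsq _ (hφ P (mem_powerset.1 hP) R hR y)) x
  have hL0 : 0 ≤ A ^ 3 * B ^ 2 := by positivity
  have hYL : ∀ x, 0 < μ x → 0 ≤ Y x ∧ Y x ≤ A ^ 3 * B ^ 2 := fun x hx =>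
    ⟨hY0 x, bound (fun _ => T) x hx⟩
  have hY'L : ∀ x, 0 < μ x → 0 ≤ Y' x ∧ Y' x ≤ A ^ 3 * B ^ 2 := fun x hx =>
    ⟨hY'0 x, bound id x hx⟩
  -- One factor `2^|T|` comes from Cauchy–Schwarz and another from the number of sets `P`.
  have hY'Λ : ∀ x, 0 < μ x → Y' x ≤ (4 : ℝ) ^ T.card * Λ := by
    intro x hx
    refine (sum_le_sum fun P hP => mul_le_mul_of_nonneg_left
      (hΛ P (mem_powerset.1 hP) x hx) (by positivity)).trans (le_of_eq ?_)
    rw [sum_const, card_powerset, nsmul_eq_mul, show (4 : ℝ) = 2 * 2 by norm_num, mul_pow]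
    push_cast
    ring
  have hZn : norm₂ μ Z ≤ A * (B * (A * N)) := by
    refine (norm₂_sum_le hμ _ _).trans (sum_le_card_mul (by positivity) hIcard fun R hR => ?_)
    refine (norm₂_avg_le hμ _ _).trans ?_
    simpa only [sq] using norm₂_mul_le hμ hB0 (hes R hR) (norm₂_efronStein_le hμ (T ∪ R) f)
  -- The squared conditional component depends on `P ∪ R`, and `T ∩ (P ∪ R) = P`, so `A_T` acts on
  -- it almost as `A_P`.
  have hYn : norm₂ μ (fun x => Y x - Y' x) ≤ A ^ 3 * (κ * (B * (A * N))) := by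
    have e : (fun x => Y x - Y' x) = fun x => ∑ P ∈ T.powerset, (2 : ℝ) ^ T.card *
        ∑ R ∈ I, (avg μ T (fun y => condEfronStein μ P R f y ^ 2) x -
          avg μ P (fun y => condEfronStein μ P R f y ^ 2) x) := by
      funext x
      simp only [hY, hY', sum_sub_distrib, mul_sub]
    rw [e]
    refine (norm₂_sum_le hμ _ _).trans ((sum_le_card_mul (b := A * (A * (κ * (B * (A * N)))))
      (by positivity) (powerset_card_le T) fun P hP => ?_).trans (le_of_eq (by rw [← hA]; ring)))
    rw [mem_powerset] at hP
    rw [norm₂_const_mul, abs_of_nonneg (by positivity)]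
    refine mul_le_mul hTc ?_ (norm₂_nonneg _) hA0.le
    refine (norm₂_sum_le hμ _ _).trans (sum_le_card_mul (by positivity) hIcard fun R hR => ?_)
    have hdep : DependsOn (fun y => condEfronStein μ P R f y ^ 2) (P ∪ R : Finset (Fin k)) :=
      fun x y hxy => by simp only [condEfronStein_dependsOn P R f hxy]
    have hTP : T ∩ (P ∪ R) = P := by
      rw [inter_union_distrib_left, inter_eq_right.2 hP, (disjoint_iff_inter_eq_empty.1 (hdisj R hR)),
        union_empty]
    have h1 := norm₂_avg_avg_sub_le hμ hε h T (P ∪ R) (fun y => condEfronStein μ P R f y ^ 2)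
    rw [hTP] at h1
    rw [norm₂_congr hμ (g := fun x =>
      avg μ T (avg μ (P ∪ R) fun y => condEfronStein μ P R f y ^ 2) x -
        avg μ P (fun y => condEfronStein μ P R f y ^ 2) x)]
    · refine h1.trans (mul_le_mul_of_nonneg_left ?_ hκ0)
      simpa only [sq] using norm₂_mul_le hμ hB0 (hφ P hP R hR) (norm₂_condEfronStein_le hμ P R f)
    · intro x _
      rw [avg_congr hμ T (fun y hy => avg_of_dependsOn hμ hdep hy) x]
  have hmain : expect μ (fun x => Y' x ^ (n + 1) * Z x) ≤ ((4 : ℝ) ^ T.card * Λ) ^ (n + 1) *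
      ∑ R ∈ I, normSq μ (efronStein μ (T ∪ R) f) := by
    have e : ∑ R ∈ I, normSq μ (efronStein μ (T ∪ R) f) = expect μ Z := by
      rw [hZ, expect_sum]
      exact sum_congr rfl fun R _ => (expect_avg hμ T _).symm
    rw [e, ← expect_const_mul]
    exact expect_mono hμ fun x hx => mul_le_mul_of_nonneg_right
      (pow_le_pow_left₀ (hY'0 x) (hY'Λ x hx) _) (hZ0 x)
  have herr := expect_pow_sub_pow_mul_le hμ hYL hY'L n Z hL0
  have hprod : norm₂ μ (fun x => Y x - Y' x) * norm₂ μ Z ≤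
      A ^ 3 * (κ * (B * (A * N))) * (A * (B * (A * N))) :=
    mul_le_mul hYn hZn (norm₂_nonneg _) (by positivity)
  -- Only `n + 1` of the `n + 2` factors `Z` are replaced; the last one is kept, since its mean is
  -- the level weight that must appear on the right.
  calc expect μ (fun x => Z x ^ (n + 2))
      ≤ expect μ (fun x => Y' x ^ (n + 1) * Z x + (Y x ^ (n + 1) - Y' x ^ (n + 1)) * Z x) := by
        refine expect_mono hμ fun x _ => ?_
        have := mul_le_mul_of_nonneg_right (pow_le_pow_left₀ (hZ0 x) (hZY x) (n + 1)) (hZ0 x)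
        rw [← pow_succ] at this
        refine this.trans (le_of_eq (by ring))
    _ ≤ _ := by
        rw [expect_add]
        refine add_le_add hmain (herr.trans ((mul_le_mul_of_nonneg_left hprod
          (by positivity)).trans (le_of_eq ?_)))
        rw [← norm₂_sq hμ f, ← hN, hB]
        ring

end LevelMoment

/-! ### The level inequality for global Boolean functions -/

section LevelInequality

theorem sum_powerset_ite_card_union {α : Type*} [Fintype α] [DecidableEq α] {T : Finset α} {i : ℕ}
    (hT : T.card ≤ i) (F : Finset α → ℝ) :
    ∑ R ∈ (univ \ T).powerset, (if (T ∪ R).card = i then F R else 0) =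
      ∑ R ∈ powersetCard (i - T.card) (univ \ T), F R := by
  rw [powersetCard_eq_filter, sum_filter]
  refine sum_congr rfl fun R hR => ?_
  rw [mem_powerset] at hR
  rw [card_union_of_disjoint (disjoint_of_subset_left hR sdiff_disjoint).symm]
  congr 1
  apply propext
  omega

/-- The growth rate, per level, of the moments of order `2 (n + 2)`. -/
noncomputable def levelRate (n : ℕ) : ℝ :=
  (24 * (n + 2 : ℝ)) ^ (n + 2) + (n + 3 : ℝ) ^ (2 * (n + 2)) * 4 ^ (n + 1)

theorem one_le_levelRate (n : ℕ) : 1 ≤ levelRate n := by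
  have hn : (0 : ℝ) ≤ n := n.cast_nonneg
  have h1 : 1 ≤ (24 * (n + 2 : ℝ)) ^ (n + 2) := one_le_pow₀ (by linarith)
  have h2 : 0 ≤ (n + 3 : ℝ) ^ (2 * (n + 2)) * 4 ^ (n + 1) := by positivity
  unfold levelRate
  linarith

variable {k : ℕ} {V : Fin k → Type*} [∀ i, Fintype (V i)] {μ : (∀ i, V i) → ℝ} {ε : ℝ}

/-- Only sets `R` of size `i - |T|` contribute, so the weights `C^|R|` are constant and leave the
power. The main term is written per pair `(T, R)` so that it can be regrouped by `S = T ∪ R`. -/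
theorem pow_card_mul_expect_avgSum_pow_le (hμ : ∀ x, 0 ≤ μ x) (hε : 0 ≤ ε)
    (h : IsEpsProduct ε μ) {f : (∀ i, V i) → ℝ} {D Λ γ C : ℝ} {i n : ℕ} (hi : i ≤ k)
    (hD : 0 ≤ D)
    (hγ : 1 ≤ γ) (hC : 1 ≤ C)
    (hf : ∀ U : Finset (Fin k), U.card ≤ i → ∀ x, |avg μ U f x| ≤ D)
    (hΛ : ∀ T : Finset (Fin k), T.card ≤ i → ∀ P ⊆ T, ∀ x, 0 < μ x →
      ∑ R ∈ powersetCard (i - T.card) (univ \ T),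
        avg μ P (fun y => condEfronStein μ P R f y ^ 2) x ≤ Λ) (T : Finset (Fin k)) :
    γ ^ T.card * expect μ (fun x => avgSum μ (univ \ T).powerset (fun R => C ^ R.card) T
        (fun R y => (if (T ∪ R).card = i then efronStein μ (T ∪ R) f y else 0) ^ 2) x ^ (n + 2)) ≤
      ∑ R ∈ (univ \ T).powerset, (γ * 4 ^ (n + 1)) ^ T.card * (C ^ (n + 2)) ^ R.card *
        (Λ ^ (n + 1) * if (T ∪ R).card = i then normSq μ (efronStein μ (T ∪ R) f) else 0) +
      γ ^ k * (C ^ (n + 2)) ^ k * (((n + 1 : ℝ) * ((2 : ℝ) ^ k) ^ (5 * n + 8)) *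
        (D ^ (2 * n + 2) * ((k : ℝ) ^ 2 * ε * normSq μ f))) := by
  set E := ((n + 1 : ℝ) * ((2 : ℝ) ^ k) ^ (5 * n + 8)) *
        (D ^ (2 * n + 2) * ((k : ℝ) ^ 2 * ε * normSq μ f)) with hE
  have hN := normSq_nonneg hμ f
  have hE0 : 0 ≤ E := by positivity
  have hTk : ∀ S : Finset (Fin k), S.card ≤ k := fun S =>
    (card_le_univ S).trans (Fintype.card_fin k).le
  by_cases hT : T.card ≤ i
  · have h1 : ∀ x, avgSum μ (univ \ T).powerset (fun R => C ^ R.card) T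
        (fun R y => (if (T ∪ R).card = i then efronStein μ (T ∪ R) f y else 0) ^ 2) x =
        C ^ (i - T.card) * ∑ R ∈ powersetCard (i - T.card) (univ \ T),
          avg μ T (fun y => efronStein μ (T ∪ R) f y ^ 2) x := by
      intro x
      have e : ∀ R : Finset (Fin k), C ^ R.card * avg μ T (fun y =>
          (if (T ∪ R).card = i then efronStein μ (T ∪ R) f y else 0) ^ 2) x =
          if (T ∪ R).card = i then
            C ^ R.card * avg μ T (fun y => efronStein μ (T ∪ R) f y ^ 2) x else 0 := by
        intro R
        split_ifs
        · rfl
        · simp [avg, expect]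
      unfold avgSum
      simp only [e]
      rw [sum_powerset_ite_card_union hT, mul_sum]
      exact sum_congr rfl fun R hR => by rw [(mem_powersetCard.1 hR).2]
    have h2 : ∑ R ∈ (univ \ T).powerset, (γ * 4 ^ (n + 1)) ^ T.card * (C ^ (n + 2)) ^ R.card *
        (Λ ^ (n + 1) * if (T ∪ R).card = i then normSq μ (efronStein μ (T ∪ R) f) else 0) =
        γ ^ T.card * (C ^ (i - T.card)) ^ (n + 2) * (((4 : ℝ) ^ T.card * Λ) ^ (n + 1) *
          ∑ R ∈ powersetCard (i - T.card) (univ \ T), normSq μ (efronStein μ (T ∪ R) f)) := by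
      simp only [mul_ite, mul_zero]
      rw [sum_powerset_ite_card_union hT, mul_sum, mul_sum]
      refine sum_congr rfl fun R hR => ?_
      rw [(mem_powersetCard.1 hR).2, mul_pow, mul_pow, ← pow_mul C, ← pow_mul C,
        ← pow_mul (4 : ℝ), ← pow_mul (4 : ℝ), mul_comm (n + 2), mul_comm (n + 1) T.card]
      ring
    have h3 := expect_sum_avg_efronStein_sq_pow_le hμ hε h (n := n) hD hf
      (Nat.add_sub_cancel' hT) (hΛ T hT)
    simp only [h1, mul_pow (C ^ (i - T.card))]
    rw [expect_const_mul, h2, ← mul_assoc]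
    have h4 : γ ^ T.card * (C ^ (i - T.card)) ^ (n + 2) * E ≤ γ ^ k * (C ^ (n + 2)) ^ k * E := by
      refine mul_le_mul_of_nonneg_right ?_ hE0
      rw [← pow_mul, ← pow_mul, mul_comm (n + 2)]
      have : (i - T.card) * (n + 2) ≤ k * (n + 2) := Nat.mul_le_mul_right _ (by omega)
      have a1 := pow_le_pow_right₀ hγ (hTk T)
      have a2 := pow_le_pow_right₀ hC this
      gcongr
    refine (mul_le_mul_of_nonneg_left h3 (by positivity)).trans ?_
    rw [mul_add]
    exact add_le_add le_rfl h4
  · have h1 : ∀ R : Finset (Fin k), (T ∪ R).card ≠ i := fun R hR =>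
      hT (hR ▸ card_le_card subset_union_left)
    simp only [h1, if_false, mul_zero, sum_const_zero, zero_add]
    have h2 : ∀ x, avgSum μ (univ \ T).powerset (fun R => C ^ R.card) T
        (fun _ _ => (0 : ℝ) ^ 2) x = 0 := by
      intro x; simp [avgSum, avg, expect]
    simp only [h2]
    have h3 : expect μ (fun _ => (0 : ℝ) ^ (n + 2)) = 0 := by simp [expect]
    rw [h3, mul_zero]
    positivity

/-- Moments of the level-`i` part in terms of conditional level weights. -/
theorem exists_expect_level_pow_le (k n : ℕ) : ∃ K : ℝ, 0 ≤ K ∧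
    ∀ (V : Fin k → Type*) [∀ i, Fintype (V i)] (μ : (∀ i, V i) → ℝ) (ε : ℝ),
      (∀ x, 0 ≤ μ x) → 0 ≤ ε → IsEpsProduct ε μ →
      ∀ (f : (∀ i, V i) → ℝ) (D Λ : ℝ) (i : ℕ), i ≤ k → 0 ≤ D →
        (∀ U : Finset (Fin k), U.card ≤ i → ∀ x, |avg μ U f x| ≤ D) →
        (∀ T : Finset (Fin k), T.card ≤ i → ∀ P ⊆ T, ∀ x, 0 < μ x →
          ∑ R ∈ powersetCard (i - T.card) (univ \ T),
            avg μ P (fun y => condEfronStein μ P R f y ^ 2) x ≤ Λ) →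
        expect μ (fun x => (∑ S ∈ powersetCard i univ, efronStein μ S f x) ^ (2 * (n + 2))) ≤
          levelRate n ^ i * Λ ^ (n + 1) * levelWeight μ i f +
          K * (ε * D ^ (2 * n + 2) * normSq μ f) := by
  obtain ⟨K₀, hK₀, hyp⟩ := exists_expect_sum_pow_le k n
  set γ := (n + 3 : ℝ) ^ (2 * (n + 2)) with hγ
  set C := 24 * (n + 2 : ℝ) with hC
  have hn : (0 : ℝ) ≤ n := n.cast_nonneg
  have hγ1 : 1 ≤ γ := one_le_pow₀ (by linarith)
  have hC1 : 1 ≤ C := by rw [hC]; linarith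
  refine ⟨2 ^ k * (γ ^ k * (C ^ (n + 2)) ^ k * (((n + 1 : ℝ) * ((2 : ℝ) ^ k) ^ (5 * n + 8)) *
    (k : ℝ) ^ 2)) + K₀ * (((2 : ℝ) ^ k) ^ (2 * n + 4) * (2 * (k : ℝ) ^ 2)), by positivity, ?_⟩
  intro V _ μ ε hμ hε h f D Λ i hi hD hf hΛ
  set g : Finset (Fin k) → (∀ i, V i) → ℝ :=
    fun S x => if S.card = i then efronStein μ S f x else 0 with hg
  set N := norm₂ μ f with hN
  have hN0 : 0 ≤ N := norm₂_nonneg f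
  have h2k : (0 : ℝ) ≤ 2 ^ k := by positivity
  have hκ : 0 ≤ (k : ℝ) ^ 2 * ε := by positivity
  -- Here `η = k² ε`: averaging out a coordinate of `S` leaves norm at most `k² ε` times the bound
  -- `2^k N` on the component.
  have key := hyp V μ ε hμ hε h g (2 ^ k * D) (2 ^ k * N) ((k : ℝ) ^ 2 * ε)
    (by positivity) (by positivity) hκ
    (fun S x y hxy => by simp only [hg, efronStein_dependsOn S f hxy])
    (fun S x => by
      simp only [hg]
      split_ifs with hS
      · rw [efronStein_eq_condEfronStein]
        exact abs_condEfronStein_le hD hf (by simp [hS]) x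
      · rw [abs_zero]; positivity)
    (fun S => by
      by_cases hS : S.card = i
      · simpa only [hg, hS, if_true] using norm₂_efronStein_le hμ S f
      · simp only [hg, hS, if_false]
        rw [norm₂_zero]; positivity)
    (fun S v hv => by
      by_cases hS : S.card = i
      · simp only [hg, hS, if_true]
        refine (norm₂_avg_efronStein_le hμ hε h (fun hs => notMem_erase v univ (hs hv)) f).trans
          (le_of_eq (by ring))
      · simp only [hg, hS, if_false]
        refine (norm₂_avg_le hμ _ _).trans ?_
        rw [norm₂_zero]; positivity)
  have hsum : ∀ x, ∑ S, g S x = ∑ S ∈ powersetCard i univ, efronStein μ S f x := by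
    intro x
    rw [powersetCard_eq_filter, powerset_univ, sum_filter]
  simp only [hsum] at key
  refine key.trans ?_
  have hterms := sum_le_sum fun T (_ : T ∈ (univ : Finset (Finset (Fin k)))) =>
    pow_card_mul_expect_avgSum_pow_le hμ hε h (n := n) hi hD hγ1 hC1 hf hΛ T
  rw [sum_add_distrib, sum_const, card_univ, Fintype.card_finset, Fintype.card_fin,
    nsmul_eq_mul] at hterms
  have hmain : ∑ T, ∑ R ∈ (univ \ T).powerset,
      (γ * 4 ^ (n + 1)) ^ T.card * (C ^ (n + 2)) ^ R.card *
        (Λ ^ (n + 1) * if (T ∪ R).card = i then normSq μ (efronStein μ (T ∪ R) f) else 0) =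
      levelRate n ^ i * Λ ^ (n + 1) * levelWeight μ i f := by
    rw [sum_sum_powerset_sdiff, levelWeight, powersetCard_eq_filter, powerset_univ, sum_filter,
      mul_sum]
    refine sum_congr rfl fun S _ => ?_
    have e : ∀ T ∈ S.powerset, (γ * 4 ^ (n + 1)) ^ T.card * (C ^ (n + 2)) ^ (S \ T).card *
        (Λ ^ (n + 1) *
          if (T ∪ S \ T).card = i then normSq μ (efronStein μ (T ∪ S \ T) f) else 0) =
        (γ * 4 ^ (n + 1)) ^ T.card * (C ^ (n + 2)) ^ (S.card - T.card) *
        (Λ ^ (n + 1) * if S.card = i then normSq μ (efronStein μ S f) else 0) := by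
      intro T hT
      rw [mem_powerset] at hT
      rw [union_sdiff_of_subset hT, card_sdiff_of_subset hT]
    -- For each `S` of size `i`, the binomial theorem over `T ⊆ S` collapses the weights to
    -- `(C^(n+2) + γ 4^(n+1))^i`.
    rw [sum_congr rfl e, ← sum_mul, sum_pow_mul_eq_add_pow, add_comm]
    split_ifs with hS
    · rw [hS, levelRate, ← hγ, ← hC]
      ring
    · simp
  rw [hmain] at hterms
  refine (add_le_add hterms le_rfl).trans (le_of_eq ?_)
  rw [← norm₂_sq hμ f, ← hN]
  push_cast
  ring

theorem abs_avg_le_of_isGlobal {k : ℕ} {V : Fin k → Type*} [∀ i, Fintype (V i)]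
    {μ : (∀ i, V i) → ℝ} (hμ : ∀ x, 0 ≤ μ x) {f : (∀ i, V i) → ℝ}
    (hf : ∀ x, 0 < μ x → f x = 0 ∨ f x = 1) {d : ℕ} {δ : ℝ} (hg : IsGlobal μ d δ f)
    {U : Finset (Fin k)} (hU : U.card ≤ d) (x : ∀ i, V i) : |avg μ U f x| ≤ δ ^ 2 := by
  have h0 : 0 ≤ avg μ U f x := avg_nonneg hμ U (fun y hy => by
    rcases hf y hy with h | h <;> simp [h]) x
  rw [abs_of_nonneg h0]
  -- Off the support of the marginal the link weights are `0` by division by zero, so the bound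
  -- holds at every point.
  rcases (marginal_nonneg hμ U (U.restrict x)).eq_or_lt with hm | hm
  · have : avg μ U f x = 0 := by
      unfold avg expect link
      simp [← hm]
    rw [this]
    positivity
  · rw [avg_congr hμ U (g := fun y => f y ^ 2) (fun y hy => by
      rcases hf y hy with h | h <;> simp [h]) x]
    exact normSq_le_of_norm₂_le (link_nonneg hμ U _) (hg U hU _ hm)

/-- A substitute for Hölder: on `f = 1` either `g ≤ τ`, or `g > τ` and multiplying by `(g/τ)^(2n+3)`
only increases `g`. -/
theorem mul_le_add_pow_div {f g τ : ℝ} (hτ : 0 < τ) (hf : f = 0 ∨ f = 1) (n : ℕ) :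
    f * g ≤ τ * f + (τ ^ (2 * n + 3))⁻¹ * g ^ (2 * (n + 2)) := by
  have he : 0 ≤ g ^ (2 * (n + 2)) := by rw [pow_mul]; positivity
  have hp : 0 < τ ^ (2 * n + 3) := by positivity
  rcases hf with rfl | rfl
  · simp only [zero_mul, mul_zero, zero_add]
    positivity
  · rw [one_mul, mul_one]
    have h2 : 0 ≤ (τ ^ (2 * n + 3))⁻¹ * g ^ (2 * (n + 2)) := by positivity
    rcases le_or_gt g τ with h | h
    · linarith
    · have h1 : g ≤ (τ ^ (2 * n + 3))⁻¹ * g ^ (2 * (n + 2)) := by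
        rw [inv_mul_eq_div, le_div_iff₀ hp, show 2 * (n + 2) = (2 * n + 3) + 1 by ring,
          pow_succ g, mul_comm]
        exact mul_le_mul_of_nonneg_right (pow_le_pow_left₀ hτ.le h.le _) (hτ.trans h).le
      linarith

theorem normSq_eq_expect (hμ : ∀ x, 0 ≤ μ x) {f : (∀ i, V i) → ℝ}
    (hf : ∀ x, 0 < μ x → f x = 0 ∨ f x = 1) : normSq μ f = expect μ f :=
  expect_congr hμ fun x hx => by rcases hf x hx with h | h <;> simp [h]

/-- On the support `f` is the sum of its components, and pairing the component on `S` with the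
others costs only near-orthogonality errors. -/
theorem normSq_efronStein_le_expect_mul (hμ : ∀ x, 0 ≤ μ x) (hε : 0 ≤ ε)
    (h : IsEpsProduct ε μ) (S : Finset (Fin k)) (f : (∀ i, V i) → ℝ) :
    normSq μ (efronStein μ S f) ≤ expect μ (fun x => f x * efronStein μ S f x) +
      2 ^ k * (4 ^ k * ((k : ℝ) ^ 2 * ε * normSq μ f)) := by
  have hN := normSq_nonneg hμ f
  have h1 : expect μ (fun x => f x * efronStein μ S f x) =
      ∑ T, expect μ (fun x => efronStein μ T f x * efronStein μ S f x) := by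
    rw [← expect_sum]
    refine expect_congr hμ fun x hx => ?_
    rw [← sum_mul, sum_efronStein, avg_univ hμ f hx]
  have h2 : -(2 ^ k * (4 ^ k * ((k : ℝ) ^ 2 * ε * normSq μ f))) ≤
      ∑ T ∈ univ.erase S, expect μ (fun x => efronStein μ T f x * efronStein μ S f x) := by
    rw [neg_le, ← sum_neg_distrib]
    refine sum_le_card_mul (by positivity) ?_ fun T hT => ?_
    · have := card_le_univ (univ.erase S)
      rw [Fintype.card_finset, Fintype.card_fin] at this
      exact_mod_cast this
    · exact (neg_le_abs _).trans (abs_expect_efronStein_mul_le hμ hε h (ne_of_mem_erase hT) f)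
  rw [h1, ← add_sum_erase _ _ (mem_univ S)]
  have h3 : normSq μ (efronStein μ S f) =
      expect μ (fun x => efronStein μ S f x * efronStein μ S f x) := by
    unfold normSq
    simp only [sq]
  rw [h3]
  linarith

theorem levelWeight_le_expect_mul (hμ : ∀ x, 0 ≤ μ x) (hε : 0 ≤ ε)
    (h : IsEpsProduct ε μ) (i : ℕ) (f : (∀ i, V i) → ℝ) :
    levelWeight μ i f ≤
      expect μ (fun x => f x * ∑ S ∈ powersetCard i univ, efronStein μ S f x) +
      16 ^ k * (k : ℝ) ^ 2 * (ε * normSq μ f) := by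
  have hN := normSq_nonneg hμ f
  refine (sum_le_sum fun S _ => normSq_efronStein_le_expect_mul hμ hε h S f).trans ?_
  simp only [mul_sum]
  rw [expect_sum, sum_add_distrib]
  refine add_le_add le_rfl ?_
  refine (sum_le_card_mul (by positivity) (powersetCard_card_le i univ)
    fun _ _ => le_rfl).trans (le_of_eq ?_)
  rw [show (16 : ℝ) = 2 * 2 * 4 by norm_num, mul_pow, mul_pow]
  ring

theorem levelWeight_eq_zero (hμ : ∀ x, 0 ≤ μ x) (i : ℕ) {f : (∀ i, V i) → ℝ}
    (hf : normSq μ f = 0) : levelWeight μ i f = 0 := by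
  refine sum_eq_zero fun S _ => ?_
  have h1 := norm₂_efronStein_le hμ S f
  have h2 : norm₂ μ f = 0 := by unfold norm₂; rw [hf, Real.sqrt_zero]
  rw [h2, mul_zero] at h1
  rw [← norm₂_sq hμ, le_antisymm h1 (norm₂_nonneg _)]
  norm_num

/-- The real-number deduction concluding the level inequality. -/
theorem pow_le_of_self_bound {n : ℕ} {w D ε K K₁ C Γ : ℝ} (hD : 0 ≤ D)
    (hDw : 2 * D ≤ w) (hD1 : D ≤ 1) (hw : 0 < w) (hε : 0 ≤ ε) (hK : 0 ≤ K) (hC : 0 ≤ C)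
    (hΓ : 2 * (K + C) ≤ Γ ^ 2) (hΓ0 : 0 < Γ) (hΓD : Γ * Real.sqrt ε ≤ D)
    (h : w ≤ w / 2 + ((w / 2) ^ (2 * n + 3))⁻¹ *
      (K₁ * (w * D) ^ (n + 1) * w + K * (ε * D ^ (2 * n + 2))) + C * ε) :
    w ^ (n + 2) ≤ 2 * 4 ^ (n + 2) * K₁ * D ^ (n + 1) := by
  obtain ⟨τ, rfl⟩ : ∃ τ, w = 2 * τ := ⟨w / 2, by ring⟩
  have hτ : 0 < τ := by linarith
  have hDτ : D ≤ τ := by linarith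
  rw [mul_div_cancel_left₀ τ two_ne_zero] at h
  have hp : 0 < τ ^ (2 * n + 3) := by positivity
  have hεD : ε * (2 * (K + C)) ≤ D ^ 2 := by
    have h1 := pow_le_pow_left₀ (by positivity) hΓD 2
    rw [mul_pow, Real.sq_sqrt hε] at h1
    nlinarith
  have h1 : τ ^ (2 * n + 4) ≤ K₁ * (2 * τ * D) ^ (n + 1) * (2 * τ) + K * (ε * D ^ (2 * n + 2)) +
      C * ε * τ ^ (2 * n + 3) := by
    have h2 := mul_le_mul_of_nonneg_left h hp.le
    have h3 : τ ^ (2 * n + 3) * (τ + (τ ^ (2 * n + 3))⁻¹ *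
        (K₁ * (2 * τ * D) ^ (n + 1) * (2 * τ) + K * (ε * D ^ (2 * n + 2))) + C * ε) =
        τ ^ (2 * n + 4) + (K₁ * (2 * τ * D) ^ (n + 1) * (2 * τ) + K * (ε * D ^ (2 * n + 2))) +
        C * ε * τ ^ (2 * n + 3) := by
      field_simp
      ring
    rw [h3] at h2
    have h4 : τ ^ (2 * n + 3) * (2 * τ) = τ ^ (2 * n + 4) + τ ^ (2 * n + 4) := by ring
    linarith
  have h5 : K * (ε * D ^ (2 * n + 2)) ≤ K * ε * τ ^ (2 * n + 2) := by
    rw [mul_assoc]; gcongr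
  have hD2 : D ^ 2 ≤ τ ^ 2 := pow_le_pow_left₀ hD hDτ 2
  have h7 : τ ^ (2 * n + 4) ≤ 2 * (K₁ * (2 * τ * D) ^ (n + 1) * (2 * τ)) := by
    have q : 0 ≤ τ ^ (2 * n + 2) := by positivity
    have e4 : τ ^ (2 * n + 4) = τ ^ (2 * n + 2) * τ ^ 2 := by ring
    have e3 : τ ^ (2 * n + 3) = τ ^ (2 * n + 2) * τ := by ring
    have hDτ' : D ^ 2 ≤ τ ∧ D ^ 2 ≤ 1 := by constructor <;> nlinarith
    -- Together the two error terms are at most half of `τ^(2n+4)`, because `2 (K + C) ε ≤ D² ≤ τ²`.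
    -- For `τ > 1` the bound `D ≤ 1` compensates the extra factor `τ`.
    have c2 : C * ε * τ + K * ε ≤ τ ^ 2 / 2 := by
      rcases le_or_gt τ 1 with h | h
      · nlinarith [mul_nonneg hC hε, mul_nonneg hK hε]
      · have : (K * ε + C * ε) * (2 * τ) ≤ τ := by nlinarith
        nlinarith [mul_nonneg hC hε, mul_nonneg hK hε]
    have := mul_le_mul_of_nonneg_left c2 q
    rw [e4] at h1 ⊢
    rw [e3] at h1
    nlinarith
  have hτn : 0 < τ ^ (n + 2) := by positivity
  have h8 : τ ^ (n + 2) * τ ^ (n + 2) ≤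
      τ ^ (n + 2) * (2 * (2 ^ (n + 2) * K₁ * D ^ (n + 1))) := by
    refine le_trans (le_of_eq ?_) (h7.trans (le_of_eq ?_))
    · ring
    · ring
  have h9 := le_of_mul_le_mul_left h8 hτn
  rw [mul_pow]
  refine (mul_le_mul_of_nonneg_left h9 (by positivity)).trans (le_of_eq ?_)
  rw [show (4 : ℝ) = 2 * 2 by norm_num, mul_pow]
  ring

theorem IsGlobal.normSq_le (hμ : μ ∈ stdSimplex ℝ (∀ i, V i)) {d : ℕ} {δ : ℝ}
    {f : (∀ i, V i) → ℝ} (hg : IsGlobal μ d δ f) : normSq μ f ≤ δ ^ 2 := by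
  have h := hg ∅ (by simp) (fun i => absurd i.2 (notMem_empty _))
    (by rw [marginal]; simp [Finset.restrict_def, funext_iff, hμ.2])
  rw [link_empty hμ] at h
  exact normSq_le_of_norm₂_le hμ.1 h

/-- **Level inequality** for global Boolean functions on `ε`-product measures. -/
theorem exists_levelWeight_le (k n : ℕ) : ∃ Γ : ℝ, 0 < Γ ∧
    ∀ (V : Fin k → Type*) [∀ i, Fintype (V i)] (ε : ℝ), 0 ≤ ε → ∀ i ≤ k,
      ∀ μ ∈ stdSimplex ℝ (∀ i, V i), IsEpsProduct ε μ →
      ∀ f : (∀ i, V i) → ℝ, (∀ x, 0 < μ x → f x = 0 ∨ f x = 1) →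
      ∀ δ D t : ℝ, IsGlobal μ i δ f → δ ^ 2 ≤ D → D ≤ 1 → Γ * Real.sqrt ε ≤ D → 0 ≤ t →
        2 * 4 ^ (n + 2) * levelRate n ^ i * D ^ (n + 1) ≤ t ^ (n + 2) →
        levelWeight μ i f ≤ t * normSq μ f := by
  obtain ⟨K, hK, hyp⟩ := exists_expect_level_pow_le k n
  set C : ℝ := 16 ^ k * (k : ℝ) ^ 2 with hC
  have hC0 : 0 ≤ C := by positivity
  have hΓ0 : 0 < 2 * (K + C) + 1 := by positivity
  -- The added `1` ensures `Γ² ≥ 2 (K + C)`, as the absorption of errors requires.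
  refine ⟨2 * (K + C) + 1, hΓ0, ?_⟩
  intro V _ ε hε i
  -- The measure is still universally quantified here, so the induction hypothesis applies to every
  -- link.
  induction i using Nat.strong_induction_on with
  | _ i ih =>
  intro hi μ hμ h f hf δ D t hg hδD hD1 hΓD ht htp
  set Q := normSq μ f with hQ
  have hQ0 : 0 ≤ Q := normSq_nonneg hμ.1 f
  have hr := one_le_levelRate n
  rcases hQ0.eq_or_lt with hQz | hQp
  · rw [levelWeight_eq_zero hμ.1 i hQz.symm, ← hQz, mul_zero]
  by_contra! hW
  have hQD : Q ≤ D := (hg.normSq_le hμ).trans hδD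
  have hDp : 0 < D := hQp.trans_le hQD
  -- Arguing by contradiction, `w > t`. Bounds by `t` from the induction hypothesis can then be
  -- weakened to `w`, on a par with the self-referential term.
  set w := levelWeight μ i f / Q with hw
  have hwQ : levelWeight μ i f = w * Q := by rw [hw]; field_simp
  have htw : t < w := by rwa [hw, lt_div_iff₀ hQp]
  have hri : 1 ≤ levelRate n ^ i := one_le_pow₀ hr
  have h4 : 4 * D ≤ t := by
    refine le_of_pow_le_pow_left₀ (n := n + 2) (by omega) ht (le_trans ?_ htp)
    rw [mul_pow, pow_succ D (n + 1)]
    have h1 : D ^ (n + 1) * D ≤ D ^ (n + 1) := mul_le_of_le_one_right (by positivity) hD1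
    have h2 : (4 : ℝ) ^ (n + 2) ≤ 2 * 4 ^ (n + 2) * levelRate n ^ i := by
      have : (0 : ℝ) < 4 ^ (n + 2) := by positivity
      nlinarith
    exact mul_le_mul h2 h1 (by positivity) (by positivity)
  have hw0 : 0 < w := by linarith
  have hcond : ∀ T : Finset (Fin k), T.card ≤ i → ∀ P ⊆ T, ∀ x, 0 < μ x →
      ∑ R ∈ powersetCard (i - T.card) (univ \ T),
        avg μ P (fun y => condEfronStein μ P R f y ^ 2) x ≤ w * D := by
    intro T hT P hP x hx
    refine (sum_avg_condEfronStein_sq_le hμ.1 (i - T.card) f hx).trans ?_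
    -- For `T = ∅` the sum is the level-`i` weight of `μ` itself, equal to `w Q ≤ w D`. For nonempty
    -- `T` the level drops to `i - |T|` and `|P| ≤ |T|`, so the link is global enough for the
    -- induction hypothesis.
    rcases T.eq_empty_or_nonempty with rfl | hTn
    · obtain rfl := subset_empty.1 hP
      rw [link_empty hμ, card_empty, Nat.sub_zero, hwQ]
      exact mul_le_mul_of_nonneg_left hQD hw0.le
    · have ha : 0 < marginal μ P (P.restrict x) := hx.trans_le (le_marginal hμ.1 P x)
      have hTc := hTn.card_pos
      have hPc := card_le_card hP
      have hl := link_mem_stdSimplex hμ.1 ha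
      have hgl : IsGlobal (link μ P (P.restrict x)) (i - T.card) δ f :=
        hg.link hμ.1 ha (by omega)
      refine (ih (i - T.card) (by omega) (by omega) _ hl (h.link hε hμ.1 ha) f
        (fun y hy => hf y (pos_of_link_pos hμ.1 hy)) δ D t hgl hδD hD1 hΓD ht ?_).trans ?_
      · refine le_trans ?_ htp
        have := pow_le_pow_right₀ hr (Nat.sub_le i T.card)
        gcongr
      · exact mul_le_mul htw.le ((hgl.normSq_le hl).trans hδD)
          (normSq_nonneg hl.1 f) hw0.le
  have hm := hyp V μ ε hμ.1 hε h f D (w * D) i hi hDp.le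
    (fun U hU x => (abs_avg_le_of_isGlobal hμ.1 hf hg hU x).trans hδD) hcond
  -- Duality at `τ = w/2`: half of the weight returns to the left side, leaving the moment to bound
  -- the other half.
  have hτ : 0 < w / 2 := by positivity
  set g : (∀ i, V i) → ℝ := fun x => ∑ S ∈ powersetCard i univ, efronStein μ S f x with hgd
  have h1 : expect μ (fun x => f x * g x) ≤
      w / 2 * Q + ((w / 2) ^ (2 * n + 3))⁻¹ * expect μ (fun x => g x ^ (2 * (n + 2))) := by
    rw [hQ, normSq_eq_expect hμ.1 hf, ← expect_const_mul, ← expect_const_mul, ← expect_add]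
    exact expect_mono hμ.1 fun x hx => mul_le_add_pow_div hτ (hf x hx) n
  have h2 := levelWeight_le_expect_mul hμ.1 hε h i f
  have hinv : 0 ≤ ((w / 2) ^ (2 * n + 3))⁻¹ := by positivity
  have h3 : w * Q ≤ (w / 2 + ((w / 2) ^ (2 * n + 3))⁻¹ *
      (levelRate n ^ i * (w * D) ^ (n + 1) * w + K * (ε * D ^ (2 * n + 2))) + C * ε) * Q := by
    have h5 := mul_le_mul_of_nonneg_left hm hinv
    rw [hwQ] at h2 h5
    refine (h2.trans (add_le_add_left (h1.trans (add_le_add_right h5 _)) _)).trans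
      (le_of_eq ?_)
    rw [← hC, ← hQ]
    ring
  have h6 := pow_le_of_self_bound hDp.le (by linarith) hD1 hw0 hε hK hC0 (by nlinarith) hΓ0 hΓD
    (le_of_mul_le_mul_right h3 hQp)
  have h7 : t ^ (n + 2) < w ^ (n + 2) := pow_lt_pow_left₀ htw ht (by omega)
  linarith

end LevelInequality

/-! ### Numerical estimates and summation over levels -/

section Numeric

/-- For `n = 2d - 1` and `d ≥ 2`, both summands are at most `(6d)^(4d+2)`, using `24(2d+1) ≤ (6d)²`
and `2d + 2 ≤ 3d`. -/
theorem levelRate_le {d : ℕ} (hd : 2 ≤ d) :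
    levelRate (2 * d - 1) ≤ 2 * (6 * (d : ℝ)) ^ (4 * d + 2) := by
  obtain ⟨e, rfl⟩ : ∃ e, d = e + 2 := ⟨d - 2, by omega⟩
  have he : (0 : ℝ) ≤ e := e.cast_nonneg
  have h1 : 2 * (e + 2) - 1 = 2 * e + 3 := by omega
  rw [h1, levelRate]
  push_cast
  have h2 : (24 * (2 * (e : ℝ) + 3 + 2)) ^ (2 * e + 3 + 2) ≤ (6 * ((e : ℝ) + 2)) ^ (4 * (e + 2) + 2) := by
    rw [show 4 * (e + 2) + 2 = 2 * (2 * e + 3 + 2) by ring, pow_mul]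
    exact pow_le_pow_left₀ (by positivity) (by nlinarith) _
  have h3 : (2 * (e : ℝ) + 3 + 3) ^ (2 * (2 * e + 3 + 2)) * 4 ^ (2 * e + 3 + 1) ≤
      (6 * ((e : ℝ) + 2)) ^ (4 * (e + 2) + 2) := by
    calc (2 * (e : ℝ) + 3 + 3) ^ (2 * (2 * e + 3 + 2)) * 4 ^ (2 * e + 3 + 1)
        ≤ (3 * ((e : ℝ) + 2)) ^ (2 * (2 * e + 3 + 2)) * 4 ^ (2 * e + 3 + 2) := by
          refine mul_le_mul (pow_le_pow_left₀ (by positivity) (by linarith) _)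
            (pow_le_pow_right₀ (by norm_num) (by omega)) (by positivity) (by positivity)
      _ = (6 * ((e : ℝ) + 2)) ^ (4 * (e + 2) + 2) := by
          rw [show (4 : ℝ) = 2 ^ 2 by norm_num, ← pow_mul, ← mul_pow,
            show 4 * (e + 2) + 2 = 2 * (2 * e + 3 + 2) by ring]
          ring
  linarith

theorem sixtyFour_mul_pow_le {d : ℕ} (hd : 2 ≤ d) : 64 * d ^ 4 ≤ 32 ^ d := by
  induction d, hd using Nat.le_induction with
  | base => norm_num
  | succ d hd ih =>
    have h : (d + 1) ^ 4 ≤ 32 * d ^ 4 := by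
      have h1 : (d + 1) ^ 4 ≤ (2 * d) ^ 4 := Nat.pow_le_pow_left (by omega) 4
      rw [mul_pow] at h1
      omega
    rw [pow_succ 32 d]
    omega

theorem mul_sq_le_pow {d : ℕ} (hd : 2 ≤ d) : 589824 * d ^ 2 ≤ 4822 ^ d := by
  induction d, hd using Nat.le_induction with
  | base => norm_num
  | succ d hd ih =>
    have h : (d + 1) ^ 2 ≤ 4 * d ^ 2 := by nlinarith
    rw [pow_succ 4822 d]
    omega

/-- Comparison of the hypercontractive rate with `(50 d) ^ d`. -/
theorem levelRate_pow_le {d i : ℕ} (hd : 2 ≤ d) (hi : 2 * i ≤ d) :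
    (d : ℝ) ^ 2 * (2 * 4 ^ (2 * d + 1) * levelRate (2 * d - 1) ^ i) ≤
      ((50 * (d : ℝ)) ^ d) ^ (2 * d) := by
  have hd0 : (0 : ℝ) < d := by positivity
  have hr := one_le_levelRate (2 * d - 1)
  -- Squaring turns the exponent `i` into `2i`, which is at most `d`.
  refine le_of_pow_le_pow_left₀ two_ne_zero (by positivity) ?_
  have h1 : (levelRate (2 * d - 1) ^ i) ^ 2 ≤ (2 * (6 * (d : ℝ)) ^ (4 * d + 2)) ^ d := by
    rw [← pow_mul, mul_comm i 2]
    exact (pow_le_pow_right₀ hr hi).trans (pow_le_pow_left₀ (by linarith) (levelRate_le hd) _)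
  -- Here `18432 = 256 · 2 · 6²` and `589824 = 32 · 18432`; the base `25/3` satisfies `(25/3)^4 ≥
  -- 4822` and `25/3 · 6 = 50`.
  have h2 : (64 * (d : ℝ) ^ 4) * (18432 * (d : ℝ) ^ 2) ^ d ≤ ((25 / 3 : ℝ) ^ (4 * d)) ^ d := by
    have a : 64 * (d : ℝ) ^ 4 ≤ 32 ^ d := by exact_mod_cast sixtyFour_mul_pow_le hd
    have b : 589824 * (d : ℝ) ^ 2 ≤ 4822 ^ d := by exact_mod_cast mul_sq_le_pow hd
    calc (64 * (d : ℝ) ^ 4) * (18432 * (d : ℝ) ^ 2) ^ d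
        ≤ 32 ^ d * (18432 * (d : ℝ) ^ 2) ^ d := by gcongr
      _ = (589824 * (d : ℝ) ^ 2) ^ d := by rw [← mul_pow]; ring
      _ ≤ ((4822 : ℝ) ^ d) ^ d := by gcongr
      _ ≤ ((25 / 3 : ℝ) ^ (4 * d)) ^ d := by
          rw [pow_mul (25 / 3 : ℝ)]
          gcongr
          norm_num
  calc ((d : ℝ) ^ 2 * (2 * 4 ^ (2 * d + 1) * levelRate (2 * d - 1) ^ i)) ^ 2
      = (d : ℝ) ^ 4 * (64 * 256 ^ d) * (levelRate (2 * d - 1) ^ i) ^ 2 := by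
        rw [show (256 : ℝ) = 4 ^ 4 by norm_num, ← pow_mul]
        ring
    _ ≤ (d : ℝ) ^ 4 * (64 * 256 ^ d) * (2 * (6 * (d : ℝ)) ^ (4 * d + 2)) ^ d := by gcongr
    _ = (64 * (d : ℝ) ^ 4) * (18432 * (d : ℝ) ^ 2) ^ d * ((6 * (d : ℝ)) ^ (4 * d)) ^ d := by
        rw [show (18432 : ℝ) * (d : ℝ) ^ 2 = 256 * (2 * (6 * d) ^ 2) by ring, mul_pow 256,
          pow_add, ← mul_assoc 2, mul_right_comm 2, mul_pow (2 * (6 * (d : ℝ)) ^ 2)]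
        ring
    _ ≤ ((25 / 3 : ℝ) ^ (4 * d)) ^ d * ((6 * (d : ℝ)) ^ (4 * d)) ^ d := by gcongr
    _ = (((50 * (d : ℝ)) ^ d) ^ (2 * d)) ^ 2 := by
        rw [← mul_pow, ← mul_pow, show 25 / 3 * (6 * (d : ℝ)) = 50 * d by ring, ← pow_mul,
          ← pow_mul, ← pow_mul]
        congr 1
        ring

/-- The power of the maximum `max a b` is at least `b^(2d) a`. The negative powers of `ρ` in
`b^(2d)` outweigh `ρ^(d-2)` in `a`, and the factor `d²` of `levelRate_pow_le` pays for the
denominator of `a`. -/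
theorem threshold_pow_le {d i : ℕ} (hd : 2 ≤ d) (hi : 2 * i ≤ d) (hi1 : 1 ≤ i) {ρ D : ℝ}
    (hρ : 0 < ρ) (hρ1 : ρ < 1) (hD : 0 ≤ D) :
    2 * 4 ^ (2 * d + 1) * levelRate (2 * d - 1) ^ i * D ^ (2 * d) ≤
      (max (ρ ^ (d - 2) / (d : ℝ) ^ 2) ((50 * (d : ℝ)) ^ d * D / ρ ^ (2 * i))) ^ (2 * d + 1) := by
  have hd0 : (0 : ℝ) < d := by positivity
  set a := ρ ^ (d - 2) / (d : ℝ) ^ 2 with ha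
  set b := (50 * (d : ℝ)) ^ d * D / ρ ^ (2 * i) with hb
  have ha0 : 0 ≤ a := by positivity
  have hb0 : 0 ≤ b := by positivity
  have h1 : b ^ (2 * d) * a ≤ max a b ^ (2 * d + 1) := by
    rw [pow_succ]
    exact mul_le_mul (pow_le_pow_left₀ hb0 (le_max_right _ _) _) (le_max_left _ _) ha0
      (by positivity)
  refine le_trans ?_ h1
  have h2 := mul_le_mul_of_nonneg_right (levelRate_pow_le hd hi)
    (show 0 ≤ D ^ (2 * d) by positivity)
  have h3 : ρ ^ (2 * i * (2 * d)) ≤ ρ ^ (d - 2) :=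
    pow_le_pow_of_le_one hρ.le hρ1.le (by nlinarith [Nat.sub_le d 2])
  have h4 : b ^ (2 * d) * a = (((50 * (d : ℝ)) ^ d) ^ (2 * d) * D ^ (2 * d)) / (d : ℝ) ^ 2 *
      (ρ ^ (d - 2) / ρ ^ (2 * i * (2 * d))) := by
    rw [ha, hb, div_pow, mul_pow, ← pow_mul ρ]
    ring
  rw [h4]
  have h5 : 1 ≤ ρ ^ (d - 2) / ρ ^ (2 * i * (2 * d)) := by
    rwa [one_le_div (by positivity)]
  refine le_trans ?_ (le_mul_of_one_le_right (by positivity) h5)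
  rw [le_div_iff₀ (by positivity)]
  refine le_trans (le_of_eq ?_) h2
  ring

/-- Combination of the bounds on the individual levels. -/
theorem sum_pow_mul_le {k d : ℕ} (hd : 1 ≤ d) {W : ℕ → ℝ} {ρ Q D b c : ℝ} (hρ : 0 < ρ)
    (hρ1 : ρ < 1) (hW : ∀ i, 0 ≤ W i) (hQ : 0 ≤ Q) (hD : 0 ≤ D) (hb : 0 ≤ b) (hc : 0 ≤ c)
    (hsum : ∑ i ∈ range (k + 1), W i ≤ Q + c) (h0 : W 0 ≤ D)
    (hlow : ∀ i, 1 ≤ i → 2 * i ≤ d →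
      W i ≤ ρ ^ (d - 2) / (d : ℝ) ^ 2 * Q ∨ ρ ^ (2 * i) * W i ≤ b) :
    ∑ i ∈ range (k + 1), ρ ^ (2 * i) * W i ≤ ρ ^ d * Q + D + d * b + c := by
  have hd0 : (0 : ℝ) < d := by positivity
  set c₁ := ρ ^ (d - 2) / (d : ℝ) ^ 2 * Q with hc₁
  have hc₁0 : 0 ≤ c₁ := by positivity
  -- `u` collects the low levels that are small in the first sense. They are charged `ρ²`, whereas
  -- high levels are charged `ρ^(d+1)`, as `2i > d` means `2i ≥ d + 1`.
  set u : ℕ → ℝ := fun i => if (1 ≤ i ∧ 2 * i ≤ d) ∧ W i ≤ c₁ then W i else 0 with hu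
  have hpt : ∀ i, ρ ^ (2 * i) * W i ≤ (if i = 0 then D else 0) +
      (if 1 ≤ i ∧ 2 * i ≤ d then b else 0) + ρ ^ 2 * u i + ρ ^ (d + 1) * (W i - u i) := by
    intro i
    have hp : 0 ≤ ρ ^ (d + 1) * W i := mul_nonneg (by positivity) (hW i)
    rcases Nat.eq_zero_or_pos i with rfl | hi
    · simp only [hu]
      norm_num
      linarith
    · have hi0 : i ≠ 0 := by omega
      simp only [hu, hi0, if_false, zero_add]
      by_cases hl : 1 ≤ i ∧ 2 * i ≤ d
      · by_cases hw : W i ≤ c₁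
        · simp only [hl, hw, and_self, if_true, sub_self, mul_zero, add_zero]
          have := mul_le_mul_of_nonneg_right (pow_le_pow_of_le_one hρ.le hρ1.le
            (show 2 ≤ 2 * i by omega)) (hW i)
          linarith
        · simp only [hl, hw, and_self, and_false, if_true, if_false, sub_zero, mul_zero, add_zero]
          have := (hlow i hl.1 hl.2).resolve_left hw
          linarith
      · simp only [hl, false_and, if_false, zero_add, mul_zero, sub_zero]
        exact mul_le_mul_of_nonneg_right (pow_le_pow_of_le_one hρ.le hρ1.le (by omega)) (hW i)
  have hcard : ((range (k + 1)).filter (fun i => 1 ≤ i ∧ 2 * i ≤ d)).card ≤ d := by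
    refine (card_le_card (t := Icc 1 d) fun i hi => ?_).trans (by simp)
    have := (mem_filter.1 hi).2
    exact mem_Icc.2 (by omega)
  have hcount : ∀ e : ℝ, 0 ≤ e →
      ∑ i ∈ range (k + 1), (if 1 ≤ i ∧ 2 * i ≤ d then e else 0) ≤ d * e := by
    intro e he
    rw [← sum_filter, sum_const, nsmul_eq_mul]
    exact mul_le_mul_of_nonneg_right (by exact_mod_cast hcard) he
  have hU : ∑ i ∈ range (k + 1), u i ≤ d * c₁ := by
    refine (sum_le_sum fun i _ => ?_).trans (hcount c₁ hc₁0)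
    simp only [hu]
    split_ifs with h1 h2 h2
    · exact h1.2
    · exact absurd h1.1 h2
    · exact hc₁0
    · exact le_rfl
  have hU0 : 0 ≤ ∑ i ∈ range (k + 1), u i := sum_nonneg fun i _ => by
    simp only [hu]
    split_ifs
    · exact hW i
    · exact le_rfl
  have hU1 : d = 1 → ∑ i ∈ range (k + 1), u i = 0 := fun h => sum_eq_zero fun i _ => by
    simp only [hu]
    rw [if_neg (by omega)]
  refine (sum_le_sum fun i _ => hpt i).trans ?_
  rw [sum_add_distrib, sum_add_distrib, sum_add_distrib, ← mul_sum, ← mul_sum, sum_sub_distrib]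
  set U := ∑ i ∈ range (k + 1), u i with hUd
  have hz : ∑ i ∈ range (k + 1), (if i = 0 then D else 0) = D := by simp
  have hb' := hcount b hb
  have hρd : 0 < ρ ^ (d + 1) := by positivity
  have hρd1 : ρ ^ (d + 1) ≤ 1 := pow_le_one₀ hρ.le hρ1.le
  have h1 : ρ ^ (d + 1) * (∑ i ∈ range (k + 1), W i - U) ≤ ρ ^ (d + 1) * (Q - U) + c := by
    have := mul_le_mul_of_nonneg_left hsum hρd.le
    have := mul_le_of_le_one_left hc hρd1
    linarith
  -- The surplus of `U` at rate `ρ²` fits in the gap `ρ^d - ρ^(d+1)`: by Bernoulli `1 - ρ^(d-1) ≤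
  -- (d-1)(1-ρ)`, and the `d²` in the threshold gives `d U ≤ ρ^(d-2) Q`. For `d = 1` there are no
  -- such levels.
  have h2 : ρ ^ 2 * U + ρ ^ (d + 1) * (Q - U) ≤ ρ ^ d * Q := by
    rcases hd.eq_or_lt with h | h
    · rw [hU1 h.symm, ← h]
      rw [mul_zero, zero_add, sub_zero]
      exact mul_le_mul_of_nonneg_right (pow_le_pow_of_le_one hρ.le hρ1.le one_le_two) hQ
    · obtain ⟨e, rfl⟩ : ∃ e, d = e + 2 := ⟨d - 2, by omega⟩
      rw [Nat.add_sub_cancel] at hc₁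
      have hbern : 1 - ρ ^ (e + 1) ≤ (e + 1) * (1 - ρ) := by
        have := one_add_mul_le_pow (show (-2 : ℝ) ≤ ρ - 1 by linarith) (e + 1)
        rw [add_sub_cancel] at this
        push_cast at this
        linarith
      have hUe : (e + 1) * U ≤ ρ ^ e * Q := by
        have h3 : ((e + 2 : ℕ) : ℝ) * U ≤ ρ ^ e * Q := by
          refine (mul_le_mul_of_nonneg_left hU hd0.le).trans (le_of_eq ?_)
          rw [hc₁]
          field_simp
        push_cast at h3
        linarith
      have h4 := mul_le_mul_of_nonneg_right hbern hU0
      have h5 := mul_le_mul_of_nonneg_right hUe (show 0 ≤ 1 - ρ by linarith)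
      have h6 : (1 - ρ ^ (e + 1)) * U ≤ ρ ^ e * Q * (1 - ρ) := by
        refine h4.trans (le_trans (le_of_eq ?_) h5)
        ring
      have h7 := mul_le_mul_of_nonneg_left h6 (sq_nonneg ρ)
      have e1 : ρ ^ (e + 2) = ρ ^ 2 * ρ ^ e := by ring
      have e2 : ρ ^ (e + 2 + 1) = ρ ^ 2 * ρ ^ (e + 1) := by ring
      have e3 : ρ ^ (e + 1) = ρ ^ e * ρ := by ring
      rw [e1, e2]
      rw [e3] at h7 ⊢
      linarith
  rw [hz]
  linarith

/-- The factor `2^d` between the bases `50d` and `100d` pays for the number of low levels and for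
level `0`. -/
theorem mul_pow_add_one_le (d : ℕ) (hd : 1 ≤ d) :
    d * (50 * (d : ℝ)) ^ d + 1 ≤ (100 * (d : ℝ)) ^ d := by
  have hd1 : (1 : ℝ) ≤ d := by exact_mod_cast hd
  have h1 : (1 : ℝ) ≤ (50 * (d : ℝ)) ^ d := one_le_pow₀ (by linarith)
  have h2 : (d : ℝ) + 1 ≤ 2 ^ d := by exact_mod_cast d.lt_two_pow_self
  calc d * (50 * (d : ℝ)) ^ d + 1 ≤ (d + 1) * (50 * (d : ℝ)) ^ d := by linarith
    _ ≤ 2 ^ d * (50 * (d : ℝ)) ^ d := by gcongr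
    _ = (100 * (d : ℝ)) ^ d := by rw [← mul_pow]; ring

end Numeric

/-! ### Contraction of the noise operator and escape from the set -/

section Noise

variable {k : ℕ} {V : Fin k → Type*} [∀ i, Fintype (V i)] {μ : (∀ i, V i) → ℝ} {ε : ℝ}

theorem sum_noise_weight (k : ℕ) (ρ : ℝ) :
    ∑ S : Finset (Fin k), ρ ^ S.card * (1 - ρ) ^ (k - S.card) = 1 := by
  have := Fintype.sum_pow_mul_eq_add_pow (Fin k) ρ (1 - ρ)
  rw [Fintype.card_fin] at this
  rw [this, add_sub_cancel, one_pow]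

theorem norm₂_noise_le (hμ : ∀ x, 0 ≤ μ x) {ρ : ℝ} (hρ : 0 ≤ ρ) (hρ1 : ρ ≤ 1)
    (f : (∀ i, V i) → ℝ) : norm₂ μ (noise μ ρ f) ≤ norm₂ μ f := by
  refine (norm₂_sum_le hμ univ _).trans ?_
  have h : ∀ S : Finset (Fin k), 0 ≤ ρ ^ S.card * (1 - ρ) ^ (k - S.card) := fun S =>
    mul_nonneg (pow_nonneg hρ _) (pow_nonneg (by linarith) _)
  suffices hs : ∀ S : Finset (Fin k),
      norm₂ μ (fun x => ρ ^ S.card * (1 - ρ) ^ (k - S.card) * avg μ S f x) ≤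
        ρ ^ S.card * (1 - ρ) ^ (k - S.card) * norm₂ μ f by
    refine (sum_le_sum fun S _ => hs S).trans (le_of_eq ?_)
    rw [← sum_mul, sum_noise_weight, one_mul]
  intro S
  rw [norm₂_const_mul, abs_of_nonneg (h S)]
  exact mul_le_mul_of_nonneg_left (norm₂_avg_le hμ S f) (h S)

theorem normSq_noise_le (hμ : ∀ x, 0 ≤ μ x) {ρ : ℝ} (hρ : 0 ≤ ρ) (hρ1 : ρ ≤ 1)
    (f : (∀ i, V i) → ℝ) : normSq μ (noise μ ρ f) ≤ normSq μ f := by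
  rw [← norm₂_sq hμ f]
  exact normSq_le_of_norm₂_le hμ (norm₂_noise_le hμ hρ hρ1 f)

theorem expect_noiseStep (ρ : ℝ) (x : ∀ i, V i) (g : (∀ i, V i) → ℝ) :
    expect (noiseStep μ ρ x) g = noise μ ρ g x := by
  simp only [expect, noiseStep, noise, avg, sum_mul, mul_sum]
  rw [sum_comm]
  exact sum_congr rfl fun S _ => sum_congr rfl fun y _ => by ring

theorem noise_one_sub (hμ : ∀ x, 0 ≤ μ x) (ρ : ℝ) (f : (∀ i, V i) → ℝ) {x : ∀ i, V i}
    (hx : 0 < μ x) : noise μ ρ (fun y => 1 - f y) x = 1 - noise μ ρ f x := by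
  unfold noise
  simp only [avg_sub, avg_const hμ _ 1 hx, mul_sub, mul_one, sum_sub_distrib, sum_noise_weight]

/-- Near-orthogonality of the Efron--Stein decomposition. -/
theorem abs_normSq_sum_efronStein_sub_le (hμ : ∀ x, 0 ≤ μ x) (hε : 0 ≤ ε)
    (h : IsEpsProduct ε μ) (f : (∀ i, V i) → ℝ) {a : Finset (Fin k) → ℝ} (ha : ∀ S, |a S| ≤ 1) :
    |normSq μ (fun x => ∑ S, a S * efronStein μ S f x) -
        ∑ S, a S ^ 2 * normSq μ (efronStein μ S f)| ≤
      16 ^ k * (k : ℝ) ^ 2 * (ε * normSq μ f) := by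
  have hN := normSq_nonneg hμ f
  have hcard : ((univ : Finset (Finset (Fin k))).card : ℝ) ≤ 2 ^ k := by
    rw [card_univ, Fintype.card_finset, Fintype.card_fin]
    push_cast
    exact le_rfl
  have h1 : normSq μ (fun x => ∑ S, a S * efronStein μ S f x) -
      ∑ S, a S ^ 2 * normSq μ (efronStein μ S f) =
      ∑ S, ∑ T ∈ univ.erase S,
        a S * a T * expect μ (fun x => efronStein μ S f x * efronStein μ T f x) := by
    have h2 : normSq μ (fun x => ∑ S, a S * efronStein μ S f x) =
        ∑ S, ∑ T, a S * a T * expect μ (fun x => efronStein μ S f x * efronStein μ T f x) := by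
      simp only [← expect_const_mul]
      simp only [← expect_sum]
      unfold normSq
      congr 1
      funext x
      rw [sq, sum_mul_sum]
      exact sum_congr rfl fun S _ => sum_congr rfl fun T _ => by ring
    rw [h2, ← sum_sub_distrib]
    refine sum_congr rfl fun S _ => ?_
    rw [← add_sum_erase _ _ (mem_univ S)]
    have : normSq μ (efronStein μ S f) =
        expect μ (fun x => efronStein μ S f x * efronStein μ S f x) := by
      unfold normSq
      simp only [sq]
    rw [this]
    ring
  rw [h1]
  refine (abs_sum_le_sum_abs _ _).trans ?_
  refine (sum_le_card_mul (b := 2 ^ k * (4 ^ k * ((k : ℝ) ^ 2 * ε * normSq μ f)))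
    (by positivity) hcard fun S _ => ?_).trans (le_of_eq ?_)
  · refine (abs_sum_le_sum_abs _ _).trans ?_
    refine sum_le_card_mul (by positivity)
      ((Nat.cast_le.2 (card_le_univ (univ.erase S))).trans hcard) fun T hT => ?_
    rw [abs_mul, abs_mul]
    have h3 := abs_expect_efronStein_mul_le hμ hε h (ne_of_mem_erase hT).symm f
    have h4 : |a S| * |a T| ≤ 1 := mul_le_one₀ (ha S) (abs_nonneg _) (ha T)
    exact (mul_le_of_le_one_left (abs_nonneg _) h4).trans h3
  · rw [show (16 : ℝ) = 2 * 2 * 4 by norm_num, mul_pow, mul_pow]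
    ring

theorem sum_mul_normSq_efronStein (c : ℕ → ℝ) (f : (∀ i, V i) → ℝ) :
    ∑ S : Finset (Fin k), c S.card * normSq μ (efronStein μ S f) =
      ∑ i ∈ range (k + 1), c i * levelWeight μ i f := by
  rw [← powerset_univ, sum_powerset, card_univ, Fintype.card_fin]
  refine sum_congr rfl fun i _ => ?_
  rw [levelWeight, mul_sum]
  exact sum_congr rfl fun S hS => by rw [(mem_powersetCard.1 hS).2]

theorem sum_levelWeight_le (hμ : ∀ x, 0 ≤ μ x) (hε : 0 ≤ ε)
    (h : IsEpsProduct ε μ) (f : (∀ i, V i) → ℝ) :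
    ∑ i ∈ range (k + 1), levelWeight μ i f ≤
      normSq μ f + 16 ^ k * (k : ℝ) ^ 2 * (ε * normSq μ f) := by
  have h1 := abs_normSq_sum_efronStein_sub_le hμ hε h f (a := fun _ => 1) (by simp)
  have h2 : normSq μ (fun x => ∑ S, 1 * efronStein μ S f x) = normSq μ f :=
    expect_congr hμ fun x hx => by
      simp only [one_mul]
      rw [sum_efronStein, avg_univ hμ f hx]
  have h3 := sum_mul_normSq_efronStein (μ := μ) (fun _ => 1) f
  simp only [one_mul] at h3
  simp only [one_pow] at h1
  rw [h2] at h1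
  simp only [one_mul] at h1
  rw [h3] at h1
  linarith [(abs_le.1 h1).1]

theorem normSq_noise_le_sum (hμ : ∀ x, 0 ≤ μ x) (hε : 0 ≤ ε)
    (h : IsEpsProduct ε μ) (f : (∀ i, V i) → ℝ) {ρ : ℝ} (hρ : 0 ≤ ρ) (hρ1 : ρ ≤ 1) :
    normSq μ (noise μ ρ f) ≤ ∑ i ∈ range (k + 1), ρ ^ (2 * i) * levelWeight μ i f +
      16 ^ k * (k : ℝ) ^ 2 * (ε * normSq μ f) := by
  have h1 := abs_normSq_sum_efronStein_sub_le hμ hε h f (a := fun S => ρ ^ S.card) fun S => by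
    rw [abs_of_nonneg (pow_nonneg hρ _)]
    exact pow_le_one₀ hρ hρ1
  have h2 := sum_mul_normSq_efronStein (μ := μ) (fun i => ρ ^ (2 * i)) f
  have h3 : noise μ ρ f = fun x => ∑ S : Finset (Fin k), ρ ^ S.card * efronStein μ S f x :=
    funext fun x => noise_eq_sum_efronStein ρ f x
  simp only [← pow_mul, mul_comm _ 2] at h1
  rw [h2, ← h3] at h1
  linarith [(abs_le.1 h1).2]

theorem levelWeight_zero_le (hμ : μ ∈ stdSimplex ℝ (∀ i, V i)) {f : (∀ i, V i) → ℝ}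
    (hf : ∀ x, 0 < μ x → f x = 0 ∨ f x = 1) {d : ℕ} {δ : ℝ} (hg : IsGlobal μ d δ f) :
    levelWeight μ 0 f ≤ δ ^ 2 * normSq μ f := by
  have h1 : efronStein μ ∅ f = fun _ => expect μ f := by
    funext x
    simp [efronStein, avg, link_empty hμ]
  rw [levelWeight, powersetCard_zero, sum_singleton, h1, normSq, expect_const hμ, sq,
    ← normSq_eq_expect hμ.1 hf]
  exact mul_le_mul_of_nonneg_right (hg.normSq_le hμ) (normSq_nonneg hμ.1 f)

/-- When `d ≥ k` all coordinates may be fixed, so globalness bounds `f` pointwise; a Boolean `f`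
that is not null then forces `δ² ≥ 1`. -/
theorem one_le_sq_of_isGlobal (hμ : ∀ x, 0 ≤ μ x) {f : (∀ i, V i) → ℝ}
    (hf : ∀ x, 0 < μ x → f x = 0 ∨ f x = 1) {d : ℕ} {δ : ℝ} (hg : IsGlobal μ d δ f)
    (hd : k ≤ d) (hQ : 0 < normSq μ f) : 1 ≤ δ ^ 2 := by
  by_contra! hδ
  refine hQ.ne' ?_
  have h : normSq μ f = expect μ (fun _ => 0) := expect_congr hμ fun x hx => by
    have h1 := abs_avg_le_of_isGlobal hμ hf hg (U := univ) (by simpa using hd) x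
    rw [avg_univ hμ f hx] at h1
    rcases hf x hx with h2 | h2
    · simp [h2]
    · rw [h2, abs_one] at h1
      linarith
  rw [h]
  simp [expect]

/-- The probability of staying is `⟨f, T_ρ f⟩`, at most `‖f‖ ‖T_ρ f‖ ≤ √B ‖f‖²` by Cauchy–Schwarz.
-/
theorem normSq_sub_le_expect_noiseStep (hμ : ∀ x, 0 ≤ μ x) {f : (∀ i, V i) → ℝ}
    (hf : ∀ x, 0 < μ x → f x = 0 ∨ f x = 1) {ρ B : ℝ} (hB : 0 ≤ B)
    (h : normSq μ (noise μ ρ f) ≤ B * normSq μ f) :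
    (1 - Real.sqrt B) * normSq μ f ≤
      expect μ (fun x => f x * expect (noiseStep μ ρ x) (fun y => 1 - f y)) := by
  have h1 : expect μ (fun x => f x * expect (noiseStep μ ρ x) (fun y => 1 - f y)) =
      normSq μ f - expect μ (fun x => f x * noise μ ρ f x) := by
    rw [normSq_eq_expect hμ hf, ← expect_sub]
    refine expect_congr hμ fun x hx => ?_
    rw [expect_noiseStep, noise_one_sub hμ ρ f hx]
    ring
  have h2 := expect_mul_le hμ f (noise μ ρ f)
  have h3 : norm₂ μ (noise μ ρ f) ≤ Real.sqrt B * norm₂ μ f := by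
    unfold norm₂
    rw [← Real.sqrt_mul hB]
    exact Real.sqrt_le_sqrt h
  have h4 := mul_le_mul_of_nonneg_left h3 (norm₂_nonneg (ν := μ) f)
  have h5 := norm₂_sq hμ f
  have h6 : norm₂ μ f * (Real.sqrt B * norm₂ μ f) = Real.sqrt B * normSq μ f := by
    rw [← h5]
    ring
  rw [h1]
  linarith

/-- The noise operator contracts global Boolean functions on `ε`-product measures. -/
theorem exists_normSq_noise_le (k : ℕ) : ∃ C : ℝ, 0 < C ∧
    ∀ (V : Fin k → Type*) [∀ i, Fintype (V i)] (μ : (∀ i, V i) → ℝ) (ε ρ : ℝ),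
      μ ∈ stdSimplex ℝ (∀ i, V i) → 0 ≤ ε → IsEpsProduct ε μ → 0 < ρ → ρ < 1 →
      ∀ (d : ℕ) (δ : ℝ) (f : (∀ i, V i) → ℝ),
        (∀ x, 0 < μ x → f x = 0 ∨ f x = 1) → IsGlobal μ d δ f →
          normSq μ (noise μ ρ f) ≤
            (ρ ^ d + (100 * (d : ℝ)) ^ d * δ ^ 2 + C * Real.sqrt ε) * normSq μ f := by
  -- With `n = 2d - 1` the moments have order `4d + 2`. The threshold `Γ` depends on `d`; since only
  -- `d ≤ k` will matter, summing over these gives a constant depending on `k` alone.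
  choose Γ hΓ hyp using fun d => exists_levelWeight_le k (2 * d - 1)
  set G := ∑ d ∈ range (k + 1), (100 * (d : ℝ)) ^ d * Γ d with hG
  set C₀ : ℝ := 16 ^ k * (k : ℝ) ^ 2 with hC₀
  have hC₀0 : 0 ≤ C₀ := by positivity
  have hG0 : ∀ d ∈ range (k + 1), 0 ≤ (100 * (d : ℝ)) ^ d * Γ d := fun d _ =>
    mul_nonneg (by positivity) (hΓ d).le
  have hGn : 0 ≤ G := sum_nonneg hG0
  -- `G` pays for enlarging `δ²` to `D`, `2 C₀` for the two uses of near-orthogonality, and `1`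
  -- forces `√ε ≤ 1`, hence `ε ≤ √ε`, in the nontrivial case.
  refine ⟨G + 2 * C₀ + 1, by positivity, ?_⟩
  intro V _ μ ε ρ hμ hε h hρ hρ1 d δ f hf hg
  set s := Real.sqrt ε with hs
  have hs0 : 0 ≤ s := Real.sqrt_nonneg ε
  have hsε : s ^ 2 = ε := Real.sq_sqrt hε
  set Q := normSq μ f with hQ
  have hQ0 : 0 ≤ Q := normSq_nonneg hμ.1 f
  have hcontr : normSq μ (noise μ ρ f) ≤ Q := normSq_noise_le hμ.1 hρ.le hρ1.le f
  have hρd : 0 < ρ ^ d := by positivity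
  have hδ0 : 0 ≤ (100 * (d : ℝ)) ^ d * δ ^ 2 := by positivity
  have hCs : 0 ≤ (G + 2 * C₀ + 1) * s := by positivity
  -- If the claimed factor is at least `1`, contractivity of `T_ρ` suffices. This disposes of `d =
  -- 0`, of `δ² ≥ 1` (hence of `d > k`), and of large `ε`.
  rcases le_or_gt 1 (ρ ^ d + (100 * (d : ℝ)) ^ d * δ ^ 2 + (G + 2 * C₀ + 1) * s) with hB | hB
  · exact hcontr.trans (le_mul_of_one_le_left hQ0 hB)
  rcases hQ0.eq_or_lt with hQz | hQp
  · rw [← hQz, mul_zero]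
    exact hcontr.trans hQz.ge
  have hd : 1 ≤ d := by
    by_contra! h0
    obtain rfl : d = 0 := by omega
    rw [pow_zero] at hB
    linarith
  have hd1 : (1 : ℝ) ≤ d := by exact_mod_cast hd
  have h100 : 1 ≤ (100 * (d : ℝ)) ^ d := one_le_pow₀ (by linarith)
  have hδ1 : δ ^ 2 < 1 := by
    have := le_mul_of_one_le_left (sq_nonneg δ) h100
    linarith
  have hdk : d ≤ k := by
    by_contra! hkd
    exact absurd (one_le_sq_of_isGlobal hμ.1 hf hg hkd.le hQp) hδ1.not_ge
  have hΓG : (100 * (d : ℝ)) ^ d * Γ d ≤ G := single_le_sum hG0 (mem_range.2 (by omega))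
  have hΓs : (100 * (d : ℝ)) ^ d * (Γ d * s) ≤ G * s := by
    rw [← mul_assoc]
    exact mul_le_mul_of_nonneg_right hΓG hs0
  have hΓs0 : 0 ≤ Γ d * s := mul_nonneg (hΓ d).le hs0
  have hC₀s : 0 ≤ C₀ * s := by positivity
  have hΓ1 : Γ d * s < 1 := by
    have h1 := le_mul_of_one_le_left hΓs0 h100
    nlinarith
  have hs1 : s ≤ 1 := by nlinarith [mul_nonneg hGn hs0]
  have hεs : ε ≤ s := by rw [← hsε]; nlinarith
  -- The level inequality needs both `δ² ≤ D` and `Γ √ε ≤ D`.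
  set D := max (δ ^ 2) (Γ d * s) with hD
  have hD0 : 0 ≤ D := hΓs0.trans (le_max_right _ _)
  have hD1 : D ≤ 1 := max_le hδ1.le hΓ1.le
  have hDadd : D ≤ δ ^ 2 + Γ d * s := max_le (by linarith) (by linarith [sq_nonneg δ])
  set β := (50 * (d : ℝ)) ^ d with hβ
  have hβ0 : 0 ≤ β := by positivity
  have hlow : ∀ i, 1 ≤ i → 2 * i ≤ d → levelWeight μ i f ≤ ρ ^ (d - 2) / (d : ℝ) ^ 2 * Q ∨
      ρ ^ (2 * i) * levelWeight μ i f ≤ β * D * Q := by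
    intro i hi hid
    have key := hyp d V ε hε i (by omega) μ hμ h f hf δ D
      (max (ρ ^ (d - 2) / (d : ℝ) ^ 2) (β * D / ρ ^ (2 * i))) (hg.mono (by omega))
      (le_max_left _ _) hD1 (le_max_right _ _) (le_max_of_le_left (by positivity)) (by
        have := threshold_pow_le (by omega : 2 ≤ d) hid hi hρ hρ1 hD0
        rwa [show 2 * d - 1 + 2 = 2 * d + 1 by omega, show 2 * d - 1 + 1 = 2 * d by omega])
    rcases max_choice (ρ ^ (d - 2) / (d : ℝ) ^ 2) (β * D / ρ ^ (2 * i)) with hm | hm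
    · rw [hm] at key
      exact Or.inl key
    · rw [hm] at key
      refine Or.inr ((mul_le_mul_of_nonneg_left key (by positivity)).trans (le_of_eq ?_))
      rw [← mul_assoc, mul_div_cancel₀ _ (by positivity)]
  have hW0 : levelWeight μ 0 f ≤ D * Q := (levelWeight_zero_le hμ hf hg).trans
    (mul_le_mul_of_nonneg_right (le_max_left _ _) hQ0)
  have hsum := sum_pow_mul_le hd hρ hρ1 (fun i => levelWeight_nonneg hμ.1 i f) hQ0
    (mul_nonneg hD0 hQ0) (mul_nonneg (mul_nonneg hβ0 hD0) hQ0)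
    (mul_nonneg hC₀0 (mul_nonneg hε hQ0)) (sum_levelWeight_le hμ.1 hε h f) hW0 hlow
  have hnoise := normSq_noise_le_sum hμ.1 hε h f hρ.le hρ1.le
  have h1 : (d * β + 1) * D ≤ (100 * (d : ℝ)) ^ d * δ ^ 2 + G * s := by
    have := mul_le_mul (mul_pow_add_one_le d hd) hDadd hD0 (by positivity)
    linarith
  have h2 : C₀ * ε ≤ C₀ * s := mul_le_mul_of_nonneg_left hεs hC₀0
  have h3 : ρ ^ d + (d * β + 1) * D + 2 * (C₀ * ε) ≤
      ρ ^ d + (100 * (d : ℝ)) ^ d * δ ^ 2 + (G + 2 * C₀ + 1) * s := by linarith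
  refine le_trans ?_ (mul_le_mul_of_nonneg_right h3 hQ0)
  rw [← hC₀, ← hQ] at hnoise
  linarith

end Noise

end HDX

theorem mainTheorem4 (k : ℕ) :
    ∃ C : ℝ, 0 < C ∧
      ∀ (V : Fin k → Type*) [∀ i, Fintype (V i)] (μ : (∀ i, V i) → ℝ) (ε ρ : ℝ),
        μ ∈ stdSimplex ℝ (∀ i, V i) → 0 ≤ ε → HDX.IsEpsProduct ε μ → 0 < ρ → ρ < 1 →
          (∀ (f : (∀ i, V i) → ℝ) (x : ∀ i, V i),
            HDX.noise μ ρ f x =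
              ∑ S : Finset (Fin k), ρ ^ S.card * HDX.efronStein μ S f x) ∧
          ∀ (d : ℕ) (δ : ℝ) (f : (∀ i, V i) → ℝ),
            (∀ x, 0 < μ x → f x = 0 ∨ f x = 1) → HDX.IsGlobal μ d δ f →
              HDX.normSq μ (HDX.noise μ ρ f) ≤
                (ρ ^ d + (100 * (d : ℝ)) ^ d * δ ^ 2 + C * Real.sqrt ε) * HDX.normSq μ f ∧
              (1 - Real.sqrt (ρ ^ d + (100 * (d : ℝ)) ^ d * δ ^ 2 + C * Real.sqrt ε)) *
                  HDX.normSq μ f ≤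
                HDX.expect μ (fun x => f x * HDX.expect (HDX.noiseStep μ ρ x) (fun y => 1 - f y)) := by
  obtain ⟨C, hC, h⟩ := HDX.exists_normSq_noise_le k
  refine ⟨C, hC, fun V _ μ ε ρ hμ hε hp hρ hρ1 => ⟨HDX.noise_eq_sum_efronStein ρ, ?_⟩⟩
  intro d δ f hf hg
  have hB := h V μ ε ρ hμ hε hp hρ hρ1 d δ f hf hg
  exact ⟨hB, HDX.normSq_sub_le_expect_noiseStep hμ.1 hf (by positivity) hB⟩
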